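/- Let $(M^n,d,g,x)$, $n\ge 1$, be a compact Riemannian manifold with a single conical singularity at $x$. That is, $(M,d)$ is a compact metric space; $M\setminus\{x\}$ is a smooth $n$-dimensional manifold with a smooth Riemannian metric $g$ whose Riemannian distance is $d$; and there are a compact smooth $(n-1)$-manifold $N$, a neighbourhood $U_x$ of $x$ and $\epsilon_0>0$ such that $(U_x\setminus\{x\},g)$ is isometric to $((0,\epsilon_0)\times N,\ dr^2+r^2h_r)$, where $r\to0$ corresponds to the point $x$, and $h_r$ is a smooth family of Riemannian metrics on $N$ with $h_r=h_0+o(r^{\alpha})$ as $r\to 0$, uniformly on $N$, for some $\alpha>0$ and some smooth Riemannian metric $h_0$ on $N$. Let $\chi\in C^\infty(M\setminus\{x\})$ be a weight function: $0<\chi^{-1}\le 1$ everywhere, $\chi=1$ on $M\setminus U_x$, and $\chi=1/r$ at the points $(r,\theta)\in U_x$ with $r<\epsilon_0/4$. For $k\in\mathbb N=\{0,1,2,\dots\}$, $p>1$, $\delta\in\mathbb R$ and $u\in C_0^\infty(M\setminus\{x\})$ put $$\|u\|_{W^{k,p}(M)}=\Big(\int_M\sum_{i=0}^k|\nabla^iu|^p\,d\mathrm{vol}_g\Big)^{1/p},\qquad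 \|u\|_{W^{k,p}_\delta(M)}=\Big(\int_M\sum_{i=0}^k\chi^{p(\delta-i)+n}|\nabla^iu|^p\,d\mathrm{vol}_g\Big)^{1/p},$$ where $\nabla^i u$ is the $i$-th covariant derivative of $u$ with respect to the Levi-Civita connection of $g$. Let $W^{k,p}(M)$ and $W^{k,p}_\delta(M)$ be the completions of $C_0^\infty(M\setminus\{x\})$ with respect to these norms. Suppose that $p>1$ and $k\in\mathbb N$ satisfy $p\,i\ne n$ for all $i=1,\dots,k$. Then the two expressions, with $\delta=k-\frac np$, are homogeneous and subadditive on $C_0^\infty(M\setminus\{x\})$, so that the completions are meaningful, and there is a constant $C$, depending on the manifold with its conical neighbourhood, $\chi$, $p$ and $k$, but not on $u$, such that for all $u\in C^\infty_0(M\setminus\{x\})$ $$\|u\|_{W^{k,p}(M)}\ \le\ \|u\|_{W^{k,p}_{k-n/p}(M)}\ \le\ C\,\|u\|_{W^{k,p}(M)}.$$ Consequently $W^{k,p}_{k-n/p}(M)=W^{k,p}(M)$, in the sense that the identity of $C_0^\infty(M\setminus\{x\})$ extends to an isomorphism of topological vector spaces between the two completions. (No decay of the derivatives of $h_r-h_0$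 is assumed; in particular this covers the manifolds satisfying the higher order asymptotic condition $AC_{k-1}$, i.e. $r^{i-1}|\nabla^i(h_r-h_0)|\le C_i$ near $x$ for $1\le i\le k-1$.) -/

import Mathlib

open Set Filter Topology MeasureTheory Bundle
open scoped Manifold ContDiff

noncomputable section

namespace ConicalSobolev

/-! ### Riemannian metric, Levi-Civita connection and volume in charts -/

section Riemannian

variable {n : ℕ} {X : Type*} [TopologicalSpace X] [ChartedSpace (EuclideanSpace ℝ (Fin n)) X]

section Metric

variable [RiemannianBundle (fun y : X => TangentSpace (𝓡 n) y)]

/-- The Riemannian metric read in the preferred chart at `c`: the bilinear form `g_z(v, w)` at a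
point `z` of the chart's image. -/
def chartMetric (c : X) (z v w : EuclideanSpace ℝ (Fin n)) : ℝ :=
  inner ℝ
    (mfderiv (𝓡 n) (𝓡 n) (extChartAt (𝓡 n) c).symm z v :
      TangentSpace (𝓡 n) ((extChartAt (𝓡 n) c).symm z))
    (mfderiv (𝓡 n) (𝓡 n) (extChartAt (𝓡 n) c).symm z w :
      TangentSpace (𝓡 n) ((extChartAt (𝓡 n) c).symm z))

/-- The matrix `(g_{ab})` of the metric in the preferred chart at `c`. -/
def gram (c : X) (z : EuclideanSpace ℝ (Fin n)) : Matrix (Fin n) (Fin n) ℝ :=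
  Matrix.of fun a b =>
    chartMetric c z (EuclideanSpace.single a 1) (EuclideanSpace.single b 1)

/-- The Christoffel symbols of the first kind,
`Γ(v, w; ξ) = (∂_v g(w, ξ) + ∂_w g(v, ξ) - ∂_ξ g(v, w)) / 2`. -/
def christoffelFirst (c : X) (z v w ξ : EuclideanSpace ℝ (Fin n)) : ℝ :=
  (fderiv ℝ (fun z' => chartMetric c z' w ξ) z v
    + fderiv ℝ (fun z' => chartMetric c z' v ξ) z w
    - fderiv ℝ (fun z' => chartMetric c z' v w) z ξ) / 2

/-- The Christoffel symbols of the Levi-Civita connection, as the vector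
`Γ(v, w) = ∑ₐ (∑_b g^{ab} Γ(v, w; e_b)) eₐ`. -/
def christoffel (c : X) (z v w : EuclideanSpace ℝ (Fin n)) : EuclideanSpace ℝ (Fin n) :=
  WithLp.toLp 2
    (Matrix.mulVec (gram c z)⁻¹ fun b => christoffelFirst c z v w (EuclideanSpace.single b 1))

/-- The `i`-th Levi-Civita covariant derivative `∇ⁱu` of a function `u`, read in the preferred
chart at `c`, as a function of a point `z` and of `i` vectors:
`(∇ⁱ⁺¹u)(v₀, v₁, …, vᵢ) = ∂_{v₀} ((∇ⁱu)(v₁, …, vᵢ)) - ∑ⱼ (∇ⁱu)(v₁, …, Γ(v₀, vⱼ), …, vᵢ)`. -/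
def chartCovDeriv (c : X) (u : X → ℝ) :
    (i : ℕ) → EuclideanSpace ℝ (Fin n) → (Fin i → EuclideanSpace ℝ (Fin n)) → ℝ
  | 0 => fun z _ => u ((extChartAt (𝓡 n) c).symm z)
  | i + 1 => fun z v =>
      fderiv ℝ (fun z' => chartCovDeriv c u i z' (Fin.tail v)) z (v 0)
        - ∑ j : Fin i, chartCovDeriv c u i z
            (Function.update (Fin.tail v) j (christoffel c z (v 0) (Fin.tail v j)))

/-- The tensor `∇ⁱu` at the point `y`, evaluated on tangent vectors at `y`. -/
def covDeriv (u : X → ℝ) (i : ℕ) (y : X) (v : Fin i → TangentSpace (𝓡 n) y) : ℝ :=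
  chartCovDeriv y u i (extChartAt (𝓡 n) y y)
    fun j => mfderiv (𝓡 n) (𝓡 n) (extChartAt (𝓡 n) y) y (v j)

/-- The pointwise norm `|∇ⁱu|_g` at `y`: the square root of the sum of the squares of the
components of `∇ⁱu` in an orthonormal basis of the tangent space at `y`. -/
def covDerivNorm (u : X → ℝ) (i : ℕ) (y : X) : ℝ :=
  haveI : FiniteDimensional ℝ (TangentSpace (𝓡 n) y) :=
    inferInstanceAs (FiniteDimensional ℝ (EuclideanSpace ℝ (Fin n)))
  √(∑ f : Fin i → Fin (Module.finrank ℝ (TangentSpace (𝓡 n) y)),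
      covDeriv u i y (fun j => stdOrthonormalBasis ℝ (TangentSpace (𝓡 n) y) (f j)) ^ 2)

/-- The Riemannian volume measure `dvol_g`: the supremum over all charts of the measures
`√(det g) dz` on the image of the chart, transported to the manifold. These local measures agree on
overlaps, so on a second countable manifold the supremum is the measure that restricts to each of
them. -/
def riemannianVolume (n : ℕ) (X : Type*) [TopologicalSpace X]
    [ChartedSpace (EuclideanSpace ℝ (Fin n)) X]
    [RiemannianBundle (fun y : X => TangentSpace (𝓡 n) y)] [MeasurableSpace X] : Measure X :=
  ⨆ c : X,
    ((volume.restrict (extChartAt (𝓡 n) c).target).withDensity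
      fun z => ENNReal.ofReal √(gram (n := n) c z).det).map (extChartAt (𝓡 n) c).symm

end Metric

/-- The space `C₀^∞(X)` of compactly supported smooth real functions on the manifold `X`. -/
def TestFunctions (n : ℕ) (X : Type*) [TopologicalSpace X]
    [ChartedSpace (EuclideanSpace ℝ (Fin n)) X] : Submodule ℝ (X → ℝ) where
  carrier := {u | ContMDiff (𝓡 n) 𝓘(ℝ, ℝ) ∞ u ∧ HasCompactSupport u}
  zero_mem' := ⟨contMDiff_const, HasCompactSupport.zero⟩
  add_mem' := fun hu hv => ⟨hu.1.add hv.1, hu.2.add hv.2⟩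
  smul_mem' := fun a _ hu => ⟨(contMDiff_const (c := a)).mul hu.1, hu.2.mul_left (f := fun _ => a)⟩

variable [RiemannianBundle (fun y : X => TangentSpace (𝓡 n) y)] [MeasurableSpace X]

/-- The usual Sobolev norm `(∫ ∑_{i ≤ k} |∇ⁱu|^p dvol_g)^{1/p}`. -/
def sobolevNorm (k : ℕ) (p : ℝ) (u : TestFunctions n X) : ℝ :=
  (∫ y, ∑ i ∈ Finset.range (k + 1), covDerivNorm (n := n) (u : X → ℝ) i y ^ p
    ∂(riemannianVolume n X)) ^ (1 / p)

/-- The weighted Sobolev norm `(∫ ∑_{i ≤ k} χ^{p(δ - i) + n} |∇ⁱu|^p dvol_g)^{1/p}`. -/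
def weightedSobolevNorm (χ : X → ℝ) (k : ℕ) (p δ : ℝ) (u : TestFunctions n X) : ℝ :=
  (∫ y, ∑ i ∈ Finset.range (k + 1),
      χ y ^ (p * (δ - i) + n) * covDerivNorm (n := n) (u : X → ℝ) i y ^ p
    ∂(riemannianVolume n X)) ^ (1 / p)

end Riemannian

/-! ### Completion with respect to a norm given by a formula -/

section Completion

variable {V : Type*} [AddCommGroup V] [Module ℝ V]

open Classical in
/-- The function `N`, as a (semi)norm on `V`; the zero seminorm if `N` is not a seminorm. -/
def formulaSeminorm (N : V → ℝ) : Seminorm ℝ V :=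
  if h : ∃ q : Seminorm ℝ V, ∀ u, q u = N u then h.choose else 0

/-- A copy of the vector space `V`, normed by `N`. -/
def Normed (_N : V → ℝ) : Type _ := V

instance (N : V → ℝ) : SeminormedAddCommGroup (Normed N) :=
  (formulaSeminorm N).toSeminormedAddCommGroup

instance (N : V → ℝ) : Module ℝ (Normed N) := inferInstanceAs (Module ℝ V)

instance (N : V → ℝ) : NormedSpace ℝ (Normed N) where
  toModule := inferInstance
  norm_smul_le a u := (map_smul_eq_mul (formulaSeminorm N) a u).le

/-- The completion of `V` with respect to the norm `N`. -/
abbrev NormCompletion (N : V → ℝ) : Type _ := UniformSpace.Completion (Normed N)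

/-- The canonical map of `V` into its completion with respect to the norm `N`. -/
def toCompletion (N : V → ℝ) (u : V) : NormCompletion N :=
  UniformSpace.Completion.coe' (show Normed N from u)

end Completion

section Spaces

variable (n : ℕ) (X : Type*) [TopologicalSpace X] [ChartedSpace (EuclideanSpace ℝ (Fin n)) X]
  [RiemannianBundle (fun y : X => TangentSpace (𝓡 n) y)] [MeasurableSpace X]

/-- The Sobolev space `W^{k,p}`: the completion of `C₀^∞` in the usual Sobolev norm. -/
abbrev SobolevSpace (k : ℕ) (p : ℝ) : Type _ :=
  NormCompletion (sobolevNorm (n := n) (X := X) k p)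

/-- The weighted Sobolev space `W^{k,p}_δ`: the completion of `C₀^∞` in the weighted norm. -/
abbrev WeightedSobolevSpace (χ : X → ℝ) (k : ℕ) (p δ : ℝ) : Type _ :=
  NormCompletion (weightedSobolevNorm (n := n) (X := X) χ k p δ)

end Spaces

/-! ### Conical singularities -/

section Conical

variable {m : ℕ} {M : Type*} [MetricSpace M] (x : M)
  [ChartedSpace (EuclideanSpace ℝ (Fin (m + 1))) {y : M // y ≠ x}]
  [RiemannianBundle (fun y : {y : M // y ≠ x} => TangentSpace (𝓡 (m + 1)) y)]
  (N : Type*) [TopologicalSpace N] [ChartedSpace (EuclideanSpace ℝ (Fin m)) N]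
  [IsManifold (𝓡 m) ∞ N]

/-- A conical neighbourhood `U` of the point `x` with cross section `N`: the Riemannian manifold
`U \ {x}` is isometric to `(0, ε) × N` with the metric `dr² + r² h_r`, where `r → 0` corresponds to
the point `x`, and `h_r = h₀ + o(r^α)` as `r → 0` for some `α > 0`, uniformly on `N`.
The smooth dependence of `h_r` on `r ∈ (0, ε)` is contained in `smooth_param` and `isometry`. -/
structure ConicalNeighborhood where
  /-- The length `ε` of the neighbourhood. -/
  ε : ℝ
  ε_pos : 0 < ε
  /-- The metrics `h_r` on the cross section, for `0 ≤ r < ε`. -/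
  h : ℝ → ContMDiffRiemannianMetric (𝓡 m) ∞ (EuclideanSpace ℝ (Fin m))
    (fun θ : N => TangentSpace (𝓡 m) θ)
  /-- The coordinates `(r, θ)`, as a diffeomorphism of `(0, ε) × N` onto `U \ {x}`. -/
  param : OpenPartialHomeomorph (ℝ × N) {y : M // y ≠ x}
  source_eq : param.source = Ioo 0 ε ×ˢ univ
  smooth_param : ContMDiffOn (𝓘(ℝ, ℝ).prod (𝓡 m)) (𝓡 (m + 1)) ∞ param param.source
  smooth_symm : ContMDiffOn (𝓡 (m + 1)) (𝓘(ℝ, ℝ).prod (𝓡 m)) ∞ param.symm param.target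
  /-- The metric is `dr² + r² h_r`. -/
  isometry : ∀ r ∈ Ioo 0 ε, ∀ (θ : N) (a b : ℝ) (v w : TangentSpace (𝓡 m) θ),
    inner ℝ
      (mfderiv (𝓘(ℝ, ℝ).prod (𝓡 m)) (𝓡 (m + 1)) param (r, θ) (a, v) :
        TangentSpace (𝓡 (m + 1)) (param (r, θ)))
      (mfderiv (𝓘(ℝ, ℝ).prod (𝓡 m)) (𝓡 (m + 1)) param (r, θ) (b, w) :
        TangentSpace (𝓡 (m + 1)) (param (r, θ)))
      = a * b + r ^ 2 * (h r).inner θ v w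
  /-- A point of `M \ {x}` tends to `x` if and only if its radial coordinate tends to `0`. In
  particular `U` is a neighbourhood of `x`. -/
  vertex : comap Subtype.val (𝓝 x) = map param (𝓝[>] 0 ×ˢ ⊤)
  /-- The metrics `h_r` converge to `h₀` at the rate `o(r^α)`. -/
  asymptotic : ∃ α : ℝ, 0 < α ∧ ∀ c : ℝ, 0 < c → ∀ᶠ r in 𝓝[>] (0 : ℝ),
    ∀ (θ : N) (v : TangentSpace (𝓡 m) θ),
      |(h r).inner θ v v - (h 0).inner θ v v| ≤ c * r ^ α * (h 0).inner θ v v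

variable {x N}

/-- A weight function for the conical neighbourhood `U`: smooth and positive on `M \ {x}`, equal to
`1` outside `U` and to `1 / r` where `r < ε / 4`, and with `0 < χ⁻¹ ≤ 1`. -/
structure ConicalNeighborhood.IsWeight (U : ConicalNeighborhood (m := m) x N)
    (χ : {y : M // y ≠ x} → ℝ) : Prop where
  smooth : ContMDiff (𝓡 (m + 1)) 𝓘(ℝ, ℝ) ∞ χ
  eq_one : ∀ y ∉ U.param.target, χ y = 1
  eq_inv : ∀ r θ, 0 < r → r < U.ε / 4 → χ (U.param (r, θ)) = 1 / r
  inv_pos : ∀ y, 0 < (χ y)⁻¹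
  inv_le_one : ∀ y, (χ y)⁻¹ ≤ 1

end Conical

end ConicalSobolev

end

/-! Write n = m + 1. For δ = k - n/p the weight exponent p(δ - i) + n equals p(k - i), which is
nonnegative for i ≤ k. Since χ ≥ 1, the unweighted norm is bounded by the weighted one integrand by
integrand.

The reverse bound is an iterated Hardy inequality (`exists_hardy`): for s ≥ 0 with ps ≠ n, the
integral of χ^{ps}|∇ⁱu|^p is at most a constant times the sum of the integrals of
χ^{p(s-1)}|∇ⁱ⁺¹u|^p and of |∇ⁱu|^p. Each application lowers the weight by one and raises the order
of the derivative by one. Starting from s = k - i, after k - i applications only unweighted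
integrals of derivatives of order at most k remain (`exists_weightedEnergy_le`). The values of s
that occur are 1, …, k - i, whence the condition pi ≠ n.

The Hardy inequality is proved ray by ray. Along a generator of the cone, f = |∇ⁱu| is compared with
|∇ⁱ⁺¹u| by Kato's inequality (`hasDerivAt_covDerivNorm_radial`), and the one-dimensional
`hardy_lintegral` is applied with the weight r^{a-1}, a = n - ps ≠ 0. Both signs of a are allowed
because u vanishes near the vertex. A cutoff disposes of the outer endpoint at the price of an
unweighted term. To pass between the ray and the manifold it is enough that the volume density is
comparable to r^m times a function of the angle (`coneDensity_le`), which uses only that the metrics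
h_r are mutually comparable for small r. Kato's inequality holds for the true connection of g, so no
derivative of h_r - h_0 enters.

Kato's inequality is obtained at a point by differentiating the squared norm in a frame that is
parallel to first order along the line: the Gram matrix then has zero derivative and only the
components of ∇ⁱu contribute (`IsMetricOn.hasDerivAt_normSq`). The norm itself need not be
differentiable at its zeros, but its p-th power is, as p > 1.

The covariant derivatives and the volume are defined through preferred charts, while the argument
needs conical coordinates. Independence of coordinates is the naturality of ∇ⁱ under changes of
variables (`IsMetricOn.covT_pull`, `covDerivNorm_eq`) and the change of variables formula for the
volume (`setLIntegral_riemannianVolume`). Minkowski's inequality shows that both expressions are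
seminorms, and comparable seminorms have isomorphic completions (`exists_completion_equiv`). -/

noncomputable section

namespace ConicalSobolev

/-! ### Local Riemannian geometry on open subsets of a vector space -/

section LocalGeometry

set_option maxSynthPendingDepth 3
set_option linter.unusedSectionVars false

variable {E : Type*} [NormedAddCommGroup E] [NormedSpace ℝ E]
  {E' : Type*} [NormedAddCommGroup E'] [NormedSpace ℝ E']

/-- A field of bilinear forms which is a smooth Riemannian metric on the open set `Ω`. -/
structure IsMetricOn (B : E → E →L[ℝ] E →L[ℝ] ℝ) (Ω : Set E) : Prop where
  isOpen : IsOpen Ω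
  smooth : ContDiffOn ℝ ∞ B Ω
  symm : ∀ z ∈ Ω, ∀ v w, B z v w = B z w v
  pos : ∀ z ∈ Ω, ∀ v, v ≠ 0 → 0 < B z v v

/-- The Christoffel symbols of the first kind, as a trilinear map. -/
def christLower (B : E → E →L[ℝ] E →L[ℝ] ℝ) (z : E) : E →L[ℝ] E →L[ℝ] E →L[ℝ] ℝ :=
  (1 / 2 : ℝ) • (fderiv ℝ B z + (fderiv ℝ B z).flip
    - (ContinuousLinearMap.flipₗᵢ ℝ E E ℝ).toContinuousLinearEquiv.toContinuousLinearMap ∘L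
        (fderiv ℝ B z).flip)

lemma christLower_apply (B : E → E →L[ℝ] E →L[ℝ] ℝ) (z v w ξ : E) :
    christLower B z v w ξ
      = (fderiv ℝ B z v w ξ + fderiv ℝ B z w v ξ - fderiv ℝ B z ξ v w) / 2 := by
  simp [christLower]; ring

/-- The Christoffel symbols of the Levi-Civita connection of `B`. -/
def christ (B : E → E →L[ℝ] E →L[ℝ] ℝ) (z : E) : E →L[ℝ] E →L[ℝ] E :=
  ContinuousLinearMap.compL ℝ E (E →L[ℝ] ℝ) E (B z).inverse ∘L christLower B z

lemma christ_apply (B : E → E →L[ℝ] E →L[ℝ] ℝ) (z v w : E) :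
    christ B z v w = (B z).inverse (christLower B z v w) := rfl

/-- The derivation `ξ ↦ ∑ⱼ T(·, …, Γ(ξ, ·), …, ·)` on multilinear maps. -/
def christAction (Γ : E →L[ℝ] E →L[ℝ] E) {i : ℕ} (T : E [×i]→L[ℝ] ℝ) : E →L[ℝ] E [×i]→L[ℝ] ℝ :=
  T.fderivCompContinuousLinearMap (fun _ => ContinuousLinearMap.id ℝ E) ∘L
    ContinuousLinearMap.pi fun _ => Γ

lemma christAction_apply (Γ : E →L[ℝ] E →L[ℝ] E) {i : ℕ} (T : E [×i]→L[ℝ] ℝ) (ξ : E)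
    (v : Fin i → E) :
    christAction Γ T ξ v = ∑ j, T (Function.update v j (Γ ξ (v j))) := by
  simp only [christAction, ContinuousLinearMap.comp_apply,
    ContinuousMultilinearMap.fderivCompContinuousLinearMap_apply]
  refine Finset.sum_congr rfl fun j _ => congrArg T (funext fun l => ?_)
  rcases eq_or_ne l j with rfl | h
  · simp
  · simp [h]

/-- The iterated covariant derivatives of the function `f` with respect to the Levi-Civita
connection of `B`. -/
def covT (B : E → E →L[ℝ] E →L[ℝ] ℝ) (f : E → ℝ) : (i : ℕ) → E → E [×i]→L[ℝ] ℝ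
  | 0 => fun z => ContinuousMultilinearMap.constOfIsEmpty ℝ (fun _ => E) (f z)
  | i + 1 => fun z =>
      (fderiv ℝ (covT B f i) z - christAction (christ B z) (covT B f i z)).uncurryLeft

lemma covT_zero_apply (B : E → E →L[ℝ] E →L[ℝ] ℝ) (f : E → ℝ) (z : E) (v : Fin 0 → E) :
    covT B f 0 z v = f z := rfl

lemma covT_succ_apply (B : E → E →L[ℝ] E →L[ℝ] ℝ) (f : E → ℝ) (i : ℕ) (z : E)
    (v : Fin (i + 1) → E) :
    covT B f (i + 1) z v = fderiv ℝ (covT B f i) z (v 0) (Fin.tail v)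
      - ∑ j, covT B f i z (Function.update (Fin.tail v) j (christ B z (v 0) (Fin.tail v j))) := by
  simp [covT, christAction_apply, ContinuousLinearMap.uncurryLeft_apply]

/-- Currying off one argument at a time reduces this to `contDiffOn_clm_apply`, which is where the
finite dimension of `E'` is needed. -/
lemma contDiffOn_continuousMultilinearMap_apply [FiniteDimensional ℝ E'] {n : ℕ∞ω}
    {s : Set E} : ∀ {i : ℕ} {T : E → E' [×i]→L[ℝ] ℝ},
    (∀ v, ContDiffOn ℝ n (fun z => T z v) s) → ContDiffOn ℝ n T s := by
  intro i
  induction i with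
  | zero =>
    intro T h
    have : T = fun z => (continuousMultilinearCurryFin0 ℝ E' ℝ).symm (T z 0) := by
      funext z; ext v
      simp [Subsingleton.elim v 0]
    rw [this]
    exact (continuousMultilinearCurryFin0 ℝ E' ℝ).symm.contDiff.comp_contDiffOn (h 0)
  | succ i ih =>
    intro T h
    have h1 : ContDiffOn ℝ n (fun z => (T z).curryLeft) s := by
      rw [contDiffOn_clm_apply]
      intro a
      refine ih fun v => ?_
      simpa using h (Fin.cons a v)
    have : T = fun z =>
        (continuousMultilinearCurryLeftEquiv ℝ (fun _ : Fin (i + 1) => E') ℝ).symm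
          ((T z).curryLeft) := by
      funext z
      exact ((continuousMultilinearCurryLeftEquiv ℝ (fun _ : Fin (i + 1) => E')
        ℝ).symm_apply_apply (T z)).symm
    rw [this]
    exact (continuousMultilinearCurryLeftEquiv ℝ (fun _ : Fin (i + 1) => E')
      ℝ).symm.contDiff.comp_contDiffOn h1

variable [FiniteDimensional ℝ E] [FiniteDimensional ℝ E']

/-- Positivity gives injectivity, and `E` has the dimension of its dual. Needed because `christ` is
built from `inverse`, which is zero at maps that are not invertible. -/
lemma IsMetricOn.isInvertible {B : E → E →L[ℝ] E →L[ℝ] ℝ} {Ω : Set E} (hB : IsMetricOn B Ω)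
    {z : E} (hz : z ∈ Ω) : (B z).IsInvertible := by
  have hinj : Function.Injective (B z).toLinearMap := by
    rw [← LinearMap.ker_eq_bot, LinearMap.ker_eq_bot']
    intro v hv
    by_contra hne
    have := hB.pos z hz v hne
    have h2 : B z v = 0 := hv
    simp [h2] at this
  have hfr : Module.finrank ℝ E = Module.finrank ℝ (E →L[ℝ] ℝ) := by
    rw [← (LinearMap.toContinuousLinearMap (𝕜 := ℝ) (E := E) (F' := ℝ)).finrank_eq]
    exact (Subspace.dual_finrank_eq (K := ℝ) (V := E)).symm
  refine ⟨(LinearEquiv.ofInjectiveOfFinrankEq (B z).toLinearMap hinj hfr).toContinuousLinearEquiv,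
    ?_⟩
  ext v w
  rfl

/-- The Koszul formula. With the index lowered no inverse occurs, so identities between Christoffel
symbols become linear algebra, to be concluded by `IsMetricOn.eq_of_forall`. -/
lemma IsMetricOn.apply_christ {B : E → E →L[ℝ] E →L[ℝ] ℝ} {Ω : Set E} (hB : IsMetricOn B Ω)
    {z : E} (hz : z ∈ Ω) (v w ξ : E) :
    B z (christ B z v w) ξ
      = (fderiv ℝ B z v w ξ + fderiv ℝ B z w v ξ - fderiv ℝ B z ξ v w) / 2 := by
  rw [christ_apply, ← christLower_apply]
  obtain ⟨e, he⟩ := hB.isInvertible hz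
  rw [← he]
  simp

lemma IsMetricOn.eq_of_forall {B : E → E →L[ℝ] E →L[ℝ] ℝ} {Ω : Set E} (hB : IsMetricOn B Ω)
    {z : E} (hz : z ∈ Ω) {v w : E} (h : ∀ ξ, B z v ξ = B z w ξ) : v = w := by
  by_contra hne
  have h1 := hB.pos z hz (v - w) (sub_ne_zero.2 hne)
  have h2 := h (v - w)
  have h3 : B z (v - w) (v - w) = B z v (v - w) - B z w (v - w) := by
    rw [map_sub (B z), _root_.sub_apply]
  rw [h3, h2, sub_self] at h1
  exact lt_irrefl _ h1

lemma IsMetricOn.contDiffOn_christ {B : E → E →L[ℝ] E →L[ℝ] ℝ} {Ω : Set E}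
    (hB : IsMetricOn B Ω) : ContDiffOn ℝ ∞ (christ B) Ω := by
  have hD : ContDiffOn ℝ ∞ (fderiv ℝ B) Ω :=
    hB.smooth.fderiv_of_isOpen hB.isOpen (by simp)
  have hinv : ContDiffOn ℝ ∞ (fun z => (B z).inverse) Ω := fun z hz =>
    (hB.isInvertible hz).contDiffAt_map_inverse.comp_contDiffWithinAt z (hB.smooth z hz)
  rw [contDiffOn_clm_apply]
  intro v
  rw [contDiffOn_clm_apply]
  intro w
  have h1 : ContDiffOn ℝ ∞ (fun z => christLower B z v w) Ω := by
    rw [contDiffOn_clm_apply]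
    intro ξ
    simp only [christLower_apply]
    have key : ∀ a b c : E, ContDiffOn ℝ ∞ (fun z => fderiv ℝ B z a b c) Ω := fun a b c =>
      ((hD.clm_apply contDiffOn_const).clm_apply contDiffOn_const).clm_apply contDiffOn_const
    exact (((key v w ξ).add (key w v ξ)).sub (key ξ v w)).div_const 2
  exact hinv.clm_apply h1

lemma contDiffOn_multilinear_apply {n : ℕ∞ω} {i : ℕ} {s : Set E'}
    {T : E' → E [×i]→L[ℝ] ℝ} {V : E' → Fin i → E} (hT : ContDiffOn ℝ n T s)
    (hV : ContDiffOn ℝ n V s) : ContDiffOn ℝ n (fun z => T z (V z)) s := by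
  induction i with
  | zero =>
    have : (fun z => T z (V z)) = fun z => ContinuousMultilinearMap.apply ℝ (fun _ => E) ℝ 0 (T z) := by
      funext z; simp [Subsingleton.elim (V z) 0]
    rw [this]
    exact (ContinuousLinearMap.contDiff _).comp_contDiffOn hT
  | succ i ih =>
    have h1 : ContDiffOn ℝ n (fun z => (T z).curryLeft) s :=
      ContDiff.comp_contDiffOn
        (continuousMultilinearCurryLeftEquiv ℝ (fun _ : Fin (i + 1) => E) ℝ).contDiff hT
    have h2 := contDiffOn_pi.1 hV
    have h3 := ih (h1.clm_apply (h2 0)) (V := fun z => Fin.tail (V z))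
      (contDiffOn_pi.2 fun j => h2 j.succ)
    refine h3.congr fun z _ => ?_
    simp

lemma IsMetricOn.contDiffOn_covT {B : E → E →L[ℝ] E →L[ℝ] ℝ} {Ω : Set E} (hB : IsMetricOn B Ω)
    {f : E → ℝ} (hf : ContDiffOn ℝ ∞ f Ω) (i : ℕ) : ContDiffOn ℝ ∞ (covT B f i) Ω := by
  induction i with
  | zero =>
    exact contDiffOn_continuousMultilinearMap_apply fun v => hf
  | succ i ih =>
    refine contDiffOn_continuousMultilinearMap_apply fun v => ?_
    simp only [covT_succ_apply]
    have hD : ContDiffOn ℝ ∞ (fderiv ℝ (covT B f i)) Ω := ih.fderiv_of_isOpen hB.isOpen (by simp)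
    refine ContDiffOn.sub ?_ (ContDiffOn.sum fun j _ => ?_)
    · exact contDiffOn_multilinear_apply (hD.clm_apply contDiffOn_const)
        contDiffOn_const
    · refine contDiffOn_multilinear_apply ih (contDiffOn_pi.2 fun l => ?_)
      rcases eq_or_ne l j with rfl | h
      · simpa using (hB.contDiffOn_christ.clm_apply contDiffOn_const).clm_apply contDiffOn_const
      · simpa [h] using contDiffOn_const

/-- Locality of ∇ⁱ in the metric and in the function; it is what makes ∇ⁱu vanish off the support of
u. -/
lemma covT_congr {B B' : E → E →L[ℝ] E →L[ℝ] ℝ} {f f' : E → ℝ} {z : E}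
    (hB : B =ᶠ[𝓝 z] B') (hf : f =ᶠ[𝓝 z] f') (i : ℕ) :
    covT B f i =ᶠ[𝓝 z] covT B' f' i := by
  have hΓ : ∀ᶠ y in 𝓝 z, christ B y = christ B' y := by
    filter_upwards [eventually_eventually_nhds.2 hB] with y hy
    have h1 : fderiv ℝ B y = fderiv ℝ B' y := Filter.EventuallyEq.fderiv_eq hy
    have h2 : B y = B' y := hy.self_of_nhds
    simp only [christ, christLower, h1, h2]
  induction i with
  | zero => filter_upwards [hf] with y hy; simp [covT, hy]
  | succ i ih =>
    filter_upwards [hΓ, eventually_eventually_nhds.2 ih] with y hy h2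
    have h1 : fderiv ℝ (covT B f i) y = fderiv ℝ (covT B' f' i) y :=
      Filter.EventuallyEq.fderiv_eq h2
    have h3 : covT B f i y = covT B' f' i y := h2.self_of_nhds
    simp only [covT, hy, h1, h3]

lemma covT_zero_fun (B : E → E →L[ℝ] E →L[ℝ] ℝ) (i : ℕ) : covT B (fun _ => 0) i = 0 := by
  induction i with
  | zero => funext z; ext v; simp [covT]
  | succ i ih =>
    funext z; ext v
    simp [covT_succ_apply, ih]

lemma IsMetricOn.covT_add {B : E → E →L[ℝ] E →L[ℝ] ℝ} {Ω : Set E} (hB : IsMetricOn B Ω)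
    {f f' : E → ℝ} (hf : ContDiffOn ℝ ∞ f Ω) (hf' : ContDiffOn ℝ ∞ f' Ω) (i : ℕ) :
    ∀ z ∈ Ω, covT B (fun y => f y + f' y) i z = covT B f i z + covT B f' i z := by
  induction i with
  | zero => intro z hz; ext v; simp [covT]
  | succ i ih =>
    intro z hz
    have hΩ : Ω ∈ 𝓝 z := hB.isOpen.mem_nhds hz
    have h1 : fderiv ℝ (covT B (fun y => f y + f' y) i) z
        = fderiv ℝ (covT B f i) z + fderiv ℝ (covT B f' i) z := by
      rw [Filter.EventuallyEq.fderiv_eq (f := fun y => covT B f i y + covT B f' i y)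
        (Filter.mem_of_superset hΩ fun y hy => ih y hy)]
      exact fderiv_add
        (((hB.contDiffOn_covT hf i).contDiffAt hΩ).differentiableAt (by simp))
        (((hB.contDiffOn_covT hf' i).contDiffAt hΩ).differentiableAt (by simp))
    ext v
    simp only [covT_succ_apply, h1, ih z hz, _root_.add_apply,
      Finset.sum_add_distrib]
    ring

lemma IsMetricOn.covT_smul {B : E → E →L[ℝ] E →L[ℝ] ℝ} {Ω : Set E} (hB : IsMetricOn B Ω)
    {f : E → ℝ} (hf : ContDiffOn ℝ ∞ f Ω) (a : ℝ) (i : ℕ) :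
    ∀ z ∈ Ω, covT B (fun y => a * f y) i z = a • covT B f i z := by
  induction i with
  | zero => intro z hz; ext v; simp [covT]
  | succ i ih =>
    intro z hz
    have hΩ : Ω ∈ 𝓝 z := hB.isOpen.mem_nhds hz
    have h1 : fderiv ℝ (covT B (fun y => a * f y) i) z = a • fderiv ℝ (covT B f i) z := by
      rw [Filter.EventuallyEq.fderiv_eq (f := fun y => a • covT B f i y)
        (Filter.mem_of_superset hΩ fun y hy => ih y hy)]
      exact fderiv_const_smul
        (((hB.contDiffOn_covT hf i).contDiffAt hΩ).differentiableAt (by simp)) a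
    ext v
    simp only [covT_succ_apply, h1, ih z hz, _root_.smul_apply,
      smul_eq_mul, ← Finset.mul_sum]
    ring

/-- Chain and product rule for the pulled-back metric. The two terms with the second derivative of Φ
are the source of the inhomogeneous term in the law for Christoffel symbols. -/
lemma fderiv_pull_apply {B : E → E →L[ℝ] E →L[ℝ] ℝ} {B' : E' → E' →L[ℝ] E' →L[ℝ] ℝ}
    {Φ : E' → E} {z : E'} (hBd : DifferentiableAt ℝ B (Φ z)) (hBd' : DifferentiableAt ℝ B' z)
    (hΦ : ContDiffAt ℝ ∞ Φ z)
    (hpull : ∀ᶠ y in 𝓝 z, ∀ v w, B' y v w = B (Φ y) (fderiv ℝ Φ y v) (fderiv ℝ Φ y w))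
    (a v w : E') :
    fderiv ℝ B' z a v w
      = fderiv ℝ B (Φ z) (fderiv ℝ Φ z a) (fderiv ℝ Φ z v) (fderiv ℝ Φ z w)
        + B (Φ z) (fderiv ℝ (fderiv ℝ Φ) z a v) (fderiv ℝ Φ z w)
        + B (Φ z) (fderiv ℝ Φ z v) (fderiv ℝ (fderiv ℝ Φ) z a w) := by
  have hdΦ : DifferentiableAt ℝ Φ z := hΦ.differentiableAt (by simp)
  have hddΦ : DifferentiableAt ℝ (fderiv ℝ Φ) z :=
    (hΦ.fderiv_right (m := ∞) (by simp)).differentiableAt (by simp)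
  have e1 : HasFDerivAt (fun y => B' y v w)
      ((ContinuousLinearMap.apply ℝ ℝ w ∘L ContinuousLinearMap.apply ℝ _ v) ∘L fderiv ℝ B' z) z :=
    (ContinuousLinearMap.apply ℝ ℝ w ∘L ContinuousLinearMap.apply ℝ _ v).hasFDerivAt.comp z
      hBd'.hasFDerivAt
  have hV : ∀ v : E', HasFDerivAt (fun y => fderiv ℝ Φ y v)
      (ContinuousLinearMap.apply ℝ _ v ∘L fderiv ℝ (fderiv ℝ Φ) z) z := fun v =>
    (ContinuousLinearMap.apply ℝ E v).hasFDerivAt.comp z hddΦ.hasFDerivAt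
  have e2 := ((hBd.hasFDerivAt.comp z hdΦ.hasFDerivAt).clm_apply (hV v)).clm_apply (hV w)
  have e3 : HasFDerivAt (fun y => B (Φ y) (fderiv ℝ Φ y v) (fderiv ℝ Φ y w)) _ z :=
    e1.congr_of_eventuallyEq (hpull.mono fun y hy => (hy v w).symm)
  have := congrArg (fun L => L a) (e3.unique e2)
  simp at this
  rw [this]
  ring

/-- The transformation law of the Christoffel symbols. -/
lemma IsMetricOn.christ_pull {B : E → E →L[ℝ] E →L[ℝ] ℝ} {Ω : Set E} (hB : IsMetricOn B Ω)
    {B' : E' → E' →L[ℝ] E' →L[ℝ] ℝ} {Ω' : Set E'} (hB' : IsMetricOn B' Ω') {Φ : E' → E}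
    (hΦ : ContDiffOn ℝ ∞ Φ Ω') (hmaps : MapsTo Φ Ω' Ω)
    (hsurj : ∀ z ∈ Ω', Function.Surjective (fderiv ℝ Φ z))
    (hpull : ∀ z ∈ Ω', ∀ v w, B' z v w = B (Φ z) (fderiv ℝ Φ z v) (fderiv ℝ Φ z w))
    {z : E'} (hz : z ∈ Ω') (v w : E') :
    fderiv ℝ Φ z (christ B' z v w)
      = fderiv ℝ (fderiv ℝ Φ) z v w + christ B (Φ z) (fderiv ℝ Φ z v) (fderiv ℝ Φ z w) := by
  have hΩ' : Ω' ∈ 𝓝 z := hB'.isOpen.mem_nhds hz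
  have hΩ : Ω ∈ 𝓝 (Φ z) := hB.isOpen.mem_nhds (hmaps hz)
  have hΦz := hΦ.contDiffAt hΩ'
  have hsym : ∀ a b, fderiv ℝ (fderiv ℝ Φ) z a b = fderiv ℝ (fderiv ℝ Φ) z b a := fun a b =>
    (hΦz.isSymmSndFDerivAt (by simpa using WithTop.coe_le_coe.2 (le_top (a := (2 : ℕ∞))))) a b
  have hD := fderiv_pull_apply ((hB.smooth.contDiffAt hΩ).differentiableAt (by simp))
    ((hB'.smooth.contDiffAt hΩ').differentiableAt (by simp)) hΦz
    (Filter.mem_of_superset hΩ' fun y hy => hpull y hy)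
  -- Test against ξ = dΦ(η), which is every vector by surjectivity. In the Koszul combination the
  -- symmetry of D²Φ cancels all second-order terms except two copies of B(D²Φ(v, w), dΦ η).
  refine hB.eq_of_forall (hmaps hz) fun ξ => ?_
  obtain ⟨η, rfl⟩ := hsurj z hz ξ
  rw [← hpull z hz, hB'.apply_christ hz, map_add, _root_.add_apply,
    hB.apply_christ (hmaps hz), hD, hD, hD, hsym w v, hsym η v, hsym η w,
    hB.symm _ (hmaps hz) (fderiv ℝ Φ z w) (fderiv ℝ (fderiv ℝ Φ) z v η)]
  ring

/-- Naturality of the iterated covariant derivatives. -/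
lemma IsMetricOn.covT_pull {B : E → E →L[ℝ] E →L[ℝ] ℝ} {Ω : Set E} (hB : IsMetricOn B Ω)
    {B' : E' → E' →L[ℝ] E' →L[ℝ] ℝ} {Ω' : Set E'} (hB' : IsMetricOn B' Ω') {Φ : E' → E}
    (hΦ : ContDiffOn ℝ ∞ Φ Ω') (hmaps : MapsTo Φ Ω' Ω)
    (hsurj : ∀ z ∈ Ω', Function.Surjective (fderiv ℝ Φ z))
    (hpull : ∀ z ∈ Ω', ∀ v w, B' z v w = B (Φ z) (fderiv ℝ Φ z v) (fderiv ℝ Φ z w))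
    {f : E → ℝ} (hf : ContDiffOn ℝ ∞ f Ω) {f' : E' → ℝ} (hf' : ∀ z ∈ Ω', f' z = f (Φ z))
    (i : ℕ) : ∀ z ∈ Ω', ∀ v, covT B' f' i z v = covT B f i (Φ z) (fun j => fderiv ℝ Φ z (v j)) := by
  have hfc : ContDiffOn ℝ ∞ f' Ω' := (hf.comp hΦ hmaps).congr hf'
  induction i with
  | zero => intro z hz v; simp [covT_zero_apply, hf' z hz]
  | succ i ih =>
    intro z hz v
    have hΩ' : Ω' ∈ 𝓝 z := hB'.isOpen.mem_nhds hz
    have hΩ : Ω ∈ 𝓝 (Φ z) := hB.isOpen.mem_nhds (hmaps hz)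
    have hΦz := hΦ.contDiffAt hΩ'
    have hdΦ : DifferentiableAt ℝ Φ z := hΦz.differentiableAt (by simp)
    have hddΦ : DifferentiableAt ℝ (fderiv ℝ Φ) z :=
      (hΦz.fderiv_right (m := ∞) (by simp)).differentiableAt (by simp)
    have hT : DifferentiableAt ℝ (covT B f i) (Φ z) :=
      ((hB.contDiffOn_covT hf i).contDiffAt hΩ).differentiableAt (by simp)
    have hT' : DifferentiableAt ℝ (covT B' f' i) z :=
      ((hB'.contDiffOn_covT hfc i).contDiffAt hΩ').differentiableAt (by simp)
    have hV : ∀ v : E', HasFDerivAt (fun y => fderiv ℝ Φ y v)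
        (ContinuousLinearMap.apply ℝ _ v ∘L fderiv ℝ (fderiv ℝ Φ) z) z := fun v =>
      (ContinuousLinearMap.apply ℝ E v).hasFDerivAt.comp z hddΦ.hasFDerivAt
    have e1 := hT'.hasFDerivAt.continuousMultilinear_apply_const (Fin.tail v)
    have e2 := HasFDerivAt.continuousMultilinearMap_apply
      (hT.hasFDerivAt.comp z hdΦ.hasFDerivAt) (fun j => hV (Fin.tail v j))
    have e3 := e1.congr_of_eventuallyEq
      (Filter.mem_of_superset hΩ' fun y hy => (ih y hy (Fin.tail v)).symm)
    have e4 := congrArg (fun L => L (v 0)) (e3.unique e2)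
    have e5 : fderiv ℝ (covT B' f' i) z (v 0) (Fin.tail v)
        = fderiv ℝ (covT B f i) (Φ z) (fderiv ℝ Φ z (v 0)) (fun j => fderiv ℝ Φ z (Fin.tail v j))
          + ∑ j, covT B f i (Φ z) (Function.update (fun j => fderiv ℝ Φ z (Fin.tail v j)) j
              (fderiv ℝ (fderiv ℝ Φ) z (v 0) (Fin.tail v j))) := by
      simpa [ContinuousMultilinearMap.toContinuousLinearMap] using e4
    rw [covT_succ_apply, covT_succ_apply, e5]
    -- The D²Φ part of the transformed Christoffel term is exactly the D²Φ part of the chain rule in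
    -- `e5`; the two are subtracted, so the next derivative is tensorial again.
    have e6 : ∀ j, covT B' f' i z
          (Function.update (Fin.tail v) j (christ B' z (v 0) (Fin.tail v j)))
        = covT B f i (Φ z) (Function.update (fun j => fderiv ℝ Φ z (Fin.tail v j)) j
              (fderiv ℝ (fderiv ℝ Φ) z (v 0) (Fin.tail v j)))
          + covT B f i (Φ z) (Function.update (fun j => fderiv ℝ Φ z (Fin.tail v j)) j
              (christ B (Φ z) (fderiv ℝ Φ z (v 0)) (fderiv ℝ Φ z (Fin.tail v j)))) := by
      intro j
      rw [ih z hz, ← ContinuousMultilinearMap.map_update_add,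
        ← hB.christ_pull hB' hΦ hmaps hsurj hpull hz]
      congr 1
      funext l
      rcases eq_or_ne l j with rfl | h
      · simp
      · simp [h]
    simp only [e6, Finset.sum_add_distrib]
    have e7 : (Fin.tail fun j => fderiv ℝ Φ z (v j)) = fun j => fderiv ℝ Φ z (Fin.tail v j) := rfl
    rw [e7]
    ring

end LocalGeometry

/-! ### The norm of a tensor -/

section TensorNorm

set_option maxSynthPendingDepth 3
set_option linter.unusedSectionVars false

variable {E : Type*} [NormedAddCommGroup E] [NormedSpace ℝ E]
  {ι : Type*} [Fintype ι] [DecidableEq ι] {ι' : Type*} [Fintype ι'] [DecidableEq ι']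

/-- The family `e` is orthonormal for the bilinear form `B`. -/
def IsOrthonormalFor (B : E →L[ℝ] E →L[ℝ] ℝ) (e : ι → E) : Prop :=
  ∀ a b, B (e a) (e b) = if a = b then 1 else 0

/-- The Gram matrix of a family of vectors with respect to a bilinear form. -/
def gramOf (B : E →L[ℝ] E →L[ℝ] ℝ) (e : ι → E) : Matrix ι ι ℝ := Matrix.of fun a b => B (e a) (e b)

/-- The square of the norm of the tensor `T`, computed in the frame `e`. -/
def frameNormSq (B : E →L[ℝ] E →L[ℝ] ℝ) (e : ι → E) {i : ℕ} (T : E [×i]→L[ℝ] ℝ) : ℝ :=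
  ∑ a : Fin i → ι, ∑ b : Fin i → ι, (∏ j, (gramOf B e)⁻¹ (a j) (b j)) *
    (T (fun j => e (a j)) * T (fun j => e (b j)))

lemma IsOrthonormalFor.linearIndependent {B : E →L[ℝ] E →L[ℝ] ℝ} {e : ι → E}
    (he : IsOrthonormalFor B e) : LinearIndependent ℝ e := by
  rw [Fintype.linearIndependent_iff]
  intro c hc a
  have := congrArg (fun v => B v (e a)) hc
  simpa [he _ _] using this

lemma IsOrthonormalFor.eq_sum {B : E →L[ℝ] E →L[ℝ] ℝ} (b' : Module.Basis ι ℝ E)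
    (he : IsOrthonormalFor B b') (v w : E) : B v w = ∑ f, b'.repr v f * b'.repr w f := by
  have hv : B v w = ∑ f, b'.repr v f * B (b' f) w := by
    conv_lhs => rw [← b'.sum_repr v]
    simp only [map_sum, map_smul, _root_.sum_apply, _root_.smul_apply, smul_eq_mul]
  have hw : ∀ f, B (b' f) w = b'.repr w f := fun f => by
    conv_lhs => rw [← b'.sum_repr w]
    simp only [map_sum, map_smul, smul_eq_mul, he _ _]
    simp
  simp only [hv, hw]

/-- Expanding in the orthonormal basis `b'` factors the Gram matrix as `QᵀQ`, where `Q` is the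
inverse of `P = b.toMatrix b'`. -/
lemma gramOf_inv (B : E →L[ℝ] E →L[ℝ] ℝ) (b : Module.Basis ι ℝ E)
    (b' : Module.Basis ι' ℝ E) (he : IsOrthonormalFor B b') :
    (gramOf B b)⁻¹ = b.toMatrix b' * (b.toMatrix b').transpose := by
  set P := b.toMatrix b'
  set Q := b'.toMatrix b
  have hPQ : P * Q = 1 := b.toMatrix_mul_toMatrix_flip b'
  have hQP : Q * P = 1 := b'.toMatrix_mul_toMatrix_flip b
  have hg : gramOf B b = Q.transpose * Q := by
    ext a c
    simp [gramOf, Matrix.mul_apply, Q, Module.Basis.toMatrix_apply, he.eq_sum b']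
  apply Matrix.inv_eq_left_inv
  rw [hg]
  calc P * P.transpose * (Q.transpose * Q) = P * ((Q * P).transpose * Q) := by
        rw [Matrix.transpose_mul]; simp only [Matrix.mul_assoc]
    _ = 1 := by rw [hQP]; simp [hPQ]

/-- With the inverse Gram matrix written as `PPᵀ`, the double sum splits, for each multi-index `f`,
into the square of the expansion of T on the vectors of `b'`. Hence the norm can be computed in any
frame: a fixed basis is good for continuity, a nearly parallel one for Kato's inequality. -/
lemma frameNormSq_eq_sum_sq_of_basis (B : E →L[ℝ] E →L[ℝ] ℝ) (b : Module.Basis ι ℝ E)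
    (b' : Module.Basis ι' ℝ E) (he : IsOrthonormalFor B b') {i : ℕ} (T : E [×i]→L[ℝ] ℝ) :
    frameNormSq B b T = ∑ f : Fin i → ι', T (fun j => b' (f j)) ^ 2 := by
  have hT : ∀ f : Fin i → ι', T (fun j => b' (f j))
      = ∑ a : Fin i → ι, (∏ j, b.toMatrix b' (a j) (f j)) * T (fun j => b (a j)) := by
    intro f
    have : (fun j => b' (f j)) = fun j => ∑ a, b.toMatrix b' a (f j) • b a :=
      funext fun j => (b.sum_toMatrix_smul_self b' (f j)).symm
    rw [this, T.map_sum]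
    refine Finset.sum_congr rfl fun a _ => ?_
    rw [T.map_smul_univ, smul_eq_mul]
  simp only [frameNormSq, hT, gramOf_inv B b b' he, sq, Finset.sum_mul_sum]
  symm
  rw [Finset.sum_comm]
  refine Finset.sum_congr rfl fun a _ => ?_
  rw [Finset.sum_comm]
  refine Finset.sum_congr rfl fun c _ => ?_
  rw [show (∏ j, (b.toMatrix b' * (b.toMatrix b').transpose) (a j) (c j))
      = ∏ j : Fin i, ∑ f : ι', b.toMatrix b' (a j) f * b.toMatrix b' (c j) f from
    Finset.prod_congr rfl fun j _ => by simp [Matrix.mul_apply]]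
  rw [Fintype.prod_sum, Finset.sum_mul]
  refine Finset.sum_congr rfl fun f _ => ?_
  rw [Finset.prod_mul_distrib]
  ring

variable [FiniteDimensional ℝ E]

lemma frameNormSq_eq_sum_sq (B : E →L[ℝ] E →L[ℝ] ℝ) {e : ι → E} (hli : LinearIndependent ℝ e)
    (hc : Fintype.card ι = Module.finrank ℝ E) {e' : ι' → E} (he : IsOrthonormalFor B e')
    (hc' : Fintype.card ι' = Module.finrank ℝ E) {i : ℕ} (T : E [×i]→L[ℝ] ℝ) :
    frameNormSq B e T = ∑ f : Fin i → ι', T (fun j => e' (f j)) ^ 2 := by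
  have h1 := coe_basisOfLinearIndependentOfCardEqFinrank' e hli hc
  have h2 := coe_basisOfLinearIndependentOfCardEqFinrank' e' he.linearIndependent hc'
  have := frameNormSq_eq_sum_sq_of_basis B
    (basisOfLinearIndependentOfCardEqFinrank' e hli hc)
    (basisOfLinearIndependentOfCardEqFinrank' e' he.linearIndependent hc') (by rwa [h2]) T
  rwa [h1, h2] at this

/-- The square of the norm of the tensor `T` with respect to the inner product `B`. -/
def normSq (B : E →L[ℝ] E →L[ℝ] ℝ) {i : ℕ} (T : E [×i]→L[ℝ] ℝ) : ℝ :=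
  frameNormSq B (Module.finBasis ℝ E) T

/-- A symmetric positive definite bilinear form. -/
structure IsInner (B : E →L[ℝ] E →L[ℝ] ℝ) : Prop where
  symm : ∀ v w, B v w = B w v
  pos : ∀ v, v ≠ 0 → 0 < B v v

lemma IsInner.nonneg {B : E →L[ℝ] E →L[ℝ] ℝ} (hB : IsInner B) (v : E) : 0 ≤ B v v := by
  rcases eq_or_ne v 0 with rfl | h
  · simp
  · exact (hB.pos v h).le

/-- Stated for a bare vector space: the inner product structure built from `B` brings its own norm,
which would clash with one already present. -/
lemma exists_orthonormal_of_posDef (V : Type*) [AddCommGroup V] [Module ℝ V]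
    [FiniteDimensional ℝ V] (B : V →ₗ[ℝ] V →ₗ[ℝ] ℝ) (hs : ∀ v w, B v w = B w v)
    (hp : ∀ v, v ≠ 0 → 0 < B v v) :
    ∃ e : Fin (Module.finrank ℝ V) → V, ∀ a b, B (e a) (e b) = if a = b then 1 else 0 := by
  let core : InnerProductSpace.Core ℝ V :=
    { inner := fun v w => B v w
      conj_inner_symm := fun v w => hs w v
      re_inner_nonneg := fun v => by
        rcases eq_or_ne v 0 with rfl | h
        · simp
        · exact (hp v h).le
      add_left := fun u v w => by simp
      smul_left := fun u v r => by simp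
      definite := fun v h => by
        by_contra hne
        exact (hp v hne).ne' h }
  let : NormedAddCommGroup V := core.toNormedAddCommGroup
  let : InnerProductSpace ℝ V := InnerProductSpace.ofCore core.toCore
  refine ⟨stdOrthonormalBasis ℝ V, fun a b => ?_⟩
  exact orthonormal_iff_ite.1 (stdOrthonormalBasis ℝ V).orthonormal a b

lemma IsInner.exists_orthonormal {B : E →L[ℝ] E →L[ℝ] ℝ} (hB : IsInner B) :
    ∃ e : Fin (Module.finrank ℝ E) → E, IsOrthonormalFor B e :=
  exists_orthonormal_of_posDef E
    { toFun := fun v => (B v).toLinearMap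
      map_add' := fun v w => by ext; simp
      map_smul' := fun a v => by ext; simp } hB.symm hB.pos

lemma normSq_eq_sum_sq {B : E →L[ℝ] E →L[ℝ] ℝ} {e : ι → E} (he : IsOrthonormalFor B e)
    (hc : Fintype.card ι = Module.finrank ℝ E) {i : ℕ} (T : E [×i]→L[ℝ] ℝ) :
    normSq B T = ∑ f : Fin i → ι, T (fun j => e (f j)) ^ 2 :=
  frameNormSq_eq_sum_sq B (Module.finBasis ℝ E).linearIndependent (by simp) he hc T

lemma IsInner.frameNormSq_eq {B : E →L[ℝ] E →L[ℝ] ℝ} (hB : IsInner B) {e : ι → E}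
    (hli : LinearIndependent ℝ e) (hc : Fintype.card ι = Module.finrank ℝ E) {i : ℕ}
    (T : E [×i]→L[ℝ] ℝ) : frameNormSq B e T = normSq B T := by
  obtain ⟨e', he'⟩ := hB.exists_orthonormal
  rw [normSq_eq_sum_sq he' (by simp), frameNormSq_eq_sum_sq B hli hc he' (by simp)]

lemma IsInner.normSq_nonneg {B : E →L[ℝ] E →L[ℝ] ℝ} (hB : IsInner B) {i : ℕ}
    (T : E [×i]→L[ℝ] ℝ) : 0 ≤ normSq B T := by
  obtain ⟨e', he'⟩ := hB.exists_orthonormal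
  rw [normSq_eq_sum_sq he' (by simp)]
  positivity

lemma IsInner.sqrt_normSq_add_le {B : E →L[ℝ] E →L[ℝ] ℝ} (hB : IsInner B) {i : ℕ}
    (S T : E [×i]→L[ℝ] ℝ) : √(normSq B (S + T)) ≤ √(normSq B S) + √(normSq B T) := by
  obtain ⟨e', he'⟩ := hB.exists_orthonormal
  simp only [normSq_eq_sum_sq he' (by simp)]
  have := norm_add_le
    (WithLp.toLp 2 fun f : Fin i → Fin (Module.finrank ℝ E) => S (fun j => e' (f j)))
    (WithLp.toLp 2 fun f : Fin i → Fin (Module.finrank ℝ E) => T (fun j => e' (f j)))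
  simpa [EuclideanSpace.norm_eq] using this

lemma normSq_smul (B : E →L[ℝ] E →L[ℝ] ℝ) {i : ℕ} (a : ℝ) (T : E [×i]→L[ℝ] ℝ) :
    normSq B (a • T) = a ^ 2 * normSq B T := by
  simp only [normSq, frameNormSq, _root_.smul_apply, smul_eq_mul, Finset.mul_sum]
  refine Finset.sum_congr rfl fun _ _ => Finset.sum_congr rfl fun _ _ => by ring

lemma gramOf_isUnit_det {B : E →L[ℝ] E →L[ℝ] ℝ} (hB : IsInner B) (b : Module.Basis ι ℝ E) :
    IsUnit (gramOf B b).det := by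
  obtain ⟨e', he'⟩ := hB.exists_orthonormal
  have h2 := coe_basisOfLinearIndependentOfCardEqFinrank' e' he'.linearIndependent (by simp)
  set b' := basisOfLinearIndependentOfCardEqFinrank' e' he'.linearIndependent (by simp)
  have hb' : IsOrthonormalFor B b' := by rwa [h2]
  have hg : gramOf B b = (b'.toMatrix b).transpose * b'.toMatrix b := by
    ext a c
    simp [gramOf, Matrix.mul_apply, Module.Basis.toMatrix_apply, hb'.eq_sum b']
  refine Matrix.isUnit_det_of_left_inverse
    (B := b.toMatrix b' * (b.toMatrix b').transpose) ?_
  rw [hg]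
  calc b.toMatrix b' * (b.toMatrix b').transpose * ((b'.toMatrix b).transpose * b'.toMatrix b)
      = b.toMatrix b' * ((b'.toMatrix b * b.toMatrix b').transpose * b'.toMatrix b) := by
        rw [Matrix.transpose_mul]; simp only [Matrix.mul_assoc]
    _ = 1 := by simp

lemma continuousAt_gramOf_inv {X : Type*} [TopologicalSpace X] {x₀ : X}
    {B : X → E →L[ℝ] E →L[ℝ] ℝ} {e : X → ι → E} (hB : ContinuousAt B x₀) (he : ContinuousAt e x₀)
    (hu : IsUnit (gramOf (B x₀) (e x₀)).det) (a b : ι) :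
    ContinuousAt (fun x => (gramOf (B x) (e x))⁻¹ a b) x₀ := by
  have h1 : ContinuousAt (fun x => gramOf (B x) (e x)) x₀ := by
    refine continuousAt_pi.2 fun a => continuousAt_pi.2 fun b => ?_
    exact (hB.clm_apply ((continuous_apply a).continuousAt.comp he)).clm_apply
      ((continuous_apply b).continuousAt.comp he)
  have h2 : ContinuousAt (fun x => (gramOf (B x) (e x))⁻¹) x₀ := by
    refine ContinuousAt.comp (g := Inv.inv) (continuousAt_matrix_inv _ ?_) h1
    rw [Ring.inverse_eq_inv']
    exact continuousAt_inv₀ hu.ne_zero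
  exact continuousAt_pi.1 (continuousAt_pi.1 h2 a) b

/-- In a fixed basis the norm is a polynomial in the components of T and the entries of the inverse
Gram matrix, so no continuous choice of orthonormal frames is required. -/
lemma IsInner.continuousAt_normSq {X : Type*} [TopologicalSpace X] {x₀ : X}
    {B : X → E →L[ℝ] E →L[ℝ] ℝ} {i : ℕ} {T : X → E [×i]→L[ℝ] ℝ} (hin : IsInner (B x₀))
    (hB : ContinuousAt B x₀) (hT : ContinuousAt T x₀) :
    ContinuousAt (fun x => normSq (B x) (T x)) x₀ := by
  have hTv : ∀ v, ContinuousAt (fun x => T x v) x₀ := fun v =>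
    (ContinuousMultilinearMap.apply ℝ (fun _ => E) ℝ v).continuous.continuousAt.comp hT
  unfold normSq frameNormSq
  refine tendsto_finsetSum _ fun a _ => tendsto_finsetSum _ fun b _ => ?_
  refine Tendsto.mul (tendsto_finsetProd _ fun j _ => ?_) ((hTv _).mul (hTv _))
  exact continuousAt_gramOf_inv (e := fun _ => Module.finBasis ℝ E) hB continuousAt_const
    (gramOf_isUnit_det hin _) _ _

end TensorNorm

/-! ### Kato's inequality -/

section Kato

set_option maxSynthPendingDepth 3
set_option linter.unusedSectionVars false

variable {E : Type*} [NormedAddCommGroup E] [NormedSpace ℝ E] [FiniteDimensional ℝ E]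
  {ι : Type*} [Fintype ι] [DecidableEq ι]

lemma IsMetricOn.isInner {B : E → E →L[ℝ] E →L[ℝ] ℝ} {Ω : Set E} (hB : IsMetricOn B Ω) {z : E}
    (hz : z ∈ Ω) : IsInner (B z) :=
  ⟨hB.symm z hz, hB.pos z hz⟩

/-- A continuous factor does not affect the vanishing of a derivative at a zero. -/
lemma hasDerivAt_zero_of_continuousAt_mul {u v : ℝ → ℝ} {t : ℝ} (hu : ContinuousAt u t)
    (hv : HasDerivAt v 0 t) (hv0 : v t = 0) : HasDerivAt (fun s => u s * v s) 0 t := by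
  rw [hasDerivAt_iff_isLittleO] at hv ⊢
  have hv' : v =o[𝓝 t] fun s => s - t := by simpa [hv0] using hv
  have h := (hu.isBigO_one ℝ).mul_isLittleO hv'
  simpa [hv0] using h

/-- From M⁻¹ = 1 + M⁻¹(1 - M): the factor 1 - M vanishes with its derivative at `t`, so continuity
of M⁻¹ suffices. -/
lemma hasDerivAt_inv_apply {M : ℝ → Matrix ι ι ℝ} {t : ℝ} (h1 : M t = 1)
    (hM : ∀ a b, HasDerivAt (fun s => M s a b) 0 t)
    (hinv : ∀ a b, ContinuousAt (fun s => (M s)⁻¹ a b) t) (a b : ι) :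
    HasDerivAt (fun s => (M s)⁻¹ a b) 0 t := by
  have hMc : ContinuousAt M t :=
    continuousAt_pi.2 fun a => continuousAt_pi.2 fun b => (hM a b).continuousAt
  have hdet : ∀ᶠ s in 𝓝 t, (M s).det ≠ 0 := by
    have : ContinuousAt (fun s => (M s).det) t :=
      (Continuous.matrix_det continuous_id).continuousAt.comp hMc
    exact this.eventually_ne (by simp [h1])
  have key : (fun s => (M s)⁻¹ a b) =ᶠ[𝓝 t] fun s =>
      (1 : Matrix ι ι ℝ) a b + ∑ c, (M s)⁻¹ a c * ((1 : Matrix ι ι ℝ) c b - M s c b) := by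
    filter_upwards [hdet] with s hs
    have : (M s)⁻¹ = 1 + (M s)⁻¹ * (1 - M s) := by
      rw [Matrix.mul_sub, Matrix.nonsing_inv_mul _ (isUnit_iff_ne_zero.2 hs)]
      simp
    conv_lhs => rw [this]
    simp [Matrix.mul_apply, Matrix.add_apply]
  refine HasDerivAt.congr_of_eventuallyEq ?_ key
  have h2 : HasDerivAt (fun s => ∑ c, (M s)⁻¹ a c * ((1 : Matrix ι ι ℝ) c b - M s c b))
      (∑ _c : ι, (0 : ℝ)) t := by
    refine HasDerivAt.fun_sum fun c _ => ?_
    refine hasDerivAt_zero_of_continuousAt_mul (hinv a c) ?_ ?_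
    · simpa using (hM c b).const_sub ((1 : Matrix ι ι ℝ) c b)
    · simp [h1]
  simpa using h2.const_add ((1 : Matrix ι ι ℝ) a b)

/-- Differentiation of a tensor along a line in a frame that is parallel to first order. -/
lemma IsMetricOn.hasDerivAt_covT_frame {B : E → E →L[ℝ] E →L[ℝ] ℝ} {Ω : Set E}
    (hB : IsMetricOn B Ω) {f : E → ℝ} (hf : ContDiffOn ℝ ∞ f Ω) {i : ℕ} {z : E} (hz : z ∈ Ω)
    (ξ : E) (v : Fin i → E) :
    HasDerivAt (fun t : ℝ => covT B f i (z + t • ξ) (fun j => v j - t • christ B z ξ (v j)))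
      (covT B f (i + 1) z (Fin.cons ξ v)) 0 := by
  have hΩ : Ω ∈ 𝓝 z := hB.isOpen.mem_nhds hz
  have hT : HasFDerivAt (covT B f i) (fderiv ℝ (covT B f i) z) (z + (0 : ℝ) • ξ) := by
    simpa using (((hB.contDiffOn_covT hf i).contDiffAt hΩ).differentiableAt (by simp)).hasFDerivAt
  have hl : HasDerivAt (fun t : ℝ => z + t • ξ) ξ 0 := by
    simpa using ((hasDerivAt_id (0 : ℝ)).smul_const ξ).const_add z
  have hv : ∀ j, HasDerivAt (fun t : ℝ => v j - t • christ B z ξ (v j))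
      (-(christ B z ξ (v j))) 0 := fun j => by
    simpa using ((hasDerivAt_id (0 : ℝ)).smul_const (christ B z ξ (v j))).const_sub (v j)
  have := (HasFDerivAt.continuousMultilinearMap_apply
    (hT.comp (0 : ℝ) hl.hasFDerivAt) (fun j => (hv j).hasFDerivAt)).hasDerivAt
  refine HasDerivAt.congr_deriv this ?_
  symm
  rw [covT_succ_apply]
  simp [ContinuousMultilinearMap.toContinuousLinearMap, sub_eq_add_neg]

/-- Metric compatibility of the Levi-Civita connection: by the Koszul formula ∂_ξ B(v, w) = B(Γ(ξ,
v), w) + B(v, Γ(ξ, w)), and the frame is moved so as to subtract just these terms. -/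
lemma IsMetricOn.hasDerivAt_gramOf_frame {B : E → E →L[ℝ] E →L[ℝ] ℝ} {Ω : Set E}
    (hB : IsMetricOn B Ω) {z : E} (hz : z ∈ Ω) (ξ v w : E) :
    HasDerivAt (fun t : ℝ => B (z + t • ξ) (v - t • christ B z ξ v) (w - t • christ B z ξ w))
      0 0 := by
  have hΩ : Ω ∈ 𝓝 z := hB.isOpen.mem_nhds hz
  have hBd : HasFDerivAt B (fderiv ℝ B z) (z + (0 : ℝ) • ξ) := by
    simpa using ((hB.smooth.contDiffAt hΩ).differentiableAt (by simp)).hasFDerivAt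
  have hl : HasDerivAt (fun t : ℝ => z + t • ξ) ξ 0 := by
    simpa using ((hasDerivAt_id (0 : ℝ)).smul_const ξ).const_add z
  have hv : ∀ v, HasDerivAt (fun t : ℝ => v - t • christ B z ξ v) (-(christ B z ξ v)) 0 :=
    fun v => by
      simpa using ((hasDerivAt_id (0 : ℝ)).smul_const (christ B z ξ v)).const_sub v
  have hsym : ∀ a v w, fderiv ℝ B z a v w = fderiv ℝ B z a w v := by
    intro a v w
    have h1 : ∀ v w, HasFDerivAt (fun y => B y v w)
        ((ContinuousLinearMap.apply ℝ ℝ w ∘L ContinuousLinearMap.apply ℝ _ v) ∘L fderiv ℝ B z)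
        z := fun v w =>
      (ContinuousLinearMap.apply ℝ ℝ w ∘L ContinuousLinearMap.apply ℝ _ v).hasFDerivAt.comp z
        ((hB.smooth.contDiffAt hΩ).differentiableAt (by simp)).hasFDerivAt
    have h2 : HasFDerivAt (fun y => B y w v)
        ((ContinuousLinearMap.apply ℝ ℝ w ∘L ContinuousLinearMap.apply ℝ _ v) ∘L fderiv ℝ B z)
        z := by
      refine (h1 v w).congr_of_eventuallyEq ?_
      filter_upwards [hΩ] with y hy using hB.symm y hy w v
    have h3 := DFunLike.congr_fun (h2.unique (h1 w v)) a
    simpa only [ContinuousLinearMap.comp_apply, ContinuousLinearMap.apply_apply] using h3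
  have h1 : HasDerivAt (fun t : ℝ => B (z + t • ξ) (v - t • christ B z ξ v))
      (fderiv ℝ B z ξ v - B z (christ B z ξ v)) 0 := by
    have hc : HasDerivAt (fun t : ℝ => B (z + t • ξ)) (fderiv ℝ B z ξ) 0 :=
      hBd.comp_hasDerivAt (0 : ℝ) hl
    have h : HasDerivAt (fun t : ℝ => B (z + t • ξ) (v - t • christ B z ξ v))
      (fderiv ℝ B z ξ (v - (0 : ℝ) • christ B z ξ v)
        + B (z + (0 : ℝ) • ξ) (-(christ B z ξ v))) 0 := hc.clm_apply (hv v)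
    refine HasDerivAt.congr_deriv h ?_
    simp only [zero_smul, add_zero, map_neg, sub_eq_add_neg]
    simp
  have h2 : HasDerivAt
      (fun t : ℝ => B (z + t • ξ) (v - t • christ B z ξ v) (w - t • christ B z ξ w))
      (fderiv ℝ B z ξ v w - B z (christ B z ξ v) w - B z v (christ B z ξ w)) 0 := by
    refine HasDerivAt.congr_deriv (h1.clm_apply (hv w)) ?_
    simp [sub_eq_add_neg]
  refine h2.congr_deriv ?_
  have h3 := hB.apply_christ hz ξ v w
  have h4 := hB.apply_christ hz ξ w v
  rw [hB.symm z hz v, h3, h4, hsym ξ w v, hsym v ξ w]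
  ring

/-- Cauchy–Schwarz in the expansion of ξ along the frame: filling one slot with a vector of length
at most one does not increase the norm. -/
lemma IsInner.sum_sq_apply_cons_le {B : E →L[ℝ] E →L[ℝ] ℝ} {e : ι → E}
    (he : IsOrthonormalFor B e) (hc : Fintype.card ι = Module.finrank ℝ E) {i : ℕ}
    (T : E [×(i + 1)]→L[ℝ] ℝ) {ξ : E} (hξ : B ξ ξ ≤ 1) :
    ∑ f : Fin i → ι, T (Fin.cons ξ fun j => e (f j)) ^ 2 ≤ normSq B T := by
  have h2 := coe_basisOfLinearIndependentOfCardEqFinrank' e he.linearIndependent hc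
  set b := basisOfLinearIndependentOfCardEqFinrank' e he.linearIndependent hc
  have hb : IsOrthonormalFor B b := by rwa [h2]
  have hξ' : ∑ a, b.repr ξ a ^ 2 ≤ 1 := by
    rw [hb.eq_sum b] at hξ
    simpa [sq] using hξ
  have hexp : ∀ v, T (Fin.cons ξ v) = ∑ a, b.repr ξ a * T (Fin.cons (e a) v) := by
    intro v
    have h3 : ∀ w, T (Fin.cons w v) = T.curryLeft w v := fun w => by simp
    have h4 : ξ = ∑ a, b.repr ξ a • e a := by rw [← h2, b.sum_repr]
    rw [h3]
    conv_lhs => rw [h4]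
    rw [map_sum, _root_.sum_apply]
    simp
  have hcs : ∀ v, T (Fin.cons ξ v) ^ 2 ≤ ∑ a, T (Fin.cons (e a) v) ^ 2 := by
    intro v
    rw [hexp v]
    refine (Finset.sum_mul_sq_le_sq_mul_sq _ _ _).trans ?_
    have : 0 ≤ ∑ a, T (Fin.cons (e a) v) ^ 2 := Finset.sum_nonneg fun _ _ => sq_nonneg _
    nlinarith
  refine (Finset.sum_le_sum fun f _ => hcs fun j => e (f j)).trans (le_of_eq ?_)
  rw [normSq_eq_sum_sq he hc, ← (Fin.consEquiv fun _ => ι).sum_comp, Fintype.sum_prod_type,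
    Finset.sum_comm]
  refine Finset.sum_congr rfl fun a _ => Finset.sum_congr rfl fun f _ => ?_
  congr 2
  funext j
  refine Fin.cases ?_ (fun j => ?_) j <;> simp [Fin.consEquiv]

/-- Kato's inequality for the square of the norm of `∇ⁱf`, along a line in a direction of length
at most one; and the vanishing to second order at zeros. -/
theorem IsMetricOn.hasDerivAt_normSq {B : E → E →L[ℝ] E →L[ℝ] ℝ} {Ω : Set E}
    (hB : IsMetricOn B Ω) {f : E → ℝ} (hf : ContDiffOn ℝ ∞ f Ω) (i : ℕ) {z : E} (hz : z ∈ Ω)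
    {ξ : E} (hξ : B z ξ ξ ≤ 1) :
    (∃ D, HasDerivAt (fun t : ℝ => normSq (B (z + t • ξ)) (covT B f i (z + t • ξ))) D 0 ∧
      |D| ≤ 2 * √(normSq (B z) (covT B f i z)) * √(normSq (B z) (covT B f (i + 1) z))) ∧
    (normSq (B z) (covT B f i z) = 0 →
      (fun t : ℝ => normSq (B (z + t • ξ)) (covT B f i (z + t • ξ))) =O[𝓝 0] fun t => t ^ 2) := by
  have hΩ : Ω ∈ 𝓝 z := hB.isOpen.mem_nhds hz
  obtain ⟨e, he⟩ := (hB.isInner hz).exists_orthonormal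
  have hc : Fintype.card (Fin (Module.finrank ℝ E)) = Module.finrank ℝ E := by simp
  -- First-order parallel transport of an orthonormal frame. It stays a basis for small t but is
  -- orthonormal only to first order, which is why `frameNormSq` admits arbitrary frames.
  set ε : ℝ → Fin (Module.finrank ℝ E) → E := fun t a => e a - t • christ B z ξ (e a) with hε
  have hε0 : ε 0 = e := by funext a; simp [hε]
  have hεc : Continuous ε := by
    refine continuous_pi fun a => ?_
    exact continuous_const.sub (continuous_id.smul continuous_const)
  have hlc : Continuous fun t : ℝ => z + t • ξ :=
    continuous_const.add (continuous_id.smul continuous_const)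
  have hl0 : Tendsto (fun t : ℝ => z + t • ξ) (𝓝 0) (𝓝 z) := by
    simpa using hlc.tendsto 0
  have hli : ∀ᶠ t in 𝓝 (0 : ℝ), LinearIndependent ℝ (ε t) := by
    have h1 := he.linearIndependent.eventually
    rw [← hε0] at h1
    exact hεc.continuousAt.eventually h1
  have hin : ∀ᶠ t in 𝓝 (0 : ℝ), IsInner (B (z + t • ξ)) :=
    (hl0.eventually hΩ).mono fun t ht => hB.isInner ht
  set X : (Fin i → Fin (Module.finrank ℝ E)) → ℝ → ℝ := fun a t =>
    covT B f i (z + t • ξ) (fun j => ε t (a j)) with hX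
  set W : (Fin i → Fin (Module.finrank ℝ E)) → (Fin i → Fin (Module.finrank ℝ E)) → ℝ → ℝ :=
    fun a b t => ∏ j, (gramOf (B (z + t • ξ)) (ε t))⁻¹ (a j) (b j) with hW
  have hEq : (fun t : ℝ => normSq (B (z + t • ξ)) (covT B f i (z + t • ξ))) =ᶠ[𝓝 0]
      fun t => ∑ a, ∑ b, W a b t * (X a t * X b t) := by
    filter_upwards [hli, hin] with t h1 h2
    rw [← h2.frameNormSq_eq h1 hc]
    rfl
  have hXd : ∀ a, HasDerivAt (X a) (covT B f (i + 1) z (Fin.cons ξ fun j => e (a j))) 0 :=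
    fun a => hB.hasDerivAt_covT_frame hf hz ξ fun j => e (a j)
  have hX0 : ∀ a, X a 0 = covT B f i z (fun j => e (a j)) := fun a => by simp [hX, hε0]
  have hM1 : gramOf (B (z + (0 : ℝ) • ξ)) (ε 0) = 1 := by
    ext a b
    simp [hε0, gramOf, he a b, Matrix.one_apply]
  have hBc : ContinuousAt (fun t : ℝ => B (z + t • ξ)) 0 := by
    refine ContinuousAt.comp (g := B) ?_ hlc.continuousAt
    simpa using (hB.smooth.contDiffAt hΩ).continuousAt
  have hG : ∀ a b, HasDerivAt (fun t => (gramOf (B (z + t • ξ)) (ε t))⁻¹ a b) 0 0 :=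
    hasDerivAt_inv_apply hM1 (fun a b => hB.hasDerivAt_gramOf_frame hz ξ (e a) (e b))
      fun a b => continuousAt_gramOf_inv hBc hεc.continuousAt (by rw [hM1]; simp) a b
  have hWd : ∀ a b, HasDerivAt (W a b) 0 0 := fun a b => by
    simpa using HasDerivAt.fun_finsetProd (u := Finset.univ) fun j _ => hG (a j) (b j)
  have hW0 : ∀ a b, W a b 0 = if a = b then 1 else 0 := fun a b => by
    simp only [hW, hM1, inv_one, Matrix.one_apply]
    rw [Finset.prod_ite_zero]
    simp [funext_iff]
  have hN0 : normSq (B z) (covT B f i z) = ∑ a, X a 0 ^ 2 := by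
    rw [normSq_eq_sum_sq he hc]; simp only [hX0]
  constructor
  · refine ⟨2 * ∑ a, X a 0 * covT B f (i + 1) z (Fin.cons ξ fun j => e (a j)), ?_, ?_⟩
    · refine HasDerivAt.congr_of_eventuallyEq ?_ hEq
      have h1 := HasDerivAt.fun_sum (u := Finset.univ) fun a _ =>
        HasDerivAt.fun_sum (u := Finset.univ) fun b _ =>
          (hWd a b).mul ((hXd a).mul (hXd b))
      refine HasDerivAt.congr_deriv h1 ?_
      simp only [hW0, ite_mul, one_mul, zero_mul, zero_add]
      simp only [Finset.sum_ite_eq, Finset.mem_univ, if_true, Finset.mul_sum]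
      refine Finset.sum_congr rfl fun a _ => by ring
    · rw [abs_mul, abs_two, mul_assoc]
      refine mul_le_mul_of_nonneg_left ?_ (by norm_num)
      rw [← Real.sqrt_mul ((hB.isInner hz).normSq_nonneg _)]
      refine Real.abs_le_sqrt ((Finset.sum_mul_sq_le_sq_mul_sq _ _ _).trans ?_)
      rw [← hN0]
      exact mul_le_mul_of_nonneg_left (IsInner.sum_sq_apply_cons_le he hc _ hξ)
        ((hB.isInner hz).normSq_nonneg _)
  · intro h0
    have hX00 : ∀ a, X a 0 = 0 := by
      rw [hN0, Finset.sum_eq_zero_iff_of_nonneg fun _ _ => sq_nonneg _] at h0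
      exact fun a => pow_eq_zero_iff (two_ne_zero) |>.1 (h0 a (Finset.mem_univ a))
    -- At a zero of the norm every component vanishes at t = 0 and is differentiable, hence O(t);
    -- the quadratic expression is then O(t²).
    have hXO : ∀ a, X a =O[𝓝 0] fun t => t := fun a => by
      simpa [hX00 a] using (hXd a).differentiableAt.isBigO_sub
    refine hEq.trans_isBigO ?_
    refine Asymptotics.IsBigO.fun_sum fun a _ => Asymptotics.IsBigO.fun_sum fun b _ => ?_
    have h1 := ((hWd a b).continuousAt.isBigO_one ℝ).mul ((hXO a).mul (hXO b))
    simpa [sq] using h1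

/-- The derivative of a power of the square root of a function. -/
lemma hasDerivAt_sqrt_rpow {F : ℝ → ℝ} {t D g p : ℝ} (hp : 1 < p) (hF0 : ∀ᶠ s in 𝓝 t, 0 ≤ F s)
    (hF : HasDerivAt F D t) (hD : |D| ≤ 2 * √(F t) * g)
    (hz : F t = 0 → F =O[𝓝 t] fun s => (s - t) ^ 2) :
    ∃ D', HasDerivAt (fun s => √(F s) ^ p) D' t ∧ |D'| ≤ p * √(F t) ^ (p - 1) * g := by
  rcases (hF0.self_of_nhds).eq_or_lt with h0 | h0
  -- At a zero, √F may have a corner. But F = O((s - t)²) gives √F ^ p = O(|s - t| ^ p), and this is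
  -- o(s - t) because p > 1.
  · refine ⟨0, ?_, ?_⟩
    · have h1 := hz h0.symm
      rw [hasDerivAt_iff_isLittleO]
      have h2 : (fun s => √(F s) ^ p) =O[𝓝 t] fun s => |s - t| ^ p := by
        obtain ⟨C, hC⟩ := h1.bound
        refine Asymptotics.IsBigO.of_bound (√|C| ^ p) ?_
        filter_upwards [hC] with s hs
        have h3 : √(F s) ≤ √|C| * |s - t| := by
          rw [← Real.sqrt_sq_eq_abs (s - t), ← Real.sqrt_mul (abs_nonneg C)]
          apply Real.sqrt_le_sqrt
          have h4 : C * (s - t) ^ 2 ≤ |C| * (s - t) ^ 2 := by gcongr; exact le_abs_self C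
          have h5 : ‖(s - t) ^ 2‖ = (s - t) ^ 2 := by simp
          rw [h5] at hs
          exact (le_abs_self _).trans (hs.trans h4)
        rw [Real.norm_of_nonneg (by positivity), Real.norm_of_nonneg (by positivity),
          ← Real.mul_rpow (by positivity) (by positivity)]
        gcongr
      have h3 : (fun s => |s - t| ^ p) =o[𝓝 t] fun s => s - t := by
        have h4 : (fun s : ℝ => |s - t| ^ p) = fun s => |s - t| ^ (p - 1) * |s - t| := by
          funext s
          rcases eq_or_ne s t with rfl | hne
          · simp [Real.zero_rpow (by linarith : p ≠ 0)]
          · rw [Real.rpow_sub_one (by simpa [sub_eq_zero] using hne)]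
            have : |s - t| ≠ 0 := by simpa [sub_eq_zero] using hne
            field_simp
        rw [h4]
        have h5 : (fun s : ℝ => |s - t| ^ (p - 1)) =o[𝓝 t] fun _ => (1 : ℝ) := by
          rw [Asymptotics.isLittleO_one_iff]
          have : ContinuousAt (fun s : ℝ => |s - t| ^ (p - 1)) t := by
            refine ContinuousAt.rpow_const (by fun_prop) (Or.inr (by linarith))
          have h6 := this.tendsto
          simpa [Real.zero_rpow (by linarith : p - 1 ≠ 0)] using h6
        have h6 : (fun s : ℝ => |s - t|) =O[𝓝 t] fun s => s - t :=
          (Asymptotics.isBigO_refl _ _).abs_left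
        simpa using h5.mul_isBigO h6
      have h4 := h2.trans_isLittleO h3
      simpa [← h0, Real.zero_rpow (by linarith : p ≠ 0)] using h4
    · rw [← h0, Real.sqrt_zero, Real.zero_rpow (by linarith)]
      simp
  · have hs : 0 < √(F t) := Real.sqrt_pos.2 h0
    refine ⟨_, (hF.sqrt h0.ne').rpow_const (p := p) (Or.inl hs.ne'), ?_⟩
    rw [abs_mul, abs_mul, abs_div, abs_of_pos (by positivity : 0 < 2 * √(F t)),
      abs_of_pos (by linarith : 0 < p), abs_of_pos (by positivity : 0 < √(F t) ^ (p - 1))]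
    have h1 : |D| / (2 * √(F t)) ≤ g := by
      rw [div_le_iff₀ (by positivity)]
      linarith
    calc |D| / (2 * √(F t)) * p * √(F t) ^ (p - 1) ≤ g * p * √(F t) ^ (p - 1) := by gcongr
      _ = p * √(F t) ^ (p - 1) * g := by ring

end Kato

/-! ### The one-dimensional Hardy inequality -/

section Hardy

/-- The zero at `R` removes the outer boundary term in Hardy's inequality. The derivative lives
where r ≥ R / 2, so the error it causes stays away from the vertex. -/
lemma exists_radial_cutoff {R : ℝ} (hR : 0 < R) :
    ∃ η : ℝ → ℝ, ContDiff ℝ 1 η ∧ (∀ r ≤ R / 2, η r = 1) ∧ η R = 0 ∧ (∀ r, 0 ≤ η r) ∧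
      (∀ r, η r ≤ 1) ∧ (∀ r < R / 2, deriv η r = 0) ∧ ∃ K, 0 ≤ K ∧ ∀ r ∈ Icc 0 R, |deriv η r| ≤ K := by
  have hη : ContDiff ℝ 1 fun r : ℝ => Real.smoothTransition (2 - 2 * r / R) :=
    Real.smoothTransition.contDiff.comp (by fun_prop)
  have h1 : ∀ r ≤ R / 2, Real.smoothTransition (2 - 2 * r / R) = 1 := fun r hr => by
    apply Real.smoothTransition.one_of_one_le
    have : 2 * r / R ≤ 1 := by rw [div_le_one hR]; linarith
    linarith
  refine ⟨_, hη, h1, ?_, fun r => Real.smoothTransition.nonneg _,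
    fun r => Real.smoothTransition.le_one _, fun r hr => ?_, ?_⟩
  · apply Real.smoothTransition.zero_of_nonpos
    field_simp; linarith
  · have : (fun r : ℝ => Real.smoothTransition (2 - 2 * r / R)) =ᶠ[𝓝 r] fun _ => 1 := by
      filter_upwards [Iio_mem_nhds hr] with s hs using h1 s (le_of_lt hs)
    rw [this.deriv_eq]; simp
  · obtain ⟨K, hK⟩ := isCompact_Icc.exists_bound_of_continuousOn (s := Icc 0 R)
      (hη.continuous_deriv (le_refl _)).continuousOn
    exact ⟨K, (norm_nonneg _).trans (hK 0 ⟨le_refl _, hR.le⟩), fun r hr => hK r hr⟩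

/-- Young's inequality with a crude constant: if h ≤ εf the first term on the right suffices, and
otherwise f ≤ h/ε makes the second one suffice. -/
lemma rpow_sub_one_mul_le {p ε f h : ℝ} (hp : 1 < p) (hε : 0 < ε) (hf : 0 ≤ f) (hh : 0 ≤ h) :
    f ^ (p - 1) * h ≤ ε * f ^ p + (1 / ε) ^ (p - 1) * h ^ p := by
  have key : ∀ y : ℝ, 0 ≤ y → y ^ (p - 1) * y = y ^ p := fun y hy => by
    rw [← Real.rpow_add_one' hy (by linarith)]; congr 1; ring
  rcases le_total h (ε * f) with h1 | h1
  · have h2 : f ^ (p - 1) * h ≤ f ^ (p - 1) * (ε * f) := by gcongr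
    have h3 : f ^ (p - 1) * (ε * f) = ε * f ^ p := by rw [← key f hf]; ring
    have h4 : 0 ≤ (1 / ε) ^ (p - 1) * h ^ p := by positivity
    linarith
  · have h2 : f ≤ 1 / ε * h := by
      rw [one_div, inv_mul_eq_div, le_div_iff₀ hε]; linarith
    have h3 : f ^ (p - 1) * h ≤ (1 / ε * h) ^ (p - 1) * h := by
      gcongr
    rw [Real.mul_rpow (by positivity) hh, mul_assoc, key h hh] at h3
    have h4 : 0 ≤ ε * f ^ p := by positivity
    linarith

/-- Hardy's inequality on `(0, R)`, in integrated form on the interval where `f` is supported. -/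
lemma hardy_integral {a p R : ℝ} (ha : a ≠ 0) (hp : 1 < p) {η : ℝ → ℝ}
    (hη : ContDiff ℝ 1 η) (hη0 : ∀ r, 0 ≤ η r) (hηR : η R = 0) {f g : ℝ → ℝ} {ρ : ℝ} (hρ : 0 < ρ)
    (hρR : ρ ≤ R) (hfc : ContinuousOn f (Icc ρ R)) (hgc : ContinuousOn g (Icc ρ R))
    (hf0 : ∀ r ∈ Icc ρ R, 0 ≤ f r) (hg0 : ∀ r ∈ Icc ρ R, 0 ≤ g r) (hfρ : f ρ = 0)
    (hder : ∀ r ∈ Ioo ρ R, ∃ D, HasDerivAt (fun s => f s ^ p) D r ∧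
      |D| ≤ p * f r ^ (p - 1) * g r) :
    |a| / 2 * ∫ r in ρ..R, r ^ (a - 1) * η r * f r ^ p ≤
      (∫ r in ρ..R, |deriv η r| * r ^ a * f r ^ p)
        + p * (1 / (|a| / (2 * p))) ^ (p - 1) * ∫ r in ρ..R, η r * (r ^ (a - 1 + p) * g r ^ p) := by
  have ha' : 0 < |a| := abs_pos.2 ha
  have hp0 : 0 < p := by linarith
  set C := p * (1 / (|a| / (2 * p))) ^ (p - 1) with hC
  have hpos : ∀ r ∈ Icc ρ R, 0 < r := fun r hr => hρ.trans_le hr.1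
  have hrc : ∀ b : ℝ, ContinuousOn (fun r : ℝ => r ^ b) (Icc ρ R) := fun b =>
    continuousOn_id.rpow_const fun r hr => Or.inl (hpos r hr).ne'
  have hfp : ContinuousOn (fun r => f r ^ p) (Icc ρ R) :=
    hfc.rpow_const fun r _ => Or.inr hp0.le
  have hgp : ContinuousOn (fun r => g r ^ p) (Icc ρ R) :=
    hgc.rpow_const fun r _ => Or.inr hp0.le
  have hηc : ContinuousOn η (Icc ρ R) := hη.continuous.continuousOn
  have hη'c : ContinuousOn (fun r => |deriv η r|) (Icc ρ R) :=
    (hη.continuous_deriv (le_refl _)).abs.continuousOn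
  have hA := ((hrc (a - 1)).mul hηc).mul hfp
  have hB := (hη'c.mul (hrc a)).mul hfp
  have hG := hηc.mul ((hrc (a - 1 + p)).mul hgp)
  have iA := hA.intervalIntegrable_of_Icc (μ := volume) hρR
  have iB := hB.intervalIntegrable_of_Icc (μ := volume) hρR
  have iG := hG.intervalIntegrable_of_Icc (μ := volume) hρR
  -- The sign of a, so that the weights a > 0 and a < 0 are treated at once.
  obtain ⟨s, hs, hsa⟩ : ∃ s : ℝ, |s| = 1 ∧ s * a = |a| := by
    rcases lt_or_gt_of_ne ha with h | h
    · exact ⟨-1, by simp, by rw [abs_of_neg h]; ring⟩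
    · exact ⟨1, by simp, by rw [abs_of_pos h]; ring⟩
  choose! D hD hDb using hder
  -- Integrate the derivative of -s r^a η f^p, which vanishes at both ends as f ρ = 0 and η R = 0.
  -- This form of the fundamental theorem asks only for an integrable upper bound φ of the
  -- derivative, so nothing is needed about integrability of `D`.
  have key := intervalIntegral.sub_le_integral_of_hasDeriv_right_of_le (a := ρ) (b := R)
    (g := fun r => -(s * (r ^ a * η r * f r ^ p)))
    (g' := fun r => -(s * ((a * r ^ (a - 1) * η r + r ^ a * deriv η r) * f r ^ p
      + r ^ a * η r * D r)))
    (φ := fun r => -(|a| / 2) * (r ^ (a - 1) * η r * f r ^ p) + |deriv η r| * r ^ a * f r ^ p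
      + C * (η r * (r ^ (a - 1 + p) * g r ^ p))) hρR
    ((continuousOn_const.mul (((hrc a).mul hηc).mul hfp)).neg) ?_ ?_ ?_
  · rw [intervalIntegral.integral_add, intervalIntegral.integral_add,
      intervalIntegral.integral_const_mul, intervalIntegral.integral_const_mul] at key
    · simp only [hηR, hfρ, Real.zero_rpow hp0.ne'] at key
      simp only [mul_zero, zero_mul, neg_zero, sub_self] at key
      linarith
    · exact iA.const_mul _
    · exact iB
    · exact (iA.const_mul _).add iB
    · exact iG.const_mul _
  · intro r hr
    have hr0 : 0 < r := hpos r ⟨hr.1.le, hr.2.le⟩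
    have h1 : HasDerivAt (fun r : ℝ => r ^ a) (a * r ^ (a - 1)) r :=
      Real.hasDerivAt_rpow_const (Or.inl hr0.ne')
    have h2 : HasDerivAt η (deriv η r) r :=
      (hη.differentiable (by simp) r).hasDerivAt
    exact (((h1.mul h2).mul (hD r hr)).const_mul s).neg.hasDerivWithinAt
  · exact ((continuousOn_const.mul hA).add hB |>.add (continuousOn_const.mul hG)).integrableOn_Icc
  · intro r hr
    have hr' : r ∈ Icc ρ R := ⟨hr.1.le, hr.2.le⟩
    have hr0 : 0 < r := hpos r hr'
    -- With this ε the product pε is |a|/2: half of the main term |a| r^{a-1} η f^p is given up to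
    -- absorb the Young remainder, the other half survives.
    have hy := rpow_sub_one_mul_le (ε := |a| / (2 * p)) hp (by positivity) (hf0 r hr')
      (mul_nonneg hr0.le (hg0 r hr'))
    have hra : r ^ a = r ^ (a - 1) * r := by
      rw [← Real.rpow_add_one hr0.ne']; congr 1; ring
    have hrap : r ^ (a - 1 + p) = r ^ (a - 1) * r ^ p := Real.rpow_add hr0 _ _
    rw [Real.mul_rpow hr0.le (hg0 r hr')] at hy
    have e1 : -(s * (r ^ a * η r * D r)) ≤ r ^ a * η r * (p * f r ^ (p - 1) * g r) := by
      refine (neg_le_abs _).trans ?_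
      rw [abs_mul, hs, one_mul, abs_mul, abs_of_nonneg (by have := hη0 r; positivity)]
      have := hη0 r
      gcongr
      exact hDb r hr
    have e2 : -(s * (r ^ a * deriv η r * f r ^ p)) ≤ |deriv η r| * r ^ a * f r ^ p := by
      refine (neg_le_abs _).trans (le_of_eq ?_)
      have := hf0 r hr'
      rw [abs_mul, hs, one_mul, abs_mul, abs_mul, abs_of_pos (by positivity : 0 < r ^ a),
        abs_of_nonneg (by positivity : 0 ≤ f r ^ p)]
      ring
    have e3 : r ^ a * η r * (p * f r ^ (p - 1) * g r)
        ≤ r ^ (a - 1) * η r * (|a| / 2 * f r ^ p) + C * (η r * (r ^ (a - 1 + p) * g r ^ p)) := by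
      have h0 : 0 ≤ r ^ (a - 1) * η r * p := by have := hη0 r; positivity
      have := mul_le_mul_of_nonneg_left hy h0
      rw [hra, hrap, hC]
      calc _ = r ^ (a - 1) * η r * p * (f r ^ (p - 1) * (r * g r)) := by ring
        _ ≤ _ := this
        _ = _ := by field_simp
    calc -(s * ((a * r ^ (a - 1) * η r + r ^ a * deriv η r) * f r ^ p + r ^ a * η r * D r))
        = -((s * a) * (r ^ (a - 1) * η r * f r ^ p)) + -(s * (r ^ a * deriv η r * f r ^ p))
          + -(s * (r ^ a * η r * D r)) := by ring
      _ ≤ _ := by rw [hsa]; linarith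

/-- Hardy's inequality on `(0, R)`. -/
theorem hardy_lintegral {a p R : ℝ} (ha : a ≠ 0) (hp : 1 < p) (hR : 0 < R) :
    ∃ C : ℝ, 0 ≤ C ∧ ∀ f g : ℝ → ℝ, ContinuousOn f (Ioc 0 R) → ContinuousOn g (Ioc 0 R) →
      (∀ r ∈ Ioc 0 R, 0 ≤ f r) → (∀ r ∈ Ioc 0 R, 0 ≤ g r) → (∀ᶠ r in 𝓝[>] 0, f r = 0) →
      (∀ r ∈ Ioo 0 R, ∃ D, HasDerivAt (fun s => f s ^ p) D r ∧ |D| ≤ p * f r ^ (p - 1) * g r) →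
      ∫⁻ r in Ioo 0 (R / 2), ENNReal.ofReal (r ^ (a - 1) * f r ^ p) ≤
        ENNReal.ofReal C * ((∫⁻ r in Ioo 0 R, ENNReal.ofReal (r ^ (a - 1 + p) * g r ^ p))
          + ∫⁻ r in Ioo (R / 2) R, ENNReal.ofReal (r ^ (a - 1) * f r ^ p)) := by
  obtain ⟨η, hη, hη1, hηR, hη0, hηle, hη', K, hK0, hK⟩ := exists_radial_cutoff hR
  have hp0 : 0 < p := by linarith
  have ha' : 0 < |a| := abs_pos.2 ha
  set C₁ := p * (1 / (|a| / (2 * p))) ^ (p - 1) with hC₁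
  have hC₁0 : 0 ≤ C₁ := by positivity
  -- 2/|a| comes from dividing by the surviving coefficient |a|/2. The product KR bounds |η'| r,
  -- since r^a = r · r^{a-1}.
  refine ⟨2 / |a| * (K * R + C₁), by positivity, fun f g hfc hgc hf0 hg0 hfz hder => ?_⟩
  obtain ⟨r₁, hr₁, hfr₁⟩ : ∃ r₁ > 0, ∀ r ∈ Ioo 0 r₁, f r = 0 := by
    obtain ⟨u, hu, h⟩ := mem_nhdsGT_iff_exists_Ioo_subset.1 hfz
    exact ⟨u, hu, h⟩
  -- Any lower endpoint below R in the region where f vanishes would do; the constant does not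
  -- depend on ρ.
  set ρ := min r₁ R / 2 with hρdef
  have hmin : 0 < min r₁ R := lt_min hr₁ hR
  have hρ : 0 < ρ := by positivity
  have hρr : ρ < r₁ := by have := min_le_left r₁ R; linarith
  have hρR : ρ < R := by have := min_le_right r₁ R; linarith
  have hsub : Icc ρ R ⊆ Ioc 0 R := fun r hr => ⟨hρ.trans_le hr.1, hr.2⟩
  have key := hardy_integral ha hp hη hη0 hηR hρ hρR.le (hfc.mono hsub) (hgc.mono hsub)
    (fun r hr => hf0 r (hsub hr)) (fun r hr => hg0 r (hsub hr)) (hfr₁ ρ ⟨hρ, hρr⟩)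
    (fun r hr => hder r ⟨hρ.trans hr.1, hr.2⟩)
  rw [← hC₁] at key
  have hpos : ∀ r ∈ Icc ρ R, 0 < r := fun r hr => hρ.trans_le hr.1
  have hrc : ∀ b : ℝ, ContinuousOn (fun r : ℝ => r ^ b) (Icc ρ R) := fun b =>
    continuousOn_id.rpow_const fun r hr => Or.inl (hpos r hr).ne'
  have hfp : ContinuousOn (fun r => f r ^ p) (Icc ρ R) :=
    (hfc.mono hsub).rpow_const fun r _ => Or.inr hp0.le
  have hgp : ContinuousOn (fun r => g r ^ p) (Icc ρ R) :=
    (hgc.mono hsub).rpow_const fun r _ => Or.inr hp0.le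
  have hηc : ContinuousOn η (Icc ρ R) := hη.continuous.continuousOn
  have hη'c : ContinuousOn (fun r => |deriv η r|) (Icc ρ R) :=
    (hη.continuous_deriv (le_refl _)).abs.continuousOn
  have conv : ∀ h : ℝ → ℝ, ContinuousOn h (Icc ρ R) → (∀ r ∈ Icc ρ R, 0 ≤ h r) →
      ENNReal.ofReal (∫ r in ρ..R, h r) = ∫⁻ r in Ioo ρ R, ENNReal.ofReal (h r) := by
    intro h hc h0
    rw [intervalIntegral.integral_of_le hρR.le, integral_Ioc_eq_integral_Ioo,
      ofReal_integral_eq_lintegral_ofReal]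
    · exact hc.integrableOn_Icc.mono_set Ioo_subset_Icc_self
    · exact (ae_restrict_iff' measurableSet_Ioo).2 (ae_of_all _ fun r hr =>
        h0 r (Ioo_subset_Icc_self hr))
  have cA := conv (fun r => r ^ (a - 1) * η r * f r ^ p) (((hrc (a - 1)).mul hηc).mul hfp) fun r hr => by
    have := hpos r hr; have := hη0 r; have := hf0 r (hsub hr); positivity
  have cB := conv (fun r => |deriv η r| * r ^ a * f r ^ p) ((hη'c.mul (hrc a)).mul hfp) fun r hr => by
    have := hpos r hr; have := hf0 r (hsub hr); positivity
  have cG := conv (fun r => η r * (r ^ (a - 1 + p) * g r ^ p)) (hηc.mul ((hrc (a - 1 + p)).mul hgp)) fun r hr => by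
    have := hpos r hr; have := hη0 r; have := hg0 r (hsub hr); positivity
  set X := ∫⁻ r in Ioo 0 R, ENNReal.ofReal (r ^ (a - 1 + p) * g r ^ p)
  set Y := ∫⁻ r in Ioo (R / 2) R, ENNReal.ofReal (r ^ (a - 1) * f r ^ p) with hY
  have hA : ∫⁻ r in Ioo 0 (R / 2), ENNReal.ofReal (r ^ (a - 1) * f r ^ p) ≤
      ∫⁻ r in Ioo ρ R, ENNReal.ofReal (r ^ (a - 1) * η r * f r ^ p) := by
    rw [← lintegral_indicator measurableSet_Ioo, ← lintegral_indicator measurableSet_Ioo]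
    refine lintegral_mono fun r => ?_
    by_cases hr : r ∈ Ioo 0 (R / 2)
    · rw [indicator_of_mem hr]
      by_cases hr2 : ρ < r
      · rw [indicator_of_mem (mem_Ioo.2 ⟨hr2, by linarith [hr.2]⟩), hη1 r hr.2.le, mul_one]
      · rw [hfr₁ r ⟨hr.1, by linarith⟩, Real.zero_rpow hp0.ne']
        simp
    · rw [indicator_of_notMem hr]; exact zero_le
  have hB : ∫⁻ r in Ioo ρ R, ENNReal.ofReal (|deriv η r| * r ^ a * f r ^ p) ≤
      ENNReal.ofReal (K * R) * Y := by
    -- The derivative of η is only known to vanish for r < R / 2, so the endpoint R / 2 is put back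
    -- in, which changes nothing almost everywhere.
    rw [hY, setLIntegral_congr (Ioo_ae_eq_Ico (a := R / 2) (b := R)), ← lintegral_const_mul' _ _ ENNReal.ofReal_ne_top,
      ← lintegral_indicator measurableSet_Ioo, ← lintegral_indicator measurableSet_Ico]
    refine lintegral_mono fun r => ?_
    by_cases hr : r ∈ Ioo ρ R
    · rw [indicator_of_mem hr]
      have hr0 := hpos r (Ioo_subset_Icc_self hr)
      have hfr := hf0 r (hsub (Ioo_subset_Icc_self hr))
      by_cases hr2 : R / 2 ≤ r
      · rw [indicator_of_mem (mem_Ico.2 ⟨hr2, hr.2⟩), ← ENNReal.ofReal_mul (by positivity)]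
        apply ENNReal.ofReal_le_ofReal
        have h1 := hK r ⟨hr0.le, hr.2.le⟩
        have hra : r ^ a = r ^ (a - 1) * r := by
          rw [← Real.rpow_add_one hr0.ne']; congr 1; ring
        rw [hra]
        calc |deriv η r| * (r ^ (a - 1) * r) * f r ^ p ≤ K * (r ^ (a - 1) * R) * f r ^ p := by
              have := hr.2.le
              gcongr
          _ = _ := by ring
      · rw [hη' r (by linarith)]
        simp
    · rw [indicator_of_notMem hr]; exact zero_le
  have hG : ∫⁻ r in Ioo ρ R, ENNReal.ofReal (η r * (r ^ (a - 1 + p) * g r ^ p)) ≤ X := by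
    refine le_trans (setLIntegral_mono' measurableSet_Ioo fun r hr => ?_)
      (lintegral_mono_set (Ioo_subset_Ioo_left hρ.le))
    apply ENNReal.ofReal_le_ofReal
    have := hpos r (Ioo_subset_Icc_self hr)
    have := hg0 r (hsub (Ioo_subset_Icc_self hr))
    exact mul_le_of_le_one_left (by positivity) (hηle r)
  refine hA.trans ?_
  rw [← cA]
  have key2 : (∫ r in ρ..R, r ^ (a - 1) * η r * f r ^ p) ≤ 2 / |a| *
      ((∫ r in ρ..R, |deriv η r| * r ^ a * f r ^ p)
        + C₁ * ∫ r in ρ..R, η r * (r ^ (a - 1 + p) * g r ^ p)) := by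
    rw [div_mul_eq_mul_div, le_div_iff₀ ha']
    linarith
  refine (ENNReal.ofReal_le_ofReal key2).trans ?_
  rw [ENNReal.ofReal_mul (by positivity), ENNReal.ofReal_mul (by positivity),
    mul_assoc (ENNReal.ofReal _)]
  refine mul_le_mul_right ?_ _
  refine ENNReal.ofReal_add_le.trans ?_
  rw [ENNReal.ofReal_mul hC₁0, cB, cG, ENNReal.ofReal_add (by positivity) hC₁0, add_mul]
  refine add_le_add (hB.trans ?_) ?_
  · gcongr; exact le_add_self
  · gcongr; exact hG.trans le_self_add

end Hardy

/-! ### Parametrizations of a Riemannian manifold -/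

section Param

set_option maxSynthPendingDepth 3
set_option linter.unusedSectionVars false

variable {n : ℕ} {X : Type*} [TopologicalSpace X] [ChartedSpace (EuclideanSpace ℝ (Fin n)) X]

/-- A smooth parametrization of an open subset of the manifold `X`. -/
structure IsParam (ψ : OpenPartialHomeomorph (EuclideanSpace ℝ (Fin n)) X) : Prop where
  smooth : ContMDiffOn (𝓡 n) (𝓡 n) ∞ ψ ψ.source
  smooth_symm : ContMDiffOn (𝓡 n) (𝓡 n) ∞ ψ.symm ψ.target

lemma IsParam.mdifferentiable {ψ : OpenPartialHomeomorph (EuclideanSpace ℝ (Fin n)) X}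
    (hψ : IsParam ψ) : ψ.MDifferentiable (𝓡 n) (𝓡 n) :=
  ⟨hψ.smooth.mdifferentiableOn (by simp), hψ.smooth_symm.mdifferentiableOn (by simp)⟩

/-- The preferred chart, as a parametrization. -/
def chartParam (n : ℕ) {X : Type*} [TopologicalSpace X]
    [ChartedSpace (EuclideanSpace ℝ (Fin n)) X] (c : X) :
    OpenPartialHomeomorph (EuclideanSpace ℝ (Fin n)) X :=
  (chartAt (EuclideanSpace ℝ (Fin n)) c).symm

lemma coe_chartParam (c : X) : ⇑(chartParam n c) = (extChartAt (𝓡 n) c).symm := rfl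

lemma chartParam_source (c : X) : (chartParam n c).source = (extChartAt (𝓡 n) c).target := by
  simp [chartParam]

lemma mem_chartParam_target (c : X) : c ∈ (chartParam n c).target :=
  mem_chart_source _ c

lemma isParam_chartParam [IsManifold (𝓡 n) ∞ X] (c : X) : IsParam (chartParam n c) where
  smooth := contMDiffOn_chart_symm
  smooth_symm := contMDiffOn_chart

/-- The change of coordinates between two parametrizations. -/
def transition (φ ψ : OpenPartialHomeomorph (EuclideanSpace ℝ (Fin n)) X) :
    EuclideanSpace ℝ (Fin n) → EuclideanSpace ℝ (Fin n) := fun z => φ.symm (ψ z)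

lemma isOpen_transition_source (φ ψ : OpenPartialHomeomorph (EuclideanSpace ℝ (Fin n)) X) :
    IsOpen (ψ.source ∩ ψ ⁻¹' φ.target) :=
  ψ.isOpen_inter_preimage φ.open_target

lemma contDiffOn_transition {φ ψ : OpenPartialHomeomorph (EuclideanSpace ℝ (Fin n)) X}
    (hφ : IsParam φ) (hψ : IsParam ψ) :
    ContDiffOn ℝ ∞ (transition φ ψ) (ψ.source ∩ ψ ⁻¹' φ.target) := by
  rw [← contMDiffOn_iff_contDiffOn]
  exact hφ.smooth_symm.comp (hψ.smooth.mono inter_subset_left) fun z hz => hz.2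

lemma mapsTo_transition (φ ψ : OpenPartialHomeomorph (EuclideanSpace ℝ (Fin n)) X) :
    MapsTo (transition φ ψ) (ψ.source ∩ ψ ⁻¹' φ.target) φ.source := fun _ hz =>
  φ.map_target hz.2

lemma apply_transition (φ ψ : OpenPartialHomeomorph (EuclideanSpace ℝ (Fin n)) X)
    {z : EuclideanSpace ℝ (Fin n)} (hz : z ∈ ψ.source ∩ ψ ⁻¹' φ.target) :
    φ (transition φ ψ z) = ψ z := φ.right_inv hz.2

lemma mfderiv_eq_mfderiv_transition {φ ψ : OpenPartialHomeomorph (EuclideanSpace ℝ (Fin n)) X}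
    (hφ : IsParam φ) (hψ : IsParam ψ) {z : EuclideanSpace ℝ (Fin n)}
    (hz : z ∈ ψ.source ∩ ψ ⁻¹' φ.target) (v : EuclideanSpace ℝ (Fin n)) :
    (mfderiv (𝓡 n) (𝓡 n) ψ z v : EuclideanSpace ℝ (Fin n))
      = mfderiv (𝓡 n) (𝓡 n) φ (transition φ ψ z) (fderiv ℝ (transition φ ψ) z v) := by
  have hO := (isOpen_transition_source φ ψ).mem_nhds hz
  have h1 : ψ =ᶠ[𝓝 z] φ ∘ transition φ ψ :=
    Filter.mem_of_superset hO fun y hy => (apply_transition φ ψ hy).symm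
  have h2 : MDifferentiableAt (𝓡 n) (𝓡 n) (transition φ ψ) z :=
    (((contDiffOn_transition hφ hψ).contDiffAt hO).differentiableAt (by simp)).mdifferentiableAt
  have h3 : MDifferentiableAt (𝓡 n) (𝓡 n) φ (transition φ ψ z) :=
    hφ.mdifferentiable.mdifferentiableAt (mapsTo_transition φ ψ hz)
  have h4 : HasMFDerivAt (𝓡 n) (𝓡 n) ψ z _ :=
    (h3.hasMFDerivAt.comp z h2.hasMFDerivAt).congr_of_eventuallyEq h1
  rw [h4.mfderiv, mfderiv_eq_fderiv]
  rfl

/-- The differential of ψ factors through that of the transition map and is injective; in equal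
dimensions injective means surjective. -/
lemma surjective_fderiv_transition {φ ψ : OpenPartialHomeomorph (EuclideanSpace ℝ (Fin n)) X}
    (hφ : IsParam φ) (hψ : IsParam ψ) {z : EuclideanSpace ℝ (Fin n)}
    (hz : z ∈ ψ.source ∩ ψ ⁻¹' φ.target) :
    Function.Surjective (fderiv ℝ (transition φ ψ) z) := by
  have hinj : Function.Injective (fderiv ℝ (transition φ ψ) z) := by
    intro v w hvw
    apply hψ.mdifferentiable.mfderiv_injective hz.1
    have h1 := mfderiv_eq_mfderiv_transition hφ hψ hz v
    have h2 := mfderiv_eq_mfderiv_transition hφ hψ hz w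
    rw [hvw] at h1
    exact h1.trans h2.symm
  exact LinearMap.surjective_of_injective (f := (fderiv ℝ (transition φ ψ) z).toLinearMap) hinj

section Metric

variable [RiemannianBundle (fun y : X => TangentSpace (𝓡 n) y)]

/-- The Riemannian metric, read in a parametrization. -/
def paramMetric (ψ : EuclideanSpace ℝ (Fin n) → X) (z : EuclideanSpace ℝ (Fin n)) :
    EuclideanSpace ℝ (Fin n) →L[ℝ] EuclideanSpace ℝ (Fin n) →L[ℝ] ℝ :=
  (innerSL ℝ : TangentSpace (𝓡 n) (ψ z) →L[ℝ] TangentSpace (𝓡 n) (ψ z) →L[ℝ] ℝ).bilinearComp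
    (mfderiv (𝓡 n) (𝓡 n) ψ z) (mfderiv (𝓡 n) (𝓡 n) ψ z)

lemma paramMetric_apply (ψ : EuclideanSpace ℝ (Fin n) → X) (z v w : EuclideanSpace ℝ (Fin n)) :
    paramMetric ψ z v w = inner ℝ
      (mfderiv (𝓡 n) (𝓡 n) ψ z v : TangentSpace (𝓡 n) (ψ z))
      (mfderiv (𝓡 n) (𝓡 n) ψ z w : TangentSpace (𝓡 n) (ψ z)) := rfl

lemma chartMetric_eq (c : X) (z v w : EuclideanSpace ℝ (Fin n)) :
    chartMetric c z v w = paramMetric (chartParam n c) z v w := rfl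

/-- The image of a constant vector field under the tangent map of ψ. These sections reduce
smoothness of the metric coefficients to `inner_bundle`. -/
lemma contMDiffOn_mfderiv_apply [IsManifold (𝓡 n) ∞ X]
    {ψ : OpenPartialHomeomorph (EuclideanSpace ℝ (Fin n)) X}
    (hψ : IsParam ψ) (v : EuclideanSpace ℝ (Fin n)) :
    ContMDiffOn (𝓡 n) ((𝓡 n).prod (𝓡 n)) ∞
      (fun z => (⟨ψ z, mfderiv (𝓡 n) (𝓡 n) ψ z v⟩ :
        TotalSpace (EuclideanSpace ℝ (Fin n)) (TangentSpace (𝓡 n) : X → Type _))) ψ.source := by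
  have h1 : ContMDiff (𝓡 n) ((𝓡 n).prod (𝓡 n)) ∞
      (fun z => (⟨z, v⟩ : TotalSpace (EuclideanSpace ℝ (Fin n))
        (TangentSpace (𝓡 n) : EuclideanSpace ℝ (Fin n) → Type _))) := fun z =>
    contMDiffAt_vectorSpace_iff_contDiffAt.2 contDiffAt_const
  have h2 := hψ.smooth.contMDiffOn_tangentMapWithin (m := ∞) (by simp)
    ψ.open_source.uniqueMDiffOn
  have h3 := h2.comp (h1.contMDiffOn (s := ψ.source)) fun z hz => hz
  refine h3.congr fun z hz => ?_
  simp only [Function.comp, tangentMapWithin]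
  rw [mfderivWithin_of_isOpen ψ.open_source hz]

lemma IsParam.isMetricOn [IsManifold (𝓡 n) ∞ X]
    [IsContMDiffRiemannianBundle (𝓡 n) ∞ (EuclideanSpace ℝ (Fin n))
      (fun y : X => TangentSpace (𝓡 n) y)]
    {ψ : OpenPartialHomeomorph (EuclideanSpace ℝ (Fin n)) X}
    (hψ : IsParam ψ) : IsMetricOn (paramMetric ψ) ψ.source where
  isOpen := ψ.open_source
  smooth := by
    rw [contDiffOn_clm_apply]
    intro v
    rw [contDiffOn_clm_apply]
    intro w
    rw [← contMDiffOn_iff_contDiffOn]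
    exact (contMDiffOn_mfderiv_apply hψ v).inner_bundle (contMDiffOn_mfderiv_apply hψ w)
  symm z _ v w := by
    rw [paramMetric_apply, paramMetric_apply, real_inner_comm]
  pos z hz v hv := by
    rw [paramMetric_apply, real_inner_self_pos]
    intro h0
    exact hv (hψ.mdifferentiable.mfderiv_injective hz (h0.trans (map_zero _).symm))

lemma paramMetric_transition {φ ψ : OpenPartialHomeomorph (EuclideanSpace ℝ (Fin n)) X}
    (hφ : IsParam φ) (hψ : IsParam ψ) {z : EuclideanSpace ℝ (Fin n)}
    (hz : z ∈ ψ.source ∩ ψ ⁻¹' φ.target) (v w : EuclideanSpace ℝ (Fin n)) :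
    paramMetric ψ z v w = paramMetric φ (transition φ ψ z)
      (fderiv ℝ (transition φ ψ) z v) (fderiv ℝ (transition φ ψ) z w) := by
  rw [paramMetric_apply, paramMetric_apply]
  -- The inner product as a function of the base point with arguments in the fixed model space, so
  -- that equal base points can be rewritten although the tangent spaces are different types.
  let G : X → EuclideanSpace ℝ (Fin n) → EuclideanSpace ℝ (Fin n) → ℝ := fun y a b =>
    @inner ℝ (TangentSpace (𝓡 n) y) _ a b
  change G (ψ z) _ _ = G (φ (transition φ ψ z)) _ _
  rw [apply_transition φ ψ hz]
  exact congrArg₂ (G (ψ z)) (mfderiv_eq_mfderiv_transition hφ hψ hz v)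
    (mfderiv_eq_mfderiv_transition hφ hψ hz w)

/-! ### The covariant derivatives in a parametrization -/

variable [IsManifold (𝓡 n) ∞ X]
  [IsContMDiffRiemannianBundle (𝓡 n) ∞ (EuclideanSpace ℝ (Fin n))
    (fun y : X => TangentSpace (𝓡 n) y)]

lemma gram_eq (c : X) (z : EuclideanSpace ℝ (Fin n)) :
    gram c z = gramOf (paramMetric (chartParam n c) z) fun a => EuclideanSpace.single a 1 := rfl

lemma fderiv_paramMetric_apply {ψ : OpenPartialHomeomorph (EuclideanSpace ℝ (Fin n)) X}
    (hψ : IsParam ψ) {z : EuclideanSpace ℝ (Fin n)} (hz : z ∈ ψ.source)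
    (a v w : EuclideanSpace ℝ (Fin n)) :
    fderiv ℝ (fun z' => paramMetric ψ z' v w) z a = fderiv ℝ (paramMetric ψ) z a v w := by
  have hd : DifferentiableAt ℝ (paramMetric ψ) z :=
    (hψ.isMetricOn.smooth.contDiffAt (ψ.open_source.mem_nhds hz)).differentiableAt (by simp)
  have h : HasFDerivAt (fun z' => paramMetric ψ z' v w)
      ((ContinuousLinearMap.apply ℝ ℝ w ∘L ContinuousLinearMap.apply ℝ _ v) ∘L
        fderiv ℝ (paramMetric ψ) z) z :=
    (ContinuousLinearMap.apply ℝ ℝ w ∘L ContinuousLinearMap.apply ℝ _ v).hasFDerivAt.comp z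
      hd.hasFDerivAt
  rw [h.fderiv]
  rfl

/-- The matrix formula and the inverse operator solve the same linear system: both vectors pair with
each basis vector to the lowered Christoffel symbol, and the metric is nondegenerate. -/
lemma christoffel_eq (c : X) {z : EuclideanSpace ℝ (Fin n)} (hz : z ∈ (chartParam n c).source)
    (v w : EuclideanSpace ℝ (Fin n)) :
    christoffel c z v w = christ (paramMetric (chartParam n c)) z v w := by
  have hB := (isParam_chartParam (n := n) c).isMetricOn
  set B := paramMetric (chartParam n c) with hBdef
  set β := (EuclideanSpace.basisFun (Fin n) ℝ).toBasis with hβ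
  have hβa : ∀ a, β a = EuclideanSpace.single a 1 := fun a => by simp [hβ]
  have hβf : (fun a => EuclideanSpace.single a 1 : Fin n → EuclideanSpace ℝ (Fin n)) = β :=
    funext fun a => (hβa a).symm
  have hlow : ∀ ξ, christoffelFirst c z v w ξ
      = (fderiv ℝ B z v w ξ + fderiv ℝ B z w v ξ - fderiv ℝ B z ξ v w) / 2 := fun ξ => by
    simp only [christoffelFirst, chartMetric_eq,
      fderiv_paramMetric_apply (isParam_chartParam (n := n) c) hz, hBdef]
  have hdet : IsUnit (gramOf (B z) β).det := gramOf_isUnit_det (hB.isInner hz) β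
  have hc : ∀ a, B z (christoffel c z v w) (β a) = B z (christ B z v w) (β a) := by
    intro a
    rw [hB.apply_christ hz, ← hlow]
    set γ : Fin n → ℝ := fun b => christoffelFirst c z v w (EuclideanSpace.single b 1) with hγ
    have e1 : christoffel c z v w = ∑ b, Matrix.mulVec (gramOf (B z) β)⁻¹ γ b • β b := by
      rw [← β.sum_repr (christoffel c z v w)]
      refine Finset.sum_congr rfl fun b _ => ?_
      rw [← hβf]
      simp [hβ, christoffel, gram_eq, hγ, hBdef]
    have e2 : B z (christoffel c z v w) (β a)
        = Matrix.mulVec (gramOf (B z) β) (Matrix.mulVec (gramOf (B z) β)⁻¹ γ) a := by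
      rw [e1]
      simp only [map_sum, map_smul, _root_.sum_apply, _root_.smul_apply, smul_eq_mul]
      rw [Matrix.mulVec, dotProduct]
      refine Finset.sum_congr rfl fun b _ => ?_
      rw [mul_comm, hB.symm z hz]
      rfl
    rw [e2, Matrix.mulVec_mulVec, Matrix.mul_nonsing_inv _ hdet, Matrix.one_mulVec, hβa]
  refine hB.eq_of_forall hz fun ξ => ?_
  rw [← β.sum_repr ξ]
  simp only [map_sum, map_smul, hc]

lemma chartCovDeriv_eq (c : X) {u : X → ℝ} (hu : ContMDiff (𝓡 n) 𝓘(ℝ, ℝ) ∞ u) (i : ℕ) :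
    ∀ z ∈ (chartParam n c).source, ∀ v, chartCovDeriv c u i z v
      = covT (paramMetric (chartParam n c)) (u ∘ chartParam n c) i z v := by
  have hB := (isParam_chartParam (n := n) c).isMetricOn
  have hf : ContDiffOn ℝ ∞ (u ∘ chartParam n c) (chartParam n c).source := by
    rw [← contMDiffOn_iff_contDiffOn]
    exact hu.comp_contMDiffOn (isParam_chartParam c).smooth
  induction i with
  | zero => intro z hz v; rfl
  | succ i ih =>
    intro z hz v
    rw [covT_succ_apply, chartCovDeriv]
    have hO := (chartParam n c).open_source.mem_nhds hz
    have hT := ((hB.contDiffOn_covT hf i).contDiffAt hO).differentiableAt (by simp)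
    have h1 : fderiv ℝ (fun z' => chartCovDeriv c u i z' (Fin.tail v)) z (v 0)
        = fderiv ℝ (covT (paramMetric (chartParam n c)) (u ∘ chartParam n c) i) z (v 0)
            (Fin.tail v) := by
      rw [Filter.EventuallyEq.fderiv_eq (Filter.mem_of_superset hO fun y hy => ih y hy _),
        fderiv_continuousMultilinear_apply_const_apply hT]
    refine congrArg₂ (· - ·) h1 (Finset.sum_congr rfl fun j _ => ?_)
    rw [ih z hz, christoffel_eq c hz]

/-- The square of the norm of `∇ⁱu`, read in a parametrization. -/
def paramNormSq (ψ : EuclideanSpace ℝ (Fin n) → X) (u : X → ℝ) (i : ℕ)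
    (z : EuclideanSpace ℝ (Fin n)) : ℝ :=
  normSq (paramMetric ψ z) (covT (paramMetric ψ) (u ∘ ψ) i z)

lemma IsParam.contDiffOn_comp {ψ : OpenPartialHomeomorph (EuclideanSpace ℝ (Fin n)) X}
    (hψ : IsParam ψ) {u : X → ℝ} (hu : ContMDiff (𝓡 n) 𝓘(ℝ, ℝ) ∞ u) :
    ContDiffOn ℝ ∞ (u ∘ ψ) ψ.source := by
  rw [← contMDiffOn_iff_contDiffOn]
  exact hu.comp_contMDiffOn hψ.smooth

lemma IsMetricOn.restrict {E : Type*} [NormedAddCommGroup E] [NormedSpace ℝ E]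
    {B : E → E →L[ℝ] E →L[ℝ] ℝ} {Ω Ω' : Set E} (hB : IsMetricOn B Ω) (ho : IsOpen Ω')
    (hs : Ω' ⊆ Ω) : IsMetricOn B Ω' :=
  ⟨ho, hB.smooth.mono hs, fun z hz => hB.symm z (hs hz), fun z hz => hB.pos z (hs hz)⟩

/-- The differential of the coordinate change carries an orthonormal frame to an orthonormal frame,
and by `IsMetricOn.covT_pull` the components of ∇ⁱu in the two frames coincide. -/
lemma paramNormSq_transition {φ ψ : OpenPartialHomeomorph (EuclideanSpace ℝ (Fin n)) X}
    (hφ : IsParam φ) (hψ : IsParam ψ) {u : X → ℝ} (hu : ContMDiff (𝓡 n) 𝓘(ℝ, ℝ) ∞ u) (i : ℕ)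
    {z : EuclideanSpace ℝ (Fin n)} (hz : z ∈ ψ.source ∩ ψ ⁻¹' φ.target) :
    paramNormSq ψ u i z = paramNormSq φ u i (transition φ ψ z) := by
  have hBψ := hψ.isMetricOn.restrict (isOpen_transition_source φ ψ) inter_subset_left
  obtain ⟨e, he⟩ := (hBψ.isInner hz).exists_orthonormal
  have he' : IsOrthonormalFor (paramMetric φ (transition φ ψ z))
      (fun a => fderiv ℝ (transition φ ψ) z (e a)) := fun a b => by
    rw [← paramMetric_transition hφ hψ hz]
    exact he a b
  rw [paramNormSq, paramNormSq, normSq_eq_sum_sq he (by simp), normSq_eq_sum_sq he' (by simp)]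
  refine Finset.sum_congr rfl fun f _ => ?_
  rw [hφ.isMetricOn.covT_pull hBψ (contDiffOn_transition hφ hψ) (mapsTo_transition φ ψ)
    (fun y hy => surjective_fderiv_transition hφ hψ hy)
    (fun y hy => paramMetric_transition hφ hψ hy) (hφ.contDiffOn_comp hu)
    (fun y hy => by simp [apply_transition φ ψ hy]) i z hz]

/-- The chart at `y` sends an orthonormal basis of the tangent space at `y` to an orthonormal frame
of the metric read in that chart, so the defining sum of squares is a `normSq`. -/
lemma covDerivNorm_eq_chart {u : X → ℝ} (hu : ContMDiff (𝓡 n) 𝓘(ℝ, ℝ) ∞ u) (i : ℕ) (y : X) :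
    covDerivNorm (n := n) u i y = √(paramNormSq (chartParam n y) u i (extChartAt (𝓡 n) y y)) := by
  have hz : extChartAt (𝓡 n) y y ∈ (chartParam n y).source := by
    rw [chartParam_source]; exact mem_extChartAt_target y
  have : FiniteDimensional ℝ (TangentSpace (𝓡 n) y) :=
    inferInstanceAs (FiniteDimensional ℝ (EuclideanSpace ℝ (Fin n)))
  have hyy : chartParam n y (extChartAt (𝓡 n) y y) = y := by
    rw [coe_chartParam]; exact extChartAt_to_inv y
  have hmd := (isParam_chartParam (n := n) y).mdifferentiable.symm.symm_comp_deriv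
    (mem_chartParam_target y)
  have hinv : ∀ b : TangentSpace (𝓡 n) y,
      (mfderiv (𝓡 n) (𝓡 n) (chartParam n y) (extChartAt (𝓡 n) y y)
        (mfderiv (𝓡 n) (𝓡 n) (extChartAt (𝓡 n) y) y b) : EuclideanSpace ℝ (Fin n)) = b :=
    fun b => congrArg (fun L => L b) hmd
  have he : IsOrthonormalFor (paramMetric (chartParam n y) (extChartAt (𝓡 n) y y))
      (fun a => (mfderiv (𝓡 n) (𝓡 n) (extChartAt (𝓡 n) y) y
        (stdOrthonormalBasis ℝ (TangentSpace (𝓡 n) y) a) : EuclideanSpace ℝ (Fin n))) := by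
    intro a b
    let G : X → EuclideanSpace ℝ (Fin n) → EuclideanSpace ℝ (Fin n) → ℝ := fun y a b =>
      @inner ℝ (TangentSpace (𝓡 n) y) _ a b
    have h1 : paramMetric (chartParam n y) (extChartAt (𝓡 n) y y)
        (mfderiv (𝓡 n) (𝓡 n) (extChartAt (𝓡 n) y) y
          (stdOrthonormalBasis ℝ (TangentSpace (𝓡 n) y) a) : EuclideanSpace ℝ (Fin n))
        (mfderiv (𝓡 n) (𝓡 n) (extChartAt (𝓡 n) y) y
          (stdOrthonormalBasis ℝ (TangentSpace (𝓡 n) y) b) : EuclideanSpace ℝ (Fin n))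
        = G (chartParam n y (extChartAt (𝓡 n) y y))
          (stdOrthonormalBasis ℝ (TangentSpace (𝓡 n) y) a)
          (stdOrthonormalBasis ℝ (TangentSpace (𝓡 n) y) b) :=
      congrArg₂ (G _) (hinv _) (hinv _)
    rw [h1, hyy]
    exact orthonormal_iff_ite.1 (stdOrthonormalBasis ℝ (TangentSpace (𝓡 n) y)).orthonormal a b
  have hcard : Fintype.card (Fin (Module.finrank ℝ (TangentSpace (𝓡 n) y)))
      = Module.finrank ℝ (EuclideanSpace ℝ (Fin n)) := by
    rw [Fintype.card_fin]; rfl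
  rw [covDerivNorm, paramNormSq, normSq_eq_sum_sq he hcard]
  congr 1
  refine Finset.sum_congr rfl fun f _ => ?_
  exact congrArg (· ^ 2) (chartCovDeriv_eq y hu i _ hz _)

/-- The norm of `∇ⁱu` can be computed in any parametrization. -/
theorem covDerivNorm_eq {ψ : OpenPartialHomeomorph (EuclideanSpace ℝ (Fin n)) X}
    (hψ : IsParam ψ) {u : X → ℝ} (hu : ContMDiff (𝓡 n) 𝓘(ℝ, ℝ) ∞ u) (i : ℕ)
    {z : EuclideanSpace ℝ (Fin n)} (hz : z ∈ ψ.source) :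
    covDerivNorm (n := n) u i (ψ z) = √(paramNormSq ψ u i z) := by
  rw [covDerivNorm_eq_chart hu, paramNormSq_transition (isParam_chartParam (ψ z)) hψ hu i
    ⟨hz, mem_chartParam_target (ψ z)⟩]
  rfl

lemma IsParam.continuousOn_paramNormSq {ψ : OpenPartialHomeomorph (EuclideanSpace ℝ (Fin n)) X}
    (hψ : IsParam ψ) {u : X → ℝ} (hu : ContMDiff (𝓡 n) 𝓘(ℝ, ℝ) ∞ u) (i : ℕ) :
    ContinuousOn (paramNormSq ψ u i) ψ.source := fun _ hz =>
  ((hψ.isMetricOn.isInner hz).continuousAt_normSq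
    (hψ.isMetricOn.smooth.continuousOn.continuousAt (ψ.open_source.mem_nhds hz))
    ((hψ.isMetricOn.contDiffOn_covT (hψ.contDiffOn_comp hu) i).continuousOn.continuousAt
      (ψ.open_source.mem_nhds hz))).continuousWithinAt

lemma continuous_covDerivNorm {u : X → ℝ} (hu : ContMDiff (𝓡 n) 𝓘(ℝ, ℝ) ∞ u) (i : ℕ) :
    Continuous (covDerivNorm (n := n) u i) := by
  rw [continuous_iff_continuousAt]
  intro y
  set ψ := chartParam n y
  have hψ : IsParam ψ := isParam_chartParam y
  have hy : y ∈ ψ.target := mem_chartParam_target y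
  have hO := ψ.open_target.mem_nhds hy
  have h1 : covDerivNorm (n := n) u i =ᶠ[𝓝 y] fun y' => √(paramNormSq ψ u i (ψ.symm y')) := by
    filter_upwards [hO] with y' hy'
    rw [← covDerivNorm_eq hψ hu i (ψ.map_target hy'), ψ.right_inv hy']
  refine ContinuousAt.congr ?_ h1.symm
  refine Real.continuous_sqrt.continuousAt.comp ?_
  exact ContinuousAt.comp (g := paramNormSq ψ u i)
    ((hψ.continuousOn_paramNormSq hu i).continuousAt (ψ.open_source.mem_nhds (ψ.map_target hy)))
    (ψ.symm.continuousAt hy)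

lemma covDerivNorm_nonneg (u : X → ℝ) (i : ℕ) (y : X) : 0 ≤ covDerivNorm (n := n) u i y :=
  Real.sqrt_nonneg _

lemma normSq_zero {E : Type*} [NormedAddCommGroup E] [NormedSpace ℝ E] [FiniteDimensional ℝ E]
    (B : E →L[ℝ] E →L[ℝ] ℝ) (i : ℕ) : normSq B (0 : E [×i]→L[ℝ] ℝ) = 0 := by
  simp [normSq, frameNormSq]

lemma covDerivNorm_eq_zero {u : X → ℝ} (hu : ContMDiff (𝓡 n) 𝓘(ℝ, ℝ) ∞ u) (i : ℕ) {y : X}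
    (hy : y ∉ tsupport u) : covDerivNorm (n := n) u i y = 0 := by
  set ψ := chartParam n y
  have hψ : IsParam ψ := isParam_chartParam y
  have hyt : y ∈ ψ.target := mem_chartParam_target y
  have hz := ψ.map_target hyt
  rw [← ψ.right_inv hyt, covDerivNorm_eq hψ hu i hz, paramNormSq]
  have h0 : u ∘ ψ =ᶠ[𝓝 (ψ.symm y)] fun _ => 0 := by
    have h1 : ∀ᶠ y' in 𝓝 (ψ (ψ.symm y)), u y' = 0 := by
      rw [ψ.right_inv hyt]
      exact notMem_tsupport_iff_eventuallyEq.1 hy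
    exact (ψ.continuousAt hz).eventually h1
  rw [(covT_congr (EventuallyEq.refl _ _) h0 i).self_of_nhds, covT_zero_fun]
  simp [normSq_zero]

lemma covDerivNorm_add_le {u v : X → ℝ} (hu : ContMDiff (𝓡 n) 𝓘(ℝ, ℝ) ∞ u)
    (hv : ContMDiff (𝓡 n) 𝓘(ℝ, ℝ) ∞ v) (i : ℕ) (y : X) :
    covDerivNorm (n := n) (u + v) i y
      ≤ covDerivNorm (n := n) u i y + covDerivNorm (n := n) v i y := by
  set ψ := chartParam n y
  have hψ : IsParam ψ := isParam_chartParam y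
  have hyt : y ∈ ψ.target := mem_chartParam_target y
  have hz := ψ.map_target hyt
  rw [← ψ.right_inv hyt, covDerivNorm_eq hψ hu i hz, covDerivNorm_eq hψ hv i hz,
    covDerivNorm_eq hψ (hu.add hv) i hz]
  simp only [paramNormSq]
  have h := hψ.isMetricOn.covT_add (hψ.contDiffOn_comp hu) (hψ.contDiffOn_comp hv) i _ hz
  have h' : covT (paramMetric ψ) ((u + v) ∘ ψ) i (ψ.symm y)
      = covT (paramMetric ψ) (u ∘ ψ) i (ψ.symm y) + covT (paramMetric ψ) (v ∘ ψ) i (ψ.symm y) := h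
  rw [h']
  exact (hψ.isMetricOn.isInner hz).sqrt_normSq_add_le _ _

lemma covDerivNorm_smul {u : X → ℝ} (hu : ContMDiff (𝓡 n) 𝓘(ℝ, ℝ) ∞ u) (a : ℝ) (i : ℕ) (y : X) :
    covDerivNorm (n := n) (a • u) i y = |a| * covDerivNorm (n := n) u i y := by
  set ψ := chartParam n y
  have hψ : IsParam ψ := isParam_chartParam y
  have hyt : y ∈ ψ.target := mem_chartParam_target y
  have hz := ψ.map_target hyt
  have hau : ContMDiff (𝓡 n) 𝓘(ℝ, ℝ) ∞ (a • u) :=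
    contMDiff_const (c := a) |>.mul hu
  rw [← ψ.right_inv hyt, covDerivNorm_eq hψ hu i hz, covDerivNorm_eq hψ hau i hz]
  simp only [paramNormSq]
  have h := hψ.isMetricOn.covT_smul (hψ.contDiffOn_comp hu) a i _ hz
  have h' : covT (paramMetric ψ) ((a • u) ∘ ψ) i (ψ.symm y)
      = a • covT (paramMetric ψ) (u ∘ ψ) i (ψ.symm y) := h
  rw [h', normSq_smul, Real.sqrt_mul (sq_nonneg a), Real.sqrt_sq_eq_abs]

end Metric

end Param

/-! ### The Riemannian volume in a parametrization -/

section Volume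

set_option maxSynthPendingDepth 3
set_option linter.unusedSectionVars false

lemma det_gramOf_comp {E : Type*} [NormedAddCommGroup E] [NormedSpace ℝ E] {ι : Type*} [Fintype ι]
    [DecidableEq ι] (B B' : E →L[ℝ] E →L[ℝ] ℝ) (L : E →ₗ[ℝ] E)
    (h : ∀ v w, B' v w = B (L v) (L w)) (β : Module.Basis ι ℝ E) :
    (gramOf B' β).det = LinearMap.det L ^ 2 * (gramOf B β).det := by
  set M := LinearMap.toMatrix β β L with hM
  have hL : ∀ a, L (β a) = ∑ c, M c a • β c := fun a => by
    rw [← β.sum_repr (L (β a))]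
    simp [hM, LinearMap.toMatrix_apply]
  have : gramOf B' β = M.transpose * gramOf B β * M := by
    ext a b
    simp only [gramOf, Matrix.of_apply, h, hL, Matrix.mul_apply, Matrix.transpose_apply]
    simp only [map_sum, map_smul, _root_.sum_apply, _root_.smul_apply, smul_eq_mul,
      Finset.sum_mul, Finset.mul_sum]
    refine Finset.sum_congr rfl fun c _ => Finset.sum_congr rfl fun d _ => by ring
  rw [this, Matrix.det_mul, Matrix.det_mul, Matrix.det_transpose, ← LinearMap.det_toMatrix β L]
  ring

variable {n : ℕ}

/-- The volume density `√(det g)` of an inner product on the Euclidean space. -/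
def volDensity (B : EuclideanSpace ℝ (Fin n) →L[ℝ] EuclideanSpace ℝ (Fin n) →L[ℝ] ℝ) : ℝ :=
  √(gramOf B fun a => EuclideanSpace.single a (1 : ℝ)).det

lemma basisFun_eq_single :
    (fun a => EuclideanSpace.single a 1 : Fin n → EuclideanSpace ℝ (Fin n))
      = (EuclideanSpace.basisFun (Fin n) ℝ).toBasis := funext fun a => by simp

lemma volDensity_nonneg (B : EuclideanSpace ℝ (Fin n) →L[ℝ] EuclideanSpace ℝ (Fin n) →L[ℝ] ℝ) :
    0 ≤ volDensity B := Real.sqrt_nonneg _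

lemma volDensity_comp (B B' : EuclideanSpace ℝ (Fin n) →L[ℝ] EuclideanSpace ℝ (Fin n) →L[ℝ] ℝ)
    (L : EuclideanSpace ℝ (Fin n) →ₗ[ℝ] EuclideanSpace ℝ (Fin n))
    (h : ∀ v w, B' v w = B (L v) (L w)) :
    volDensity B' = |LinearMap.det L| * volDensity B := by
  rw [volDensity, volDensity, basisFun_eq_single, det_gramOf_comp B B' L h,
    Real.sqrt_mul (sq_nonneg _), Real.sqrt_sq_eq_abs]

lemma continuous_volDensity :
    Continuous (volDensity (n := n)) := by
  refine Real.continuous_sqrt.comp (Continuous.matrix_det ?_)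
  refine continuous_pi fun a => continuous_pi fun b => ?_
  exact (continuous_id.clm_apply continuous_const).clm_apply continuous_const

variable {X : Type*} [TopologicalSpace X] [ChartedSpace (EuclideanSpace ℝ (Fin n)) X]
  [RiemannianBundle (fun y : X => TangentSpace (𝓡 n) y)]
  [IsManifold (𝓡 n) ∞ X]
  [IsContMDiffRiemannianBundle (𝓡 n) ∞ (EuclideanSpace ℝ (Fin n))
    (fun y : X => TangentSpace (𝓡 n) y)]
  [MeasurableSpace X] [BorelSpace X]

/-- The Riemannian volume of the image of a parametrization. -/
def localVolume (ψ : OpenPartialHomeomorph (EuclideanSpace ℝ (Fin n)) X) : Measure X :=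
  ((volume.restrict ψ.source).withDensity
    fun z => ENNReal.ofReal (volDensity (paramMetric ψ z))).map ψ

lemma riemannianVolume_eq_iSup :
    riemannianVolume n X = ⨆ c : X, localVolume (chartParam n c) := by
  unfold riemannianVolume localVolume
  simp only [chartParam_source]
  rfl

/-- The map ψ is continuous only on its source; its values elsewhere are arbitrary, so the
intersection with the source is essential. -/
lemma measurableSet_source_inter_preimage {Y : Type*} [TopologicalSpace Y] [MeasurableSpace Y]
    [BorelSpace Y] (ψ : OpenPartialHomeomorph Y X) {A : Set X} (hA : MeasurableSet A) :
    MeasurableSet (ψ.source ∩ ψ ⁻¹' A) := by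
  have h1 : Measurable (ψ.source.domRestrict ψ) := (continuousOn_iff_continuous_domRestrict.1
    ψ.continuousOn).measurable
  have h2 := MeasurableSet.subtype_image ψ.open_source.measurableSet (h1 hA)
  convert h2 using 1
  ext z
  simp [and_comm]

lemma lintegral_localVolume (ψ : OpenPartialHomeomorph (EuclideanSpace ℝ (Fin n)) X)
    (hψ : IsParam ψ) {F : X → ENNReal} (hF : Measurable F) :
    ∫⁻ y, F y ∂(localVolume ψ)
      = ∫⁻ z in ψ.source, ENNReal.ofReal (volDensity (paramMetric ψ z)) * F (ψ z) := by
  have hψm : AEMeasurable ψ (volume.restrict ψ.source) :=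
    ψ.continuousOn.aemeasurable ψ.open_source.measurableSet
  have hd : AEMeasurable (fun z => ENNReal.ofReal (volDensity (paramMetric ψ z)))
      (volume.restrict ψ.source) := by
    refine ContinuousOn.aemeasurable ?_ ψ.open_source.measurableSet
    exact ENNReal.continuous_ofReal.comp_continuousOn
      (continuous_volDensity.comp_continuousOn hψ.isMetricOn.smooth.continuousOn)
  rw [localVolume, lintegral_map' hF.aemeasurable
    (hψm.mono_ac (withDensity_absolutelyContinuous _ _)),
    lintegral_withDensity_eq_lintegral_mul₀ hd (g := fun z => F (ψ z))
      (hF.comp_aemeasurable hψm)]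
  rfl

lemma localVolume_apply (ψ : OpenPartialHomeomorph (EuclideanSpace ℝ (Fin n)) X)
    (hψ : IsParam ψ) {A : Set X} (hA : MeasurableSet A) :
    localVolume ψ A
      = ∫⁻ z in ψ.source ∩ ψ ⁻¹' A, ENNReal.ofReal (volDensity (paramMetric ψ z)) := by
  rw [← lintegral_indicator_one hA, lintegral_localVolume ψ hψ (measurable_one.indicator hA),
    ← lintegral_indicator ψ.open_source.measurableSet,
    ← lintegral_indicator (measurableSet_source_inter_preimage ψ hA)]
  refine lintegral_congr fun z => ?_
  by_cases h1 : z ∈ ψ.source <;> by_cases h2 : ψ z ∈ A <;> simp [indicator, h1, h2]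

lemma localVolume_apply_eq_inter (ψ : OpenPartialHomeomorph (EuclideanSpace ℝ (Fin n)) X)
    (hψ : IsParam ψ) {A : Set X} (hA : MeasurableSet A) :
    localVolume ψ A = localVolume ψ (A ∩ ψ.target) := by
  rw [localVolume_apply ψ hψ hA, localVolume_apply ψ hψ (hA.inter ψ.open_target.measurableSet)]
  congr 2
  ext z
  simp only [mem_inter_iff, mem_preimage]
  exact ⟨fun h => ⟨h.1, h.2, ψ.map_source h.1⟩, fun h => ⟨h.1, h.2.1⟩⟩

lemma volDensity_transition {φ ψ : OpenPartialHomeomorph (EuclideanSpace ℝ (Fin n)) X}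
    (hφ : IsParam φ) (hψ : IsParam ψ) {z : EuclideanSpace ℝ (Fin n)}
    (hz : z ∈ ψ.source ∩ ψ ⁻¹' φ.target) :
    volDensity (paramMetric ψ z) = |(fderiv ℝ (transition φ ψ) z).det|
      * volDensity (paramMetric φ (transition φ ψ z)) :=
  volDensity_comp _ _ (fderiv ℝ (transition φ ψ) z).toLinearMap
    (paramMetric_transition hφ hψ hz)

/-- Change of variables: the Jacobian of the transition map is exactly the ratio of the two volume
densities. -/
lemma localVolume_congr {φ ψ : OpenPartialHomeomorph (EuclideanSpace ℝ (Fin n)) X}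
    (hφ : IsParam φ) (hψ : IsParam ψ) {A : Set X} (hA : MeasurableSet A) (hAφ : A ⊆ φ.target)
    (hAψ : A ⊆ ψ.target) : localVolume φ A = localVolume ψ A := by
  rw [localVolume_apply φ hφ hA, localVolume_apply ψ hψ hA]
  have hsub : ψ.source ∩ ψ ⁻¹' A ⊆ ψ.source ∩ ψ ⁻¹' φ.target := fun z hz => ⟨hz.1, hAφ hz.2⟩
  have himg : φ.source ∩ φ ⁻¹' A = transition φ ψ '' (ψ.source ∩ ψ ⁻¹' A) := by
    ext w
    constructor
    · intro hw
      refine ⟨ψ.symm (φ w), ⟨ψ.map_target (hAψ hw.2), ?_⟩, ?_⟩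
      · rw [mem_preimage, ψ.right_inv (hAψ hw.2)]; exact hw.2
      · rw [transition, ψ.right_inv (hAψ hw.2), φ.left_inv hw.1]
    · rintro ⟨z, hz, rfl⟩
      refine ⟨mapsTo_transition φ ψ (hsub hz), ?_⟩
      rw [mem_preimage, apply_transition φ ψ (hsub hz)]
      exact hz.2
  have hinj : InjOn (transition φ ψ) (ψ.source ∩ ψ ⁻¹' A) := by
    intro z hz w hw hzw
    apply ψ.injOn hz.1 hw.1
    rw [← apply_transition φ ψ (hsub hz), ← apply_transition φ ψ (hsub hw), hzw]
  rw [himg, lintegral_image_eq_lintegral_abs_det_fderiv_mul volume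
    (measurableSet_source_inter_preimage ψ hA)
    (fun z hz => (((contDiffOn_transition hφ hψ).contDiffAt
      ((isOpen_transition_source φ ψ).mem_nhds (hsub hz))).differentiableAt
        (by simp)).hasFDerivAt.hasFDerivWithinAt) hinj]
  refine setLIntegral_congr_fun (measurableSet_source_inter_preimage ψ hA) fun z hz => ?_
  rw [volDensity_transition hφ hψ (hsub hz), ENNReal.ofReal_mul (abs_nonneg _)]

variable [SecondCountableTopology X]

/-- A countable subatlas is made disjoint and the local volumes are pasted to a measure `lam`, which
agrees with every local volume on its domain because these agree on overlaps. Hence `lam` bounds all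
of them from above, and by countable additivity it lies below any upper bound, so it is the
supremum. -/
lemma riemannianVolume_apply {ψ : OpenPartialHomeomorph (EuclideanSpace ℝ (Fin n)) X}
    (hψ : IsParam ψ) {A : Set X} (hA : MeasurableSet A) (hAψ : A ⊆ ψ.target) :
    riemannianVolume n X A = localVolume ψ A := by
  rcases isEmpty_or_nonempty X with hX | hX
  · rw [eq_empty_of_isEmpty A]; simp
  obtain ⟨s, hs, hcov⟩ := TopologicalSpace.countable_cover_nhds (α := X)
    (f := fun c => (chartParam n c).target)
    fun c => (chartParam n c).open_target.mem_nhds (mem_chartParam_target c)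
  have hsne : s.Nonempty := by
    by_contra h
    rw [not_nonempty_iff_eq_empty.1 h] at hcov
    simp only [biUnion_empty] at hcov
    exact empty_ne_univ hcov
  obtain ⟨c, rfl⟩ := hs.exists_eq_range hsne
  have hcov' : ⋃ k, (chartParam n (c k)).target = univ := by simpa using hcov
  set D : ℕ → Set X := disjointed fun k => (chartParam n (c k)).target with hD
  have hDm : ∀ k, MeasurableSet (D k) := fun k =>
    MeasurableSet.disjointed (fun k => (chartParam n (c k)).open_target.measurableSet) k
  have hDs : ∀ k, D k ⊆ (chartParam n (c k)).target := fun k => disjointed_subset _ k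
  have hDu : ⋃ k, D k = univ := by rw [hD, iUnion_disjointed, hcov']
  have hDd : Pairwise (Function.onFun Disjoint D) := disjoint_disjointed _
  set lam : Measure X := Measure.sum fun k => (localVolume (chartParam n (c k))).restrict (D k)
    with hlam
  have hpar : ∀ c, IsParam (chartParam n c : OpenPartialHomeomorph _ X) := fun c =>
    isParam_chartParam c
  have hsplit : ∀ (μ : Measure X) {A : Set X}, MeasurableSet A → μ A = ∑' k, μ (A ∩ D k) := by
    intro μ A hA
    conv_lhs => rw [← inter_univ A, ← hDu, inter_iUnion]
    refine measure_iUnion (fun i j hij => ?_) fun k => hA.inter (hDm k)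
    exact (hDd hij).mono inter_subset_right inter_subset_right
  have hlamA : ∀ (φ : OpenPartialHomeomorph (EuclideanSpace ℝ (Fin n)) X), IsParam φ →
      ∀ A, MeasurableSet A → A ⊆ φ.target → lam A = localVolume φ A := by
    intro φ hφ A hA hAφ
    rw [hlam, Measure.sum_apply _ hA, hsplit (localVolume φ) hA]
    congr 1
    funext k
    rw [Measure.restrict_apply hA]
    exact localVolume_congr (hpar _) hφ (hA.inter (hDm k)) (inter_subset_right.trans (hDs k))
      (inter_subset_left.trans hAφ)
  have hle : riemannianVolume n X ≤ lam := by
    rw [riemannianVolume_eq_iSup]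
    refine iSup_le fun c => ?_
    rw [Measure.le_iff]
    intro A hA
    rw [localVolume_apply_eq_inter _ (hpar c) hA,
      ← hlamA _ (hpar c) _ (hA.inter (chartParam n c).open_target.measurableSet) inter_subset_right]
    exact measure_mono inter_subset_left
  have hge : lam ≤ riemannianVolume n X := by
    rw [Measure.le_iff]
    intro A hA
    rw [hlam, Measure.sum_apply _ hA, hsplit (riemannianVolume n X) hA]
    refine ENNReal.tsum_le_tsum fun k => ?_
    rw [Measure.restrict_apply hA, riemannianVolume_eq_iSup]
    exact Measure.le_iff'.1 (le_iSup (fun c => localVolume (chartParam n c)) (c k)) _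
  rw [le_antisymm hle hge, hlamA ψ hψ A hA hAψ]

/-- Integration over the image of a parametrization. -/
theorem setLIntegral_riemannianVolume {ψ : OpenPartialHomeomorph (EuclideanSpace ℝ (Fin n)) X}
    (hψ : IsParam ψ) {A : Set X} (hA : MeasurableSet A) (hAψ : A ⊆ ψ.target) {F : X → ENNReal}
    (hF : Measurable F) :
    ∫⁻ y in A, F y ∂(riemannianVolume n X)
      = ∫⁻ z in ψ.source ∩ ψ ⁻¹' A, ENNReal.ofReal (volDensity (paramMetric ψ z)) * F (ψ z) := by
  have h1 : (riemannianVolume n X).restrict A = (localVolume ψ).restrict A := by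
    refine Measure.ext fun S hS => ?_
    rw [Measure.restrict_apply hS, Measure.restrict_apply hS,
      riemannianVolume_apply hψ (hS.inter hA) (inter_subset_right.trans hAψ)]
  rw [h1, ← lintegral_indicator hA, lintegral_localVolume ψ hψ (hF.indicator hA),
    ← lintegral_indicator ψ.open_source.measurableSet,
    ← lintegral_indicator (measurableSet_source_inter_preimage ψ hA)]
  refine lintegral_congr fun z => ?_
  by_cases h1 : z ∈ ψ.source <;> by_cases h2 : ψ z ∈ A <;> simp [indicator, h1, h2]

/-- The density is continuous, hence bounded on a small coordinate ball. This makes the continuous,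
compactly supported Sobolev integrands integrable. -/
instance isLocallyFiniteMeasure_riemannianVolume :
    IsLocallyFiniteMeasure (riemannianVolume n X) := by
  refine ⟨fun y => ?_⟩
  set ψ := chartParam n y
  have hψ : IsParam ψ := isParam_chartParam y
  have hy : y ∈ ψ.target := mem_chartParam_target y
  have hz := ψ.map_target hy
  have hc : ContinuousAt (fun z => volDensity (paramMetric ψ z)) (ψ.symm y) :=
    continuous_volDensity.continuousAt.comp
      (hψ.isMetricOn.smooth.continuousOn.continuousAt (ψ.open_source.mem_nhds hz))
  obtain ⟨r, hr, hsub⟩ := Metric.mem_nhds_iff.1 (Filter.inter_mem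
    (ψ.open_source.mem_nhds hz) (hc.eventually_lt_const (lt_add_one _)))
  set S := Metric.ball (ψ.symm y) r
  have hSs : S ⊆ ψ.source := fun z hz => (hsub hz).1
  have himg : IsOpen (ψ '' S) := ψ.isOpen_image_of_subset_source Metric.isOpen_ball hSs
  refine ⟨ψ '' S, himg.mem_nhds ⟨ψ.symm y, Metric.mem_ball_self hr, ψ.right_inv hy⟩, ?_⟩
  have himt : ψ '' S ⊆ ψ.target := by
    rintro _ ⟨z, hz, rfl⟩; exact ψ.map_source (hSs hz)
  have hpre : ψ.source ∩ ψ ⁻¹' (ψ '' S) = S := by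
    ext z
    constructor
    · rintro ⟨h1, w, hw, hwz⟩
      rwa [← ψ.injOn (hSs hw) h1 hwz]
    · exact fun h => ⟨hSs h, z, h, rfl⟩
  rw [riemannianVolume_apply hψ himg.measurableSet himt, localVolume_apply ψ hψ himg.measurableSet,
    hpre]
  refine lt_of_le_of_lt (setLIntegral_mono' Metric.isOpen_ball.measurableSet
    (g := fun _ => ENNReal.ofReal (volDensity (paramMetric ψ (ψ.symm y)) + 1))
    fun z hz => ENNReal.ofReal_le_ofReal (le_of_lt (hsub hz).2)) ?_
  rw [setLIntegral_const]
  exact ENNReal.mul_lt_top ENNReal.ofReal_lt_top Metric.isBounded_ball.measure_lt_top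

end Volume

/-! ### Monotonicity of the volume density -/

section DetMono

set_option maxSynthPendingDepth 3

/-- The determinant is the product of the eigenvalues, each of which is the quadratic form at a unit
eigenvector and so lies in [0, c]. -/
lemma det_le_pow_of_quadratic_le {ι : Type*} [Fintype ι] [DecidableEq ι] {A : Matrix ι ι ℝ}
    (hA : A.IsHermitian) {c : ℝ} (h0 : ∀ v : ι → ℝ, 0 ≤ v ⬝ᵥ A.mulVec v)
    (hc : ∀ v : ι → ℝ, v ⬝ᵥ A.mulVec v ≤ c * v ⬝ᵥ v) : A.det ≤ c ^ Fintype.card ι := by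
  rw [hA.det_eq_prod_eigenvalues, ← Finset.card_univ, ← Finset.prod_const]
  refine Finset.prod_le_prod (fun i _ => ?_) fun i _ => ?_
  · simpa [hA.eigenvalues_eq] using h0 _
  · have h1 : (hA.eigenvectorBasis i : ι → ℝ) ⬝ᵥ (hA.eigenvectorBasis i : ι → ℝ) = 1 := by
      have h2 := hA.eigenvectorBasis.orthonormal.1 i
      rw [EuclideanSpace.norm_eq, Real.sqrt_eq_one] at h2
      simpa [dotProduct, sq] using h2
    simpa [hA.eigenvalues_eq, h1] using hc (hA.eigenvectorBasis i)

/-- Passing to a B-orthonormal basis multiplies both determinants by the same square; there the Gram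
matrix of B is the identity and the eigenvalue bound applies. -/
lemma det_gramOf_le {E : Type*} [NormedAddCommGroup E] [NormedSpace ℝ E] {ι : Type*}
    [FiniteDimensional ℝ E] [Fintype ι]
    [DecidableEq ι] {B B' : E →L[ℝ] E →L[ℝ] ℝ} (hB : IsInner B) (hB' : IsInner B') {c : ℝ}
    (h : ∀ v, B' v v ≤ c * B v v) (β : Module.Basis ι ℝ E) :
    (gramOf B' β).det ≤ c ^ Fintype.card ι * (gramOf B β).det := by
  obtain ⟨e₀, he₀⟩ := hB.exists_orthonormal
  have hcard : Fintype.card ι = Fintype.card (Fin (Module.finrank ℝ E)) := by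
    rw [Fintype.card_fin, Module.finrank_eq_card_basis β]
  have σ := Fintype.equivOfCardEq hcard
  have he : IsOrthonormalFor B (e₀ ∘ σ) := fun a b => by
    simp [he₀ _ _, σ.injective.eq_iff]
  have hc' : Fintype.card ι = Module.finrank ℝ E := by rw [hcard, Fintype.card_fin]
  have h2 := coe_basisOfLinearIndependentOfCardEqFinrank' (e₀ ∘ σ) he.linearIndependent hc'
  set b := basisOfLinearIndependentOfCardEqFinrank' (e₀ ∘ σ) he.linearIndependent hc'
  have hb : IsOrthonormalFor B b := by rwa [h2]
  have hchange : ∀ C : E →L[ℝ] E →L[ℝ] ℝ,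
      (gramOf C β).det = (b.toMatrix β).det ^ 2 * (gramOf C b).det := by
    intro C
    have hβ : ∀ a, β a = ∑ c, b.toMatrix β c a • b c := fun a =>
      (b.sum_toMatrix_smul_self β a).symm
    have : gramOf C β = (b.toMatrix β).transpose * gramOf C b * b.toMatrix β := by
      ext x y
      rw [gramOf, Matrix.of_apply, hβ x, hβ y]
      simp only [gramOf, Matrix.of_apply, Matrix.mul_apply, Matrix.transpose_apply,
        map_sum, map_smul, _root_.sum_apply, _root_.smul_apply, smul_eq_mul,
        Finset.sum_mul, Finset.mul_sum]
      refine Finset.sum_congr rfl fun c _ => Finset.sum_congr rfl fun d _ => by ring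
    rw [this, Matrix.det_mul, Matrix.det_mul, Matrix.det_transpose]
    ring
  have hone : gramOf B b = 1 := by
    ext x y
    simp [gramOf, hb x y, Matrix.one_apply]
  have hq : ∀ (C : E →L[ℝ] E →L[ℝ] ℝ) (v : ι → ℝ),
      v ⬝ᵥ (gramOf C b).mulVec v = C (∑ a, v a • b a) (∑ a, v a • b a) := by
    intro C v
    simp only [dotProduct, Matrix.mulVec, gramOf, Matrix.of_apply, map_sum, map_smul,
      _root_.sum_apply, _root_.smul_apply, smul_eq_mul, Finset.mul_sum]
    rw [Finset.sum_comm]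
    refine Finset.sum_congr rfl fun c _ => Finset.sum_congr rfl fun d _ => by ring
  have hdet : (gramOf B' b).det ≤ c ^ Fintype.card ι := by
    refine det_le_pow_of_quadratic_le ?_ (fun v => ?_) fun v => ?_
    · ext x y
      simp [gramOf, hB'.symm (b x)]
    · rw [hq]; exact hB'.nonneg _
    · have h3 := hq B v
      rw [hone, Matrix.one_mulVec] at h3
      rw [hq, h3]
      exact h _
  rw [hchange B', hchange B, hone, Matrix.det_one, mul_one, mul_comm]
  exact mul_le_mul_of_nonneg_right hdet (sq_nonneg _)

lemma volDensity_le {n : ℕ}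
    {B B' : EuclideanSpace ℝ (Fin n) →L[ℝ] EuclideanSpace ℝ (Fin n) →L[ℝ] ℝ}
    (hB : IsInner B) (hB' : IsInner B') {c : ℝ} (hc : 0 ≤ c)
    (h : ∀ v, B' v v ≤ c * B v v) : volDensity B' ≤ √(c ^ n) * volDensity B := by
  rw [volDensity, volDensity, basisFun_eq_single, ← Real.sqrt_mul (pow_nonneg hc n)]
  apply Real.sqrt_le_sqrt
  simpa using det_gramOf_le hB hB' h (EuclideanSpace.basisFun (Fin n) ℝ).toBasis

end DetMono

/-! ### Conical coordinates -/

section ConeCoordinates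

set_option maxSynthPendingDepth 3

/-- Splitting off the radial coordinate. -/
def splitRadial (m : ℕ) :
    EuclideanSpace ℝ (Fin (m + 1)) ≃L[ℝ] ℝ × EuclideanSpace ℝ (Fin m) :=
  ContinuousLinearEquiv.ofFinrankEq (by simp [add_comm])

/-- Rescaling the angular directions. -/
def scaleAngular (m : ℕ) (t : ℝ) :
    EuclideanSpace ℝ (Fin (m + 1)) →ₗ[ℝ] EuclideanSpace ℝ (Fin (m + 1)) :=
  (splitRadial m).symm.toLinearMap ∘ₗ
    (LinearMap.prodMap LinearMap.id (t • LinearMap.id)) ∘ₗ (splitRadial m).toLinearMap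

/-- The source of the factor r^m = r^{n-1} in the volume of the cone. -/
lemma det_scaleAngular (m : ℕ) (t : ℝ) : LinearMap.det (scaleAngular m t) = t ^ m := by
  have := LinearMap.det_conj
    (LinearMap.prodMap (LinearMap.id : ℝ →ₗ[ℝ] ℝ)
      (t • (LinearMap.id : EuclideanSpace ℝ (Fin m) →ₗ[ℝ] EuclideanSpace ℝ (Fin m))))
    (splitRadial m).symm.toLinearEquiv
  have h2 : scaleAngular m t = (splitRadial m).symm.toLinearEquiv.toLinearMap ∘ₗ
    (LinearMap.prodMap LinearMap.id (t • LinearMap.id)) ∘ₗ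
      (splitRadial m).symm.toLinearEquiv.symm.toLinearMap := rfl
  rw [h2, this, LinearMap.det_prodMap, LinearMap.det_smul]
  simp

lemma splitRadial_scaleAngular (m : ℕ) (t : ℝ) (v : EuclideanSpace ℝ (Fin (m + 1))) :
    splitRadial m (scaleAngular m t v)
      = ((splitRadial m v).1, t • (splitRadial m v).2) := by
  simp [scaleAngular]

variable {m : ℕ} {M : Type*} [MetricSpace M] {x : M}
  [ChartedSpace (EuclideanSpace ℝ (Fin (m + 1))) {y : M // y ≠ x}]
  [RiemannianBundle (fun y : {y : M // y ≠ x} => TangentSpace (𝓡 (m + 1)) y)]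
  {N : Type*} [TopologicalSpace N] [ChartedSpace (EuclideanSpace ℝ (Fin m)) N]
  [IsManifold (𝓡 m) ∞ N]

/-- The parametrization of the cone over a chart of the cross section. -/
def coneParam (U : ConicalNeighborhood (m := m) x N) (θ₀ : N) :
    OpenPartialHomeomorph (EuclideanSpace ℝ (Fin (m + 1))) {y : M // y ≠ x} :=
  (splitRadial m).toHomeomorph.toOpenPartialHomeomorph.trans
    (((OpenPartialHomeomorph.refl ℝ).prod
      (chartAt (EuclideanSpace ℝ (Fin m)) θ₀).symm).trans U.param)

lemma coneParam_apply (U : ConicalNeighborhood (m := m) x N) (θ₀ : N)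
    (z : EuclideanSpace ℝ (Fin (m + 1))) :
    coneParam U θ₀ z = U.param ((splitRadial m z).1,
      (chartAt (EuclideanSpace ℝ (Fin m)) θ₀).symm (splitRadial m z).2) := rfl

lemma mem_coneParam_source (U : ConicalNeighborhood (m := m) x N) (θ₀ : N)
    (z : EuclideanSpace ℝ (Fin (m + 1))) :
    z ∈ (coneParam U θ₀).source ↔ (splitRadial m z).1 ∈ Ioo 0 U.ε ∧
      (splitRadial m z).2 ∈ (chartAt (EuclideanSpace ℝ (Fin m)) θ₀).target := by
  simp only [coneParam, OpenPartialHomeomorph.trans_source, mem_inter_iff, mem_preimage,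
    U.source_eq]
  simp
  tauto

lemma mem_coneParam_target (U : ConicalNeighborhood (m := m) x N) (θ₀ : N)
    (y : {y : M // y ≠ x}) :
    y ∈ (coneParam U θ₀).target ↔ y ∈ U.param.target ∧
      (U.param.symm y).2 ∈ (chartAt (EuclideanSpace ℝ (Fin m)) θ₀).source := by
  simp [coneParam]

lemma contMDiffOn_coneParam_aux (θ₀ : N) :
    ContMDiffOn (𝓡 (m + 1)) (𝓘(ℝ, ℝ).prod (𝓡 m)) ∞
      (fun z : EuclideanSpace ℝ (Fin (m + 1)) => ((splitRadial m z).1,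
        (chartAt (EuclideanSpace ℝ (Fin m)) θ₀).symm (splitRadial m z).2))
      {z | (splitRadial m z).2 ∈ (chartAt (EuclideanSpace ℝ (Fin m)) θ₀).target} := by
  have h1 : ContMDiff (𝓡 (m + 1)) 𝓘(ℝ, ℝ) ∞
      (fun z : EuclideanSpace ℝ (Fin (m + 1)) => (splitRadial m z).1) :=
    (contDiff_fst.comp (splitRadial m).contDiff).contMDiff
  have h2 : ContMDiff (𝓡 (m + 1)) (𝓡 m) ∞
      (fun z : EuclideanSpace ℝ (Fin (m + 1)) => (splitRadial m z).2) :=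
    (contDiff_snd.comp (splitRadial m).contDiff).contMDiff
  exact h1.contMDiffOn.prodMk
    (ContMDiffOn.comp (contMDiffOn_chart_symm (x := θ₀)) h2.contMDiffOn fun z hz => hz)

lemma isParam_coneParam (U : ConicalNeighborhood (m := m) x N) (θ₀ : N) :
    IsParam (coneParam U θ₀) where
  smooth := by
    refine U.smooth_param.comp ((contMDiffOn_coneParam_aux θ₀).mono ?_) ?_
    · intro z hz
      exact ((mem_coneParam_source U θ₀ z).1 hz).2
    · intro z hz
      change ((splitRadial m z).1, (chartAt (EuclideanSpace ℝ (Fin m)) θ₀).symm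
        (splitRadial m z).2) ∈ U.param.source
      rw [U.source_eq]
      exact ⟨((mem_coneParam_source U θ₀ z).1 hz).1, mem_univ _⟩
  smooth_symm := by
    have h1 : ContMDiffOn (𝓡 (m + 1)) 𝓘(ℝ, ℝ) ∞ (fun y => (U.param.symm y).1)
        (coneParam U θ₀).target :=
      contMDiff_fst.comp_contMDiffOn
        (U.smooth_symm.mono fun y hy => ((mem_coneParam_target U θ₀ y).1 hy).1)
    have h2 : ContMDiffOn (𝓡 (m + 1)) (𝓡 m) ∞ (fun y => (U.param.symm y).2)
        (coneParam U θ₀).target :=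
      contMDiff_snd.comp_contMDiffOn
        (U.smooth_symm.mono fun y hy => ((mem_coneParam_target U θ₀ y).1 hy).1)
    have h3 : ContMDiffOn (𝓡 (m + 1)) (𝓡 m) ∞
        (fun y => chartAt (EuclideanSpace ℝ (Fin m)) θ₀ (U.param.symm y).2)
        (coneParam U θ₀).target :=
      ContMDiffOn.comp (contMDiffOn_chart (x := θ₀)) h2
        fun y hy => ((mem_coneParam_target U θ₀ y).1 hy).2
    exact ((splitRadial m).symm.contDiff.contMDiff).comp_contMDiffOn (h1.prodMk_space h3)

/-- The metric in conical coordinates. -/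
lemma paramMetric_coneParam (U : ConicalNeighborhood (m := m) x N) (θ₀ : N)
    {z : EuclideanSpace ℝ (Fin (m + 1))} (hz : z ∈ (coneParam U θ₀).source)
    (v w : EuclideanSpace ℝ (Fin (m + 1))) :
    paramMetric (coneParam U θ₀) z v w = (splitRadial m v).1 * (splitRadial m w).1
      + (splitRadial m z).1 ^ 2 * (U.h (splitRadial m z).1).inner
        ((chartAt (EuclideanSpace ℝ (Fin m)) θ₀).symm (splitRadial m z).2)
        (mfderiv (𝓡 m) (𝓡 m) (chartAt (EuclideanSpace ℝ (Fin m)) θ₀).symm (splitRadial m z).2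
          (splitRadial m v).2)
        (mfderiv (𝓡 m) (𝓡 m) (chartAt (EuclideanSpace ℝ (Fin m)) θ₀).symm (splitRadial m z).2
          (splitRadial m w).2) := by
  obtain ⟨hz1, hz2⟩ := (mem_coneParam_source U θ₀ z).1 hz
  set σ := (chartAt (EuclideanSpace ℝ (Fin m)) θ₀).symm with hσ
  have d1 : HasMFDerivAt (𝓡 (m + 1)) 𝓘(ℝ, ℝ)
      (fun z : EuclideanSpace ℝ (Fin (m + 1)) => (splitRadial m z).1) z
      (ContinuousLinearMap.fst ℝ ℝ (EuclideanSpace ℝ (Fin m)) ∘L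
        (splitRadial m : EuclideanSpace ℝ (Fin (m + 1)) →L[ℝ] ℝ × EuclideanSpace ℝ (Fin m))) :=
    (ContinuousLinearMap.fst ℝ ℝ (EuclideanSpace ℝ (Fin m)) ∘L (splitRadial m :
      EuclideanSpace ℝ (Fin (m + 1)) →L[ℝ] ℝ × EuclideanSpace ℝ (Fin m))).hasFDerivAt.hasMFDerivAt
  have d2 : HasMFDerivAt (𝓡 (m + 1)) (𝓡 m)
      (fun z : EuclideanSpace ℝ (Fin (m + 1)) => (splitRadial m z).2) z
      (ContinuousLinearMap.snd ℝ ℝ (EuclideanSpace ℝ (Fin m)) ∘L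
        (splitRadial m : EuclideanSpace ℝ (Fin (m + 1)) →L[ℝ] ℝ × EuclideanSpace ℝ (Fin m))) :=
    (ContinuousLinearMap.snd ℝ ℝ (EuclideanSpace ℝ (Fin m)) ∘L (splitRadial m :
      EuclideanSpace ℝ (Fin (m + 1)) →L[ℝ] ℝ × EuclideanSpace ℝ (Fin m))).hasFDerivAt.hasMFDerivAt
  have d3 : HasMFDerivAt (𝓡 m) (𝓡 m) σ (splitRadial m z).2
      (mfderiv (𝓡 m) (𝓡 m) σ (splitRadial m z).2) :=
    ((mdifferentiable_chart (I := 𝓡 m) θ₀).mdifferentiableAt_symm hz2).hasMFDerivAt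
  have hmem : ((splitRadial m z).1, σ (splitRadial m z).2) ∈ U.param.source := by
    rw [U.source_eq]; exact ⟨hz1, mem_univ _⟩
  have d4 : HasMFDerivAt (𝓘(ℝ, ℝ).prod (𝓡 m)) (𝓡 (m + 1)) U.param
      ((splitRadial m z).1, σ (splitRadial m z).2)
      (mfderiv (𝓘(ℝ, ℝ).prod (𝓡 m)) (𝓡 (m + 1)) U.param
        ((splitRadial m z).1, σ (splitRadial m z).2)) :=
    ((U.smooth_param.contMDiffAt (U.param.open_source.mem_nhds hmem)).mdifferentiableAt
      (by simp)).hasMFDerivAt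
  have d5 := HasMFDerivAt.comp z d4 (d1.prodMk (HasMFDerivAt.comp z d3 d2))
  have d6 : HasMFDerivAt (𝓡 (m + 1)) (𝓡 (m + 1)) (coneParam U θ₀) z _ := d5
  rw [← U.isometry _ hz1, paramMetric_apply, d6.mfderiv]
  rfl

variable [IsManifold (𝓡 (m + 1)) ∞ {y : M // y ≠ x}]
    [IsContMDiffRiemannianBundle (𝓡 (m + 1)) ∞ (EuclideanSpace ℝ (Fin (m + 1)))
      (fun y : {y : M // y ≠ x} => TangentSpace (𝓡 (m + 1)) y)]

/-- Kato's inequality along the generators of the cone. -/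
theorem hasDerivAt_covDerivNorm_radial (U : ConicalNeighborhood (m := m) x N)
    {u : {y : M // y ≠ x} → ℝ} (hu : ContMDiff (𝓡 (m + 1)) 𝓘(ℝ, ℝ) ∞ u) (i : ℕ) {p : ℝ}
    (hp : 1 < p) (θ : N) {r : ℝ} (hr : r ∈ Ioo 0 U.ε) :
    ∃ D, HasDerivAt (fun s => covDerivNorm (n := m + 1) u i (U.param (s, θ)) ^ p) D r ∧
      |D| ≤ p * covDerivNorm (n := m + 1) u i (U.param (r, θ)) ^ (p - 1)
        * covDerivNorm (n := m + 1) u (i + 1) (U.param (r, θ)) := by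
  set φ := chartAt (EuclideanSpace ℝ (Fin m)) θ with hφ
  set ψ := coneParam U θ with hψdef
  have hψ : IsParam ψ := isParam_coneParam U θ
  -- The coordinate vector of ∂_r. In conical coordinates the generator is the straight line in
  -- direction ξ, and the form dr² + r²h_r of the metric makes ξ a unit vector, as Kato's inequality
  -- requires.
  set ξ : EuclideanSpace ℝ (Fin (m + 1)) := (splitRadial m).symm (1, 0) with hξ
  set ζ : ℝ → EuclideanSpace ℝ (Fin (m + 1)) := fun s => (splitRadial m).symm (s, φ θ) with hζ
  have hζs : ∀ s ∈ Ioo 0 U.ε, ζ s ∈ ψ.source := fun s hs => by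
    rw [hψdef, mem_coneParam_source]
    simpa [hζ] using ⟨hs, mem_chart_target _ θ⟩
  have hψζ : ∀ s, ψ (ζ s) = U.param (s, θ) := fun s => by
    rw [hψdef, coneParam_apply]
    simp [hζ, hφ]
  have hval : ∀ j, ∀ s ∈ Ioo 0 U.ε, covDerivNorm (n := m + 1) u j (U.param (s, θ))
      = √(paramNormSq ψ u j (ζ s)) := fun j s hs => by
    rw [← hψζ s, covDerivNorm_eq hψ hu j (hζs s hs)]
  have hlin : ∀ s t, ζ (s + t) = ζ s + t • ξ := fun s t => by
    simp only [hζ, hξ, ← map_smul, ← map_add]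
    simp
  have hunit : paramMetric ψ (ζ r) ξ ξ ≤ 1 := by
    rw [paramMetric_coneParam U θ (hζs r hr)]
    have h1 : splitRadial m ξ = (1, 0) := by simp [hξ]
    have h0 : mfderiv (𝓡 m) (𝓡 m) (chartAt (EuclideanSpace ℝ (Fin m)) θ).symm
        (splitRadial m (ζ r)).2 (0 : EuclideanSpace ℝ (Fin m)) = 0 := map_zero _
    rw [h1]
    dsimp only
    rw [h0, map_zero]
    simp
  obtain ⟨⟨D, hD, hDb⟩, hO⟩ := hψ.isMetricOn.hasDerivAt_normSq (hψ.contDiffOn_comp hu) i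
    (hζs r hr) hunit
  have hshift : (fun s => paramNormSq ψ u i (ζ s))
      = (fun t : ℝ => normSq (paramMetric ψ (ζ r + t • ξ))
          (covT (paramMetric ψ) (u ∘ ψ) i (ζ r + t • ξ))) ∘ fun s => s - r := by
    funext s
    simp only [Function.comp, paramNormSq, ← hlin]
    simp
  have hF : HasDerivAt (fun s => paramNormSq ψ u i (ζ s)) D r := by
    rw [hshift]
    have := HasDerivAt.comp r (h₂ := fun t : ℝ => normSq (paramMetric ψ (ζ r + t • ξ))
          (covT (paramMetric ψ) (u ∘ ψ) i (ζ r + t • ξ))) (h := fun s => s - r) (h' := 1)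
      (by simpa using hD) ((hasDerivAt_id r).sub_const r)
    simpa using this
  have hnhds : Ioo 0 U.ε ∈ 𝓝 r := Ioo_mem_nhds hr.1 hr.2
  obtain ⟨D', hD', hDb'⟩ := hasDerivAt_sqrt_rpow
    (F := fun s => paramNormSq ψ u i (ζ s)) (g := √(paramNormSq ψ u (i + 1) (ζ r))) hp
    (Filter.mem_of_superset hnhds fun s hs =>
      (hψ.isMetricOn.isInner (hζs s hs)).normSq_nonneg _) hF hDb (fun h0 => by
      have h1 := hO h0
      rw [hshift]
      have h2 : Tendsto (fun s => s - r) (𝓝 r) (𝓝 0) := by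
        simpa using (continuous_sub_right r).tendsto r
      exact h1.comp_tendsto h2)
  refine ⟨D', hD'.congr_of_eventuallyEq ?_, ?_⟩
  · filter_upwards [hnhds] with s hs
    rw [hval i s hs]
  · rw [hval i r hr, hval (i + 1) r hr]
    exact hDb'

end ConeCoordinates

/-! ### Integration in conical coordinates -/

section ConeIntegral

set_option maxSynthPendingDepth 3
set_option linter.unusedSectionVars false

/-- `splitRadial` is chosen by dimension alone and need not preserve volume. By uniqueness of Haar
measure it does so up to a constant, which is the same on both sides of the Hardy inequality. -/
lemma exists_setLIntegral_splitRadial (m : ℕ) : ∃ c : ENNReal, c ≠ 0 ∧ c ≠ ⊤ ∧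
    ∀ (G : ℝ × EuclideanSpace ℝ (Fin m) → ENNReal) (S : Set (ℝ × EuclideanSpace ℝ (Fin m))),
      ∫⁻ z in splitRadial m ⁻¹' S, G (splitRadial m z) = c * ∫⁻ w in S, G w := by
  set e := (splitRadial m).toHomeomorph.toMeasurableEquiv
  have he : ⇑e = splitRadial m := rfl
  have : (Measure.map e volume).IsAddHaarMeasure := by
    rw [he]
    exact (splitRadial m).isAddHaarMeasure_map volume
  have hv : (volume : Measure (ℝ × EuclideanSpace ℝ (Fin m))).IsAddHaarMeasure := by
    rw [Measure.volume_eq_prod]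
    infer_instance
  have hc := Measure.isAddLeftInvariant_eq_smul (Measure.map e volume)
    (volume : Measure (ℝ × EuclideanSpace ℝ (Fin m)))
  refine ⟨_, ENNReal.coe_ne_zero.2 (Measure.addHaarScalarFactor_pos_of_isAddHaarMeasure
    (Measure.map e volume) (volume : Measure (ℝ × EuclideanSpace ℝ (Fin m)))).ne',
    ENNReal.coe_ne_top, fun G S => ?_⟩
  have h1 := (MeasurePreserving.mk e.measurable hc).setLIntegral_comp_preimage_emb
    e.measurableEmbedding G S
  refine h1.trans ?_
  rw [Measure.restrict_smul, lintegral_smul_measure]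
  rfl

variable {m : ℕ} {M : Type*} [MetricSpace M] {x : M}
  [ChartedSpace (EuclideanSpace ℝ (Fin (m + 1))) {y : M // y ≠ x}]
  [RiemannianBundle (fun y : {y : M // y ≠ x} => TangentSpace (𝓡 (m + 1)) y)]
  {N : Type*} [TopologicalSpace N] [ChartedSpace (EuclideanSpace ℝ (Fin m)) N]
  [IsManifold (𝓡 m) ∞ N]

/-- The volume density in conical coordinates. -/
def coneDensity (U : ConicalNeighborhood (m := m) x N) (θ₀ : N) (r : ℝ)
    (w : EuclideanSpace ℝ (Fin m)) : ℝ :=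
  volDensity (paramMetric (coneParam U θ₀) ((splitRadial m).symm (r, w)))

/-- The part of the cone over a chart of the cross section between two radii. -/
def coneSet (U : ConicalNeighborhood (m := m) x N) (θ₀ : N) (a b : ℝ) : Set {y : M // y ≠ x} :=
  (fun q : ℝ × N => U.param q) '' (Ioo a b ×ˢ (chartAt (EuclideanSpace ℝ (Fin m)) θ₀).source)

lemma isOpen_coneSet (U : ConicalNeighborhood (m := m) x N) (θ₀ : N) {a b : ℝ} (ha : 0 ≤ a)
    (hb : b ≤ U.ε) : IsOpen (coneSet U θ₀ a b) := by
  refine U.param.isOpen_image_of_subset_source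
    (isOpen_Ioo.prod (chartAt (EuclideanSpace ℝ (Fin m)) θ₀).open_source) ?_
  rw [U.source_eq]
  exact prod_mono (Ioo_subset_Ioo ha hb) (subset_univ _)

lemma coneSet_subset_target (U : ConicalNeighborhood (m := m) x N) (θ₀ : N) {a b : ℝ}
    (ha : 0 ≤ a) (hb : b ≤ U.ε) : coneSet U θ₀ a b ⊆ (coneParam U θ₀).target := by
  rintro _ ⟨⟨r, θ⟩, ⟨hr, hθ⟩, rfl⟩
  have hs : (r, θ) ∈ U.param.source := by
    rw [U.source_eq]; exact ⟨Ioo_subset_Ioo ha hb hr, mem_univ _⟩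
  rw [mem_coneParam_target]
  refine ⟨U.param.map_source hs, ?_⟩
  dsimp only
  rw [U.param.left_inv hs]
  exact hθ

lemma source_inter_preimage_coneSet (U : ConicalNeighborhood (m := m) x N) (θ₀ : N) {a b : ℝ}
    (ha : 0 ≤ a) (hb : b ≤ U.ε) :
    (coneParam U θ₀).source ∩ coneParam U θ₀ ⁻¹' coneSet U θ₀ a b
      = splitRadial m ⁻¹' (Ioo a b ×ˢ (chartAt (EuclideanSpace ℝ (Fin m)) θ₀).target) := by
  ext z
  simp only [mem_inter_iff, mem_coneParam_source, mem_preimage, coneParam_apply, mem_prod]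
  constructor
  · rintro ⟨⟨h1, h2⟩, ⟨r, θ⟩, ⟨hr, hθ⟩, h⟩
    have hs : (r, θ) ∈ U.param.source := by
      rw [U.source_eq]; exact ⟨Ioo_subset_Ioo ha hb hr, mem_univ _⟩
    have hs' : ((splitRadial m z).1, (chartAt (EuclideanSpace ℝ (Fin m)) θ₀).symm
        (splitRadial m z).2) ∈ U.param.source := by
      rw [U.source_eq]; exact ⟨h1, mem_univ _⟩
    have := U.param.injOn hs hs' h
    exact ⟨by rw [← (Prod.mk.inj this).1]; exact hr, h2⟩
  · rintro ⟨h1, h2⟩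
    exact ⟨⟨Ioo_subset_Ioo ha hb h1, h2⟩, _,
      ⟨h1, (chartAt (EuclideanSpace ℝ (Fin m)) θ₀).map_target h2⟩, rfl⟩

variable [IsManifold (𝓡 (m + 1)) ∞ {y : M // y ≠ x}]
    [IsContMDiffRiemannianBundle (𝓡 (m + 1)) ∞ (EuclideanSpace ℝ (Fin (m + 1)))
      (fun y : {y : M // y ≠ x} => TangentSpace (𝓡 (m + 1)) y)]

lemma continuousOn_coneDensity (U : ConicalNeighborhood (m := m) x N) (θ₀ : N) :
    ContinuousOn (fun q : ℝ × EuclideanSpace ℝ (Fin m) => coneDensity U θ₀ q.1 q.2)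
      (Ioo 0 U.ε ×ˢ (chartAt (EuclideanSpace ℝ (Fin m)) θ₀).target) := by
  refine (continuous_volDensity.comp_continuousOn
    (isParam_coneParam U θ₀).isMetricOn.smooth.continuousOn).comp
    (splitRadial m).symm.continuous.continuousOn fun q hq => ?_
  rw [mem_coneParam_source]
  simpa using hq

lemma continuousOn_param_chart_symm (U : ConicalNeighborhood (m := m) x N) (θ₀ : N) :
    ContinuousOn (fun q : ℝ × EuclideanSpace ℝ (Fin m) =>
      U.param (q.1, (chartAt (EuclideanSpace ℝ (Fin m)) θ₀).symm q.2))
      (Ioo 0 U.ε ×ˢ (chartAt (EuclideanSpace ℝ (Fin m)) θ₀).target) := by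
  refine U.param.continuousOn.comp (continuousOn_fst.prodMk
    ((chartAt (EuclideanSpace ℝ (Fin m)) θ₀).continuousOn_symm.comp continuousOn_snd
      fun q hq => hq.2)) fun q hq => ?_
  rw [U.source_eq]
  exact ⟨hq.1, mem_univ _⟩

/-! ### Comparison with the density of the product cone -/

/-- Where the asymptotics are used: with c = 1 and r^α < 1/2, every h_r lies between h_0/2 and
3h_0/2, and 3 is the quotient of these bounds. Taking R < ε/4 also ensures χ = 1/r up to radius R.
-/
lemma eventually_inner_le (U : ConicalNeighborhood (m := m) x N) :
    ∃ R, 0 < R ∧ R < U.ε / 4 ∧ ∀ r ∈ Ioc 0 R, ∀ r₀ ∈ Ioc 0 R, ∀ (θ : N)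
      (v : TangentSpace (𝓡 m) θ), (U.h r).inner θ v v ≤ 3 * (U.h r₀).inner θ v v := by
  obtain ⟨α, hα, h⟩ := U.asymptotic
  have h1 : ∀ᶠ r in 𝓝[>] (0 : ℝ), r ^ α < 1 / 2 := by
    have h2 : Tendsto (fun r : ℝ => r ^ α) (𝓝[>] 0) (𝓝 0) := by
      have := (Real.continuousAt_rpow_const 0 α (Or.inr hα.le)).tendsto
      rw [Real.zero_rpow hα.ne'] at this
      exact this.mono_left nhdsWithin_le_nhds
    exact h2.eventually_lt_const (by norm_num)
  obtain ⟨R₁, hR₁, hR⟩ := mem_nhdsGT_iff_exists_Ioo_subset.1 ((h 1 one_pos).and h1)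
  have hR₁' : 0 < R₁ := hR₁
  have hε := U.ε_pos
  have key : ∀ r ∈ Ioo 0 R₁, ∀ (θ : N) (v : TangentSpace (𝓡 m) θ),
      1 / 2 * (U.h 0).inner θ v v ≤ (U.h r).inner θ v v ∧
        (U.h r).inner θ v v ≤ 3 / 2 * (U.h 0).inner θ v v := by
    intro r hr θ v
    obtain ⟨h3, h4⟩ := hR hr
    have h5 := abs_le.1 (h3 θ v)
    have h6 : 0 ≤ (U.h 0).inner θ v v := by
      rcases eq_or_ne v 0 with rfl | hv
      · simp
      · exact ((U.h 0).pos θ v hv).le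
    rw [one_mul] at h5
    have h7 : r ^ α * (U.h 0).inner θ v v ≤ 1 / 2 * (U.h 0).inner θ v v :=
      mul_le_mul_of_nonneg_right h4.le h6
    constructor <;> linarith
  refine ⟨min (R₁ / 2) (U.ε / 8), by positivity, ?_, fun r hr r₀ hr₀ θ v => ?_⟩
  · exact (min_le_right _ _).trans_lt (by linarith)
  · have hlt : min (R₁ / 2) (U.ε / 8) < R₁ := (min_le_left _ _).trans_lt (by linarith)
    have h3 := (key r ⟨hr.1, hr.2.trans_lt hlt⟩ θ v).2
    have h4 := (key r₀ ⟨hr₀.1, hr₀.2.trans_lt hlt⟩ θ v).1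
    linarith

lemma paramMetric_coneParam_symm (U : ConicalNeighborhood (m := m) x N) (θ₀ : N) {r : ℝ}
    {w : EuclideanSpace ℝ (Fin m)} (hz : (splitRadial m).symm (r, w) ∈ (coneParam U θ₀).source)
    (v v' : EuclideanSpace ℝ (Fin (m + 1))) :
    paramMetric (coneParam U θ₀) ((splitRadial m).symm (r, w)) v v'
      = (splitRadial m v).1 * (splitRadial m v').1
      + r ^ 2 * (U.h r).inner ((chartAt (EuclideanSpace ℝ (Fin m)) θ₀).symm w)
        (mfderiv (𝓡 m) (𝓡 m) (chartAt (EuclideanSpace ℝ (Fin m)) θ₀).symm w (splitRadial m v).2)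
        (mfderiv (𝓡 m) (𝓡 m) (chartAt (EuclideanSpace ℝ (Fin m)) θ₀).symm w
          (splitRadial m v').2) := by
  have h := paramMetric_coneParam U θ₀ hz v v'
  have hq : splitRadial m ((splitRadial m).symm (r, w)) = (r, w) := by simp
  -- The tangent spaces in `h` depend on this point, so `hq` cannot be rewritten; the point becomes
  -- a variable and is then substituted.
  generalize splitRadial m ((splitRadial m).symm (r, w)) = q at h hq
  subst hq
  exact h

/-- Scaling the angular directions by r/r₀ turns the metric at radius r₀ into dr² + r²h_{r₀}, which
dominates the metric at radius r up to the factor 3. The determinant of the scaling contributes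
(r/r₀)^m, and the factor 3 in dimension m + 1 contributes √(3^{m+1}). -/
lemma coneDensity_le (U : ConicalNeighborhood (m := m) x N) (θ₀ : N) {R r r₀ : ℝ}
    (hR : R < U.ε / 4) (hr : r ∈ Ioc 0 R) (hr₀ : r₀ ∈ Ioc 0 R)
    (h : ∀ (θ : N) (v : TangentSpace (𝓡 m) θ), (U.h r).inner θ v v ≤ 3 * (U.h r₀).inner θ v v)
    {w : EuclideanSpace ℝ (Fin m)} (hw : w ∈ (chartAt (EuclideanSpace ℝ (Fin m)) θ₀).target) :
    coneDensity U θ₀ r w ≤ √(3 ^ (m + 1)) * ((r / r₀) ^ m * coneDensity U θ₀ r₀ w) := by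
  have hε := U.ε_pos
  have hz : ∀ s ∈ Ioc 0 R, (splitRadial m).symm (s, w) ∈ (coneParam U θ₀).source := fun s hs => by
    rw [mem_coneParam_source]
    simpa using ⟨⟨hs.1, by linarith [hs.2]⟩, hw⟩
  set D := (scaleAngular m (r / r₀)).toContinuousLinearMap
  have ht : 0 < r / r₀ := div_pos hr.1 hr₀.1
  set B := paramMetric (coneParam U θ₀) ((splitRadial m).symm (r, w)) with hB
  set B₀ := paramMetric (coneParam U θ₀) ((splitRadial m).symm (r₀, w)) with hB₀
  have iB : IsInner B := (isParam_coneParam U θ₀).isMetricOn.isInner (hz r hr)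
  have iB₀ : IsInner B₀ := (isParam_coneParam U θ₀).isMetricOn.isInner (hz r₀ hr₀)
  set B' := B₀.bilinearComp D D
  have hB' : ∀ v w, B' v w = B₀ (scaleAngular m (r / r₀) v) (scaleAngular m (r / r₀) w) :=
    fun v w => rfl
  have iB' : IsInner B' := by
    refine ⟨fun v w => iB₀.symm _ _, fun v hv => iB₀.pos _ fun h0 => hv ?_⟩
    have h1 : IsUnit (LinearMap.det (scaleAngular m (r / r₀))) := by
      rw [det_scaleAngular]
      exact (pow_pos ht m).ne'.isUnit
    exact (LinearMap.equivOfDetNeZero _ h1.ne_zero).injective (h0.trans (map_zero _).symm)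
  have hle : ∀ v, B v v ≤ 3 * B' v v := by
    intro v
    rw [hB', hB, hB₀, paramMetric_coneParam_symm U θ₀ (hz r hr),
      paramMetric_coneParam_symm U θ₀ (hz r₀ hr₀), splitRadial_scaleAngular]
    set V := mfderiv (𝓡 m) (𝓡 m) (chartAt (EuclideanSpace ℝ (Fin m)) θ₀).symm w
      (splitRadial m v).2 with hV
    have hV' : mfderiv (𝓡 m) (𝓡 m) (chartAt (EuclideanSpace ℝ (Fin m)) θ₀).symm w
      ((r / r₀) • (splitRadial m v).2) = (r / r₀) • V := map_smul _ _ _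
    rw [hV', map_smul, map_smul]
    have h2 := mul_le_mul_of_nonneg_left (h _ V) (sq_nonneg r)
    dsimp only
    have h3 : r₀ ^ 2 * (r / r₀) • ((r / r₀) • (U.h r₀).inner
        ((chartAt (EuclideanSpace ℝ (Fin m)) θ₀).symm w) V) V
        = r ^ 2 * (U.h r₀).inner ((chartAt (EuclideanSpace ℝ (Fin m)) θ₀).symm w) V V := by
      simp only [_root_.smul_apply, smul_eq_mul]
      have := hr₀.1.ne'
      field_simp
    nlinarith [mul_self_nonneg (splitRadial m v).1]
  have h4 := volDensity_le iB' iB (by norm_num) hle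
  rw [volDensity_comp B₀ B' _ hB', det_scaleAngular, abs_of_pos (pow_pos ht m)] at h4
  exact h4

variable [MeasurableSpace M] [BorelSpace M] [SecondCountableTopology M]

/-- Tonelli with the radius as inner variable, so that the one-dimensional inequality can be applied
for each fixed angle. The constant is independent of the chart and of the radii. -/
lemma exists_setLIntegral_coneSet (U : ConicalNeighborhood (m := m) x N) :
    ∃ c : ENNReal, c ≠ 0 ∧ c ≠ ⊤ ∧ ∀ (θ₀ : N) (a b : ℝ), 0 ≤ a → b ≤ U.ε →
      ∀ F : {y : M // y ≠ x} → ENNReal, Continuous F →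
      ∫⁻ y in coneSet U θ₀ a b, F y ∂(riemannianVolume (m + 1) {y : M // y ≠ x})
        = c * ∫⁻ w in (chartAt (EuclideanSpace ℝ (Fin m)) θ₀).target, ∫⁻ r in Ioo a b,
            ENNReal.ofReal (coneDensity U θ₀ r w)
              * F (U.param (r, (chartAt (EuclideanSpace ℝ (Fin m)) θ₀).symm w)) := by
  obtain ⟨c, hc0, hc1, hc⟩ := exists_setLIntegral_splitRadial m
  refine ⟨c, hc0, hc1, fun θ₀ a b ha hb F hF => ?_⟩
  rw [setLIntegral_riemannianVolume (isParam_coneParam U θ₀)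
    (isOpen_coneSet U θ₀ ha hb).measurableSet (coneSet_subset_target U θ₀ ha hb) hF.measurable,
    source_inter_preimage_coneSet U θ₀ ha hb]
  have h1 := hc (fun q => ENNReal.ofReal (coneDensity U θ₀ q.1 q.2)
    * F (U.param (q.1, (chartAt (EuclideanSpace ℝ (Fin m)) θ₀).symm q.2)))
    (Ioo a b ×ˢ (chartAt (EuclideanSpace ℝ (Fin m)) θ₀).target)
  have h2 : ∀ z, ENNReal.ofReal (coneDensity U θ₀ (splitRadial m z).1 (splitRadial m z).2)
      * F (U.param ((splitRadial m z).1,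
        (chartAt (EuclideanSpace ℝ (Fin m)) θ₀).symm (splitRadial m z).2))
      = ENNReal.ofReal (volDensity (paramMetric (coneParam U θ₀) z))
        * F (coneParam U θ₀ z) := fun z => by
    simp [coneDensity, coneParam_apply]
  simp only [h2] at h1
  rw [h1, Measure.volume_eq_prod, ← Measure.prod_restrict, lintegral_prod_symm]
  rw [Measure.prod_restrict]
  have hsub := prod_mono (t₁ := (chartAt (EuclideanSpace ℝ (Fin m)) θ₀).target)
    (Ioo_subset_Ioo ha hb) Subset.rfl
  have hm : MeasurableSet (Ioo a b ×ˢ (chartAt (EuclideanSpace ℝ (Fin m)) θ₀).target) :=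
    (isOpen_Ioo.prod (chartAt (EuclideanSpace ℝ (Fin m)) θ₀).open_target).measurableSet
  refine AEMeasurable.mul ?_ ?_
  · exact (ENNReal.continuous_ofReal.comp_continuousOn
      ((continuousOn_coneDensity U θ₀).mono hsub)).aemeasurable hm
  · exact (hF.comp_continuousOn
      ((continuousOn_param_chart_symm U θ₀).mono hsub)).aemeasurable hm

end ConeIntegral

/-! ### Hardy's inequality on the cone -/

section ConeHardy

set_option maxSynthPendingDepth 3
set_option linter.unusedSectionVars false

variable {m : ℕ} {M : Type*} [MetricSpace M] {x : M}
  [ChartedSpace (EuclideanSpace ℝ (Fin (m + 1))) {y : M // y ≠ x}]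
  [RiemannianBundle (fun y : {y : M // y ≠ x} => TangentSpace (𝓡 (m + 1)) y)]
  {N : Type*} [TopologicalSpace N] [ChartedSpace (EuclideanSpace ℝ (Fin m)) N]
  [IsManifold (𝓡 m) ∞ N]

/-! ### Compact sets, the vertex, and elementary bounds on the weight. -/

lemma ConicalNeighborhood.exists_preimage_nhds (U : ConicalNeighborhood (m := m) x N)
    {V : Set M} (hV : V ∈ 𝓝 x) :
    ∃ r₀ > 0, ∀ r ∈ Ioo 0 r₀, ∀ θ, (U.param (r, θ)).1 ∈ V := by
  have h1 : Subtype.val ⁻¹' V ∈ comap (Subtype.val : {y : M // y ≠ x} → M) (𝓝 x) :=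
    preimage_mem_comap hV
  rw [U.vertex, mem_map, mem_prod_iff] at h1
  obtain ⟨S, hS, T, hT, h⟩ := h1
  obtain ⟨r₀, hr₀, hr⟩ := mem_nhdsGT_iff_exists_Ioo_subset.1 hS
  rw [mem_top] at hT
  subst hT
  exact ⟨r₀, hr₀, fun r hr' θ => h (mk_mem_prod (hr hr') (mem_univ θ))⟩

/-- A compact subset of M \ {x} is closed in M and misses x, so its complement contains all small
radii, uniformly in the angle. For the support of u this is the vanishing near r = 0 that Hardy's
inequality needs. -/
lemma ConicalNeighborhood.exists_disjoint_compact (U : ConicalNeighborhood (m := m) x N)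
    {K : Set {y : M // y ≠ x}} (hK : IsCompact K) :
    ∃ r₀ > 0, ∀ r ∈ Ioo 0 r₀, ∀ θ, U.param (r, θ) ∉ K := by
  have h1 : (Subtype.val '' K)ᶜ ∈ 𝓝 x := by
    refine (hK.image continuous_subtype_val).isClosed.isOpen_compl.mem_nhds ?_
    rintro ⟨y, -, hy⟩
    exact y.2 hy
  obtain ⟨r₀, hr₀, h⟩ := U.exists_preimage_nhds h1
  exact ⟨r₀, hr₀, fun r hr θ hmem => h r hr θ ⟨_, hmem, rfl⟩⟩

/-- By compactness of M the complement of an open neighbourhood of x is compact. So outside the thin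
cone only a compact set remains, on which powers of χ are bounded. -/
lemma ConicalNeighborhood.exists_compact_compl [CompactSpace M]
    (U : ConicalNeighborhood (m := m) x N) {R : ℝ} (hR : 0 < R) :
    ∃ K : Set {y : M // y ≠ x}, IsCompact K ∧
      ∀ y ∉ K, ∃ r ∈ Ioo 0 R, ∃ θ, y = U.param (r, θ) := by
  have h1 : (fun q : ℝ × N => U.param q) '' (Ioo 0 R ×ˢ univ)
      ∈ comap (Subtype.val : {y : M // y ≠ x} → M) (𝓝 x) := by
    rw [U.vertex]
    refine image_mem_map (prod_mem_prod (Ioo_mem_nhdsGT hR) ?_)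
    simp
  obtain ⟨V, hV, hsub⟩ := mem_comap.1 h1
  obtain ⟨W, hWV, hW, hxW⟩ := mem_nhds_iff.1 hV
  refine ⟨Subtype.val ⁻¹' Wᶜ, ?_, fun y hy => ?_⟩
  · refine Topology.IsInducing.subtypeVal.isCompact_preimage' hW.isClosed_compl.isCompact ?_
    intro y hy
    exact ⟨⟨y, fun h => hy (h ▸ hxW)⟩, rfl⟩
  · have : y ∈ Subtype.val ⁻¹' V := hWV (by simpa using hy)
    obtain ⟨⟨r, θ⟩, hr, h⟩ := hsub this
    exact ⟨r, hr.1, θ, h.symm⟩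

lemma ConicalNeighborhood.IsWeight.one_le {U : ConicalNeighborhood (m := m) x N}
    {χ : {y : M // y ≠ x} → ℝ} (hχ : U.IsWeight χ) (y : {y : M // y ≠ x}) : 1 ≤ χ y := by
  have h1 := hχ.inv_pos y
  have h2 := hχ.inv_le_one y
  exact (inv_le_one₀ (_root_.inv_pos.1 h1)).1 h2

lemma ConicalNeighborhood.IsWeight.pos {U : ConicalNeighborhood (m := m) x N}
    {χ : {y : M // y ≠ x} → ℝ} (hχ : U.IsWeight χ) (y : {y : M // y ≠ x}) : 0 < χ y :=
  one_pos.trans_le (hχ.one_le y)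

lemma ConicalNeighborhood.IsWeight.continuous_rpow {U : ConicalNeighborhood (m := m) x N}
    {χ : {y : M // y ≠ x} → ℝ} (hχ : U.IsWeight χ) (t : ℝ) : Continuous fun y => χ y ^ t :=
  hχ.smooth.continuous.rpow_const fun y => Or.inl (hχ.pos y).ne'

variable [IsManifold (𝓡 (m + 1)) ∞ {y : M // y ≠ x}]
    [IsContMDiffRiemannianBundle (𝓡 (m + 1)) ∞ (EuclideanSpace ℝ (Fin (m + 1)))
      (fun y : {y : M // y ≠ x} => TangentSpace (𝓡 (m + 1)) y)]

/-- The integrand of the weighted Sobolev norms. -/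
def weightedEnergy (χ : {y : M // y ≠ x} → ℝ) (u : {y : M // y ≠ x} → ℝ) (p s : ℝ) (i : ℕ)
    (y : {y : M // y ≠ x}) : ENNReal :=
  ENNReal.ofReal (χ y ^ (p * s) * covDerivNorm (n := m + 1) u i y ^ p)

lemma continuous_weightedEnergy {U : ConicalNeighborhood (m := m) x N}
    {χ : {y : M // y ≠ x} → ℝ} (hχ : U.IsWeight χ) {u : {y : M // y ≠ x} → ℝ}
    (hu : ContMDiff (𝓡 (m + 1)) 𝓘(ℝ, ℝ) ∞ u) {p : ℝ} (hp : 0 ≤ p) (s : ℝ) (i : ℕ) :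
    Continuous (weightedEnergy (m := m) χ u p s i) :=
  ENNReal.continuous_ofReal.comp ((hχ.continuous_rpow _).mul
    ((continuous_covDerivNorm hu i).rpow_const fun _ => Or.inr hp))

/-- On a ray the density is comparable to r^m and χ^{ps} is r^{-ps}, so the left side is a
one-dimensional integral with weight r^{a-1}, and the derivative term on the right has weight
r^{a-1+p}. -/
lemma hardy_radial {U : ConicalNeighborhood (m := m) x N} {χ : {y : M // y ≠ x} → ℝ}
    (hχ : U.IsWeight χ) {p s R : ℝ} (hp : 1 < p) (hs : 0 ≤ s) (hps : p * s ≠ ((m + 1 : ℕ) : ℝ))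
    (hR : 0 < R) (hRε : R < U.ε / 4)
    (hcomp : ∀ r ∈ Ioc 0 R, ∀ r₀ ∈ Ioc 0 R, ∀ (θ : N) (v : TangentSpace (𝓡 m) θ),
      (U.h r).inner θ v v ≤ 3 * (U.h r₀).inner θ v v) :
    ∃ C : ℝ, 0 ≤ C ∧ ∀ (u : {y : M // y ≠ x} → ℝ), ContMDiff (𝓡 (m + 1)) 𝓘(ℝ, ℝ) ∞ u →
      HasCompactSupport u → ∀ (i : ℕ) (θ₀ : N),
      ∀ w ∈ (chartAt (EuclideanSpace ℝ (Fin m)) θ₀).target,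
      ∫⁻ r in Ioo 0 (R / 2), ENNReal.ofReal (coneDensity U θ₀ r w) * weightedEnergy (m := m) χ u p s i
          (U.param (r, (chartAt (EuclideanSpace ℝ (Fin m)) θ₀).symm w))
        ≤ ENNReal.ofReal C * ∫⁻ r in Ioo 0 R, ENNReal.ofReal (coneDensity U θ₀ r w) *
          (weightedEnergy (m := m) χ u p (s - 1) (i + 1)
              (U.param (r, (chartAt (EuclideanSpace ℝ (Fin m)) θ₀).symm w))
            + ENNReal.ofReal ((2 / R) ^ (p * s)) * weightedEnergy (m := m) χ u p 0 i
              (U.param (r, (chartAt (EuclideanSpace ℝ (Fin m)) θ₀).symm w))) := by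
  have hp0 : 0 < p := by linarith
  -- The one-dimensional exponent is n - ps, so a ≠ 0 is the hypothesis `hps`.
  set a : ℝ := (m : ℝ) + 1 - p * s with ha
  have ha0 : a ≠ 0 := by
    intro h
    apply hps
    push_cast
    linarith
  obtain ⟨C, hC0, hC⟩ := hardy_lintegral ha0 hp hR
  set K := √(3 ^ (m + 1)) with hK
  have hK0 : 0 ≤ K := Real.sqrt_nonneg _
  refine ⟨K * C * K, by positivity, fun u hu huc i θ₀ w hw => ?_⟩
  set θ := (chartAt (EuclideanSpace ℝ (Fin m)) θ₀).symm w with hθ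
  set f : ℝ → ℝ := fun r => covDerivNorm (n := m + 1) u i (U.param (r, θ)) with hf
  set g : ℝ → ℝ := fun r => covDerivNorm (n := m + 1) u (i + 1) (U.param (r, θ)) with hg
  have hf0 : ∀ r, 0 ≤ f r := fun r => covDerivNorm_nonneg _ _ _
  have hg0 : ∀ r, 0 ≤ g r := fun r => covDerivNorm_nonneg _ _ _
  have hε := U.ε_pos
  have hcont : ContinuousOn (fun r => U.param (r, θ)) (Ioc 0 R) := by
    refine U.param.continuousOn.comp (by fun_prop) fun r hr => ?_
    rw [U.source_eq]
    exact ⟨⟨hr.1, by linarith [hr.2]⟩, mem_univ _⟩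
  obtain ⟨r₁, hr₁, hvan⟩ := U.exists_disjoint_compact huc.isCompact
  have hardy := hC f g ((continuous_covDerivNorm hu i).comp_continuousOn hcont)
    ((continuous_covDerivNorm hu (i + 1)).comp_continuousOn hcont)
    (fun r _ => hf0 r) (fun r _ => hg0 r)
    (Filter.mem_of_superset (Ioo_mem_nhdsGT hr₁) fun r hr =>
      covDerivNorm_eq_zero hu i (hvan r hr θ))
    (fun r hr => hasDerivAt_covDerivNorm_radial U hu i hp θ ⟨hr.1, by linarith [hr.2]⟩)
  set ρ : ℝ → ℝ := fun r => coneDensity U θ₀ r w with hρ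
  have hρ0 : ∀ r, 0 ≤ ρ r := fun r => volDensity_nonneg _
  -- The angular factor of the density, frozen at radius R. It depends on the ray but occurs on both
  -- sides, so only the comparison constant K survives, once from each direction.
  set d := ρ R / R ^ m with hd
  have hd0 : 0 ≤ d := div_nonneg (hρ0 R) (pow_pos hR m).le
  have hup : ∀ r ∈ Ioc 0 R, ρ r ≤ K * (r ^ m * d) := fun r hr => by
    have h1 := coneDensity_le U θ₀ hRε hr ⟨hR, le_rfl⟩ (hcomp r hr R ⟨hR, le_rfl⟩) hw
    refine h1.trans_eq ?_
    rw [hd, div_pow]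
    ring
  have hlow : ∀ r ∈ Ioc 0 R, r ^ m * d ≤ K * ρ r := fun r hr => by
    have h1 := coneDensity_le U θ₀ hRε ⟨hR, le_rfl⟩ hr (hcomp R ⟨hR, le_rfl⟩ r hr) hw
    have hrm := pow_pos hr.1 m
    calc r ^ m * d ≤ r ^ m * (K * ((R / r) ^ m * ρ r) / R ^ m) :=
          mul_le_mul_of_nonneg_left (div_le_div_of_nonneg_right h1 (pow_pos hR m).le) hrm.le
      _ = K * ρ r := by
          have := (pow_pos hR m).ne'
          have := hrm.ne'
          rw [div_pow]
          field_simp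
  have hχr : ∀ r ∈ Ioc 0 R, ∀ t : ℝ, χ (U.param (r, θ)) ^ t = r ^ (-t) := fun r hr t => by
    rw [hχ.eq_inv r θ hr.1 (hr.2.trans_lt hRε), one_div, Real.inv_rpow hr.1.le,
      Real.rpow_neg hr.1.le]
  have hpow : ∀ r ∈ Ioc 0 R, r ^ (a - 1) = r ^ m * r ^ (-(p * s)) := fun r hr => by
    rw [← Real.rpow_natCast, ← Real.rpow_add hr.1]
    congr 1
    rw [ha]; ring
  have hpow' : ∀ r ∈ Ioc 0 R, r ^ (a - 1 + p) = r ^ m * r ^ (-(p * (s - 1))) := fun r hr => by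
    rw [← Real.rpow_natCast, ← Real.rpow_add hr.1]
    congr 1
    rw [ha]; ring
  have step1 : ∫⁻ r in Ioo 0 (R / 2), ENNReal.ofReal (ρ r)
      * weightedEnergy (m := m) χ u p s i (U.param (r, θ))
      ≤ ENNReal.ofReal (K * d) * ∫⁻ r in Ioo 0 (R / 2), ENNReal.ofReal (r ^ (a - 1) * f r ^ p) := by
    rw [← lintegral_const_mul' _ _ ENNReal.ofReal_ne_top]
    refine setLIntegral_mono' measurableSet_Ioo fun r hr => ?_
    have hr' : r ∈ Ioc 0 R := ⟨hr.1, by linarith [hr.2]⟩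
    rw [weightedEnergy, ← ENNReal.ofReal_mul (hρ0 r), ← ENNReal.ofReal_mul (by positivity),
      hχr r hr', hpow r hr']
    apply ENNReal.ofReal_le_ofReal
    have h2 : 0 ≤ r ^ (-(p * s)) * f r ^ p :=
      mul_nonneg (Real.rpow_nonneg hr.1.le _) (Real.rpow_nonneg (hf0 r) _)
    calc ρ r * (r ^ (-(p * s)) * f r ^ p) ≤ K * (r ^ m * d) * (r ^ (-(p * s)) * f r ^ p) :=
          mul_le_mul_of_nonneg_right (hup r hr') h2
      _ = K * d * (r ^ m * r ^ (-(p * s)) * f r ^ p) := by ring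
  have step2 : ENNReal.ofReal d * ∫⁻ r in Ioo 0 R, ENNReal.ofReal (r ^ (a - 1 + p) * g r ^ p)
      ≤ ENNReal.ofReal K * ∫⁻ r in Ioo 0 R, ENNReal.ofReal (ρ r)
        * weightedEnergy (m := m) χ u p (s - 1) (i + 1) (U.param (r, θ)) := by
    rw [← lintegral_const_mul' _ _ ENNReal.ofReal_ne_top,
      ← lintegral_const_mul' _ _ ENNReal.ofReal_ne_top]
    refine setLIntegral_mono' measurableSet_Ioo fun r hr => ?_
    have hr' : r ∈ Ioc 0 R := ⟨hr.1, hr.2.le⟩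
    rw [weightedEnergy, ← ENNReal.ofReal_mul (hρ0 r), ← ENNReal.ofReal_mul hd0,
      ← ENNReal.ofReal_mul hK0, hχr r hr', hpow' r hr']
    apply ENNReal.ofReal_le_ofReal
    have h2 : 0 ≤ r ^ (-(p * (s - 1))) * g r ^ p :=
      mul_nonneg (Real.rpow_nonneg hr.1.le _) (Real.rpow_nonneg (hg0 r) _)
    calc d * (r ^ m * r ^ (-(p * (s - 1))) * g r ^ p)
        = r ^ m * d * (r ^ (-(p * (s - 1))) * g r ^ p) := by ring
      _ ≤ K * ρ r * (r ^ (-(p * (s - 1))) * g r ^ p) :=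
          mul_le_mul_of_nonneg_right (hlow r hr') h2
      _ = K * (ρ r * (r ^ (-(p * (s - 1))) * g r ^ p)) := by ring
  have step3 : ENNReal.ofReal d * ∫⁻ r in Ioo (R / 2) R, ENNReal.ofReal (r ^ (a - 1) * f r ^ p)
      ≤ ENNReal.ofReal K * ∫⁻ r in Ioo 0 R, ENNReal.ofReal (ρ r)
        * (ENNReal.ofReal ((2 / R) ^ (p * s))
          * weightedEnergy (m := m) χ u p 0 i (U.param (r, θ))) := by
    rw [← lintegral_const_mul' _ _ ENNReal.ofReal_ne_top,
      ← lintegral_const_mul' _ _ ENNReal.ofReal_ne_top]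
    refine (setLIntegral_mono' measurableSet_Ioo fun r hr => ?_).trans
      (lintegral_mono_set (Ioo_subset_Ioo_left (by positivity)))
    have hr0 : 0 < r := lt_trans (by positivity) hr.1
    have hr' : r ∈ Ioc 0 R := ⟨hr0, hr.2.le⟩
    rw [weightedEnergy, ← ENNReal.ofReal_mul (p := (2 / R) ^ (p * s)) (by positivity),
      ← ENNReal.ofReal_mul (hρ0 r),
      ← ENNReal.ofReal_mul hd0,
      ← ENNReal.ofReal_mul hK0, hpow r hr', mul_zero, Real.rpow_zero, one_mul]
    apply ENNReal.ofReal_le_ofReal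
    -- On (R/2, R) the weight is bounded, since s ≥ 0; the cutoff error is therefore an unweighted
    -- integral.
    have hle : r ^ (-(p * s)) ≤ (2 / R) ^ (p * s) := by
      rw [Real.rpow_neg hr0.le, ← Real.inv_rpow hr0.le]
      refine Real.rpow_le_rpow (inv_nonneg.2 hr0.le) ?_ (by positivity)
      rw [inv_le_comm₀ hr0 (by positivity), inv_div]
      exact hr.1.le
    have hfp : 0 ≤ f r ^ p := Real.rpow_nonneg (hf0 r) _
    calc d * (r ^ m * r ^ (-(p * s)) * f r ^ p)
        = r ^ m * d * (r ^ (-(p * s)) * f r ^ p) := by ring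
      _ ≤ K * ρ r * ((2 / R) ^ (p * s) * f r ^ p) :=
          mul_le_mul (hlow r hr') (mul_le_mul_of_nonneg_right hle hfp)
            (mul_nonneg (Real.rpow_nonneg hr0.le _) hfp) (mul_nonneg hK0 (hρ0 r))
      _ = K * (ρ r * ((2 / R) ^ (p * s) * f r ^ p)) := by ring
  set I₁ := ∫⁻ r in Ioo 0 R, ENNReal.ofReal (r ^ (a - 1 + p) * g r ^ p)
  set I₂ := ∫⁻ r in Ioo (R / 2) R, ENNReal.ofReal (r ^ (a - 1) * f r ^ p)
  calc _ ≤ ENNReal.ofReal (K * d) * (ENNReal.ofReal C * (I₁ + I₂)) :=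
        step1.trans (mul_le_mul_right hardy _)
    _ = ENNReal.ofReal K * ENNReal.ofReal C * (ENNReal.ofReal d * I₁ + ENNReal.ofReal d * I₂) := by
        rw [ENNReal.ofReal_mul hK0]; ring
    _ ≤ ENNReal.ofReal K * ENNReal.ofReal C * (ENNReal.ofReal K * ∫⁻ r in Ioo 0 R,
          (ENNReal.ofReal (ρ r) * weightedEnergy (m := m) χ u p (s - 1) (i + 1) (U.param (r, θ))
          + ENNReal.ofReal (ρ r) * (ENNReal.ofReal ((2 / R) ^ (p * s))
          * weightedEnergy (m := m) χ u p 0 i (U.param (r, θ))))) := by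
        refine mul_le_mul_right ((add_le_add step2 step3).trans ?_) _
        rw [← mul_add]
        exact mul_le_mul_right (le_lintegral_add _ _) _
    _ = _ := by
        rw [ENNReal.ofReal_mul (by positivity), ENNReal.ofReal_mul hK0]
        simp only [← mul_add]
        ring

variable [MeasurableSpace M] [BorelSpace M] [SecondCountableTopology M]

lemma hardy_coneSet {U : ConicalNeighborhood (m := m) x N} {χ : {y : M // y ≠ x} → ℝ}
    (hχ : U.IsWeight χ) {p s R : ℝ} (hp : 1 < p) (hs : 0 ≤ s) (hps : p * s ≠ ((m + 1 : ℕ) : ℝ))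
    (hR : 0 < R) (hRε : R < U.ε / 4)
    (hcomp : ∀ r ∈ Ioc 0 R, ∀ r₀ ∈ Ioc 0 R, ∀ (θ : N) (v : TangentSpace (𝓡 m) θ),
      (U.h r).inner θ v v ≤ 3 * (U.h r₀).inner θ v v) :
    ∃ C : ℝ, 0 ≤ C ∧ ∀ (u : {y : M // y ≠ x} → ℝ), ContMDiff (𝓡 (m + 1)) 𝓘(ℝ, ℝ) ∞ u →
      HasCompactSupport u → ∀ (i : ℕ) (θ₀ : N),
      ∫⁻ y in coneSet U θ₀ 0 (R / 2), weightedEnergy (m := m) χ u p s i y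
          ∂(riemannianVolume (m + 1) {y : M // y ≠ x})
        ≤ ENNReal.ofReal C * ((∫⁻ y, weightedEnergy (m := m) χ u p (s - 1) (i + 1) y
            ∂(riemannianVolume (m + 1) {y : M // y ≠ x}))
          + ∫⁻ y, weightedEnergy (m := m) χ u p 0 i y
            ∂(riemannianVolume (m + 1) {y : M // y ≠ x})) := by
  obtain ⟨C, hC0, hC⟩ := hardy_radial hχ hp hs hps hR hRε hcomp
  obtain ⟨c, hc0, hc1, hc⟩ := exists_setLIntegral_coneSet U
  have hε := U.ε_pos
  have hp0 : 0 ≤ p := by linarith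
  set Λ := (2 / R) ^ (p * s) with hΛ
  have hΛ0 : 0 ≤ Λ := by positivity
  refine ⟨C * (1 + Λ), by positivity, fun u hu huc i θ₀ => ?_⟩
  have c1 := continuous_weightedEnergy hχ hu hp0 (s - 1) (i + 1)
  have c2 := continuous_weightedEnergy hχ hu hp0 0 i
  have cF : Continuous fun y => weightedEnergy (m := m) χ u p (s - 1) (i + 1) y
      + ENNReal.ofReal Λ * weightedEnergy (m := m) χ u p 0 i y :=
    c1.add (ENNReal.continuous_const_mul ENNReal.ofReal_ne_top |>.comp c2)
  rw [hc θ₀ 0 (R / 2) le_rfl (by linarith) _ (continuous_weightedEnergy hχ hu hp0 s i)]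
  have h1 := hc θ₀ 0 R le_rfl (by linarith) _ cF
  calc _ ≤ c * ∫⁻ w in (chartAt (EuclideanSpace ℝ (Fin m)) θ₀).target, ENNReal.ofReal C *
        ∫⁻ r in Ioo 0 R, ENNReal.ofReal (coneDensity U θ₀ r w) *
          (weightedEnergy (m := m) χ u p (s - 1) (i + 1)
              (U.param (r, (chartAt (EuclideanSpace ℝ (Fin m)) θ₀).symm w))
            + ENNReal.ofReal Λ * weightedEnergy (m := m) χ u p 0 i
              (U.param (r, (chartAt (EuclideanSpace ℝ (Fin m)) θ₀).symm w))) :=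
        mul_le_mul_right (setLIntegral_mono'
          (chartAt (EuclideanSpace ℝ (Fin m)) θ₀).open_target.measurableSet
          fun w hw => hC u hu huc i θ₀ w hw) _
    _ = ENNReal.ofReal C * ∫⁻ y in coneSet U θ₀ 0 R,
          (weightedEnergy (m := m) χ u p (s - 1) (i + 1) y
            + ENNReal.ofReal Λ * weightedEnergy (m := m) χ u p 0 i y)
            ∂(riemannianVolume (m + 1) {y : M // y ≠ x}) := by
        rw [h1, lintegral_const_mul' _ _ ENNReal.ofReal_ne_top]
        ring
    _ ≤ ENNReal.ofReal C * ∫⁻ y, (weightedEnergy (m := m) χ u p (s - 1) (i + 1) y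
            + ENNReal.ofReal Λ * weightedEnergy (m := m) χ u p 0 i y)
            ∂(riemannianVolume (m + 1) {y : M // y ≠ x}) :=
        mul_le_mul_right (setLIntegral_le_lintegral _ _) _
    _ ≤ _ := by
        rw [lintegral_add_left c1.measurable, lintegral_const_mul _ c2.measurable,
          ENNReal.ofReal_mul hC0, mul_assoc]
        refine mul_le_mul_right ?_ _
        rw [ENNReal.ofReal_add zero_le_one hΛ0, ENNReal.ofReal_one, add_mul, one_mul, mul_add]
        gcongr ?_ + ?_
        · exact le_self_add
        · exact le_add_self

/-- The weighted Hardy inequality on a manifold with a conical singularity. -/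
theorem exists_hardy [CompactSpace M] [CompactSpace N] {U : ConicalNeighborhood (m := m) x N}
    {χ : {y : M // y ≠ x} → ℝ}
    (hχ : U.IsWeight χ) {p s : ℝ} (hp : 1 < p) (hs : 0 ≤ s)
    (hps : p * s ≠ ((m + 1 : ℕ) : ℝ)) :
    ∃ C : ℝ, 0 ≤ C ∧ ∀ (u : {y : M // y ≠ x} → ℝ), ContMDiff (𝓡 (m + 1)) 𝓘(ℝ, ℝ) ∞ u →
      HasCompactSupport u → ∀ i : ℕ,
      ∫⁻ y, weightedEnergy (m := m) χ u p s i y ∂(riemannianVolume (m + 1) {y : M // y ≠ x})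
        ≤ ENNReal.ofReal C * ((∫⁻ y, weightedEnergy (m := m) χ u p (s - 1) (i + 1) y
            ∂(riemannianVolume (m + 1) {y : M // y ≠ x}))
          + ∫⁻ y, weightedEnergy (m := m) χ u p 0 i y
            ∂(riemannianVolume (m + 1) {y : M // y ≠ x})) := by
  obtain ⟨R, hR, hRε, hcomp⟩ := eventually_inner_le U
  obtain ⟨C, hC0, hC⟩ := hardy_coneSet hχ hp hs hps hR hRε hcomp
  -- The manifold is covered by K, where χ^{ps} is bounded by `b`, and by the cones of height R/2
  -- over finitely many charts of the compact cross section. Overlaps are harmless for an upper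
  -- bound, whence the constant |b| + (number of charts) · C.
  obtain ⟨K, hK, hKc⟩ := U.exists_compact_compl (half_pos hR)
  obtain ⟨t, ht⟩ := isCompact_univ.elim_finite_subcover
    (fun θ₀ : N => (chartAt (EuclideanSpace ℝ (Fin m)) θ₀).source)
    (fun θ₀ => (chartAt (EuclideanSpace ℝ (Fin m)) θ₀).open_source)
    (fun θ _ => mem_iUnion.2 ⟨θ, mem_chart_source _ θ⟩)
  obtain ⟨b, hb⟩ := hK.exists_bound_of_continuousOn
    (hχ.continuous_rpow (p * s)).continuousOn
  have hp0 : 0 ≤ p := by linarith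
  refine ⟨|b| + t.card * C, by positivity, fun u hu huc i => ?_⟩
  set J := (∫⁻ y, weightedEnergy (m := m) χ u p (s - 1) (i + 1) y
            ∂(riemannianVolume (m + 1) {y : M // y ≠ x}))
          + ∫⁻ y, weightedEnergy (m := m) χ u p 0 i y
            ∂(riemannianVolume (m + 1) {y : M // y ≠ x}) with hJ
  have hcov : (univ : Set {y : M // y ≠ x}) ⊆ K ∪ ⋃ j : t, coneSet U j.1 0 (R / 2) := by
    intro y _
    by_cases hy : y ∈ K
    · exact Or.inl hy
    · obtain ⟨r, hr, θ, rfl⟩ := hKc y hy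
      obtain ⟨θ₀, h1, h2⟩ := mem_iUnion₂.1 (ht (mem_univ θ))
      exact Or.inr (mem_iUnion.2 ⟨⟨θ₀, h1⟩, (r, θ), ⟨hr, h2⟩, rfl⟩)
  have hKle : ∫⁻ y in K, weightedEnergy (m := m) χ u p s i y
      ∂(riemannianVolume (m + 1) {y : M // y ≠ x}) ≤ ENNReal.ofReal |b| * J := by
    calc _ ≤ ∫⁻ y in K, ENNReal.ofReal |b| * weightedEnergy (m := m) χ u p 0 i y
          ∂(riemannianVolume (m + 1) {y : M // y ≠ x}) := by
          refine setLIntegral_mono' hK.measurableSet fun y hy => ?_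
          rw [weightedEnergy, weightedEnergy, ← ENNReal.ofReal_mul (abs_nonneg b), mul_zero,
            Real.rpow_zero, one_mul]
          refine ENNReal.ofReal_le_ofReal (mul_le_mul_of_nonneg_right ?_
            (Real.rpow_nonneg (covDerivNorm_nonneg _ _ _) _))
          exact (le_abs_self _).trans ((hb y hy).trans (le_abs_self b))
      _ ≤ ∫⁻ y, ENNReal.ofReal |b| * weightedEnergy (m := m) χ u p 0 i y
          ∂(riemannianVolume (m + 1) {y : M // y ≠ x}) := setLIntegral_le_lintegral _ _
      _ ≤ _ := by
          rw [lintegral_const_mul' _ _ ENNReal.ofReal_ne_top]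
          exact mul_le_mul_right le_add_self _
  calc _ ≤ ∫⁻ y in K ∪ ⋃ j : t, coneSet U j.1 0 (R / 2), weightedEnergy (m := m) χ u p s i y
        ∂(riemannianVolume (m + 1) {y : M // y ≠ x}) := by
        rw [← setLIntegral_univ]
        exact lintegral_mono_set hcov
    _ ≤ _ := lintegral_union_le _ _ _
    _ ≤ ENNReal.ofReal |b| * J + ∑' j : t, ENNReal.ofReal C * J := by
        refine add_le_add hKle ((lintegral_iUnion_le _ _).trans ?_)
        exact ENNReal.tsum_le_tsum fun j => hC u hu huc i j.1
    _ = _ := by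
        rw [tsum_fintype, Finset.sum_const, ENNReal.ofReal_add (abs_nonneg b) (by positivity),
          ENNReal.ofReal_mul (by positivity), add_mul]
        simp [mul_assoc]

/-- The weighted norms of all derivatives are controlled by the unweighted ones. -/
theorem exists_weightedEnergy_le [CompactSpace M] [CompactSpace N]
    {U : ConicalNeighborhood (m := m) x N} {χ : {y : M // y ≠ x} → ℝ}
    (hχ : U.IsWeight χ) {p : ℝ} (hp : 1 < p) (k : ℕ)
    (hpk : ∀ i : ℕ, 1 ≤ i → i ≤ k → p * (i : ℝ) ≠ ((m + 1 : ℕ) : ℝ)) :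
    ∃ C : ℝ, 0 ≤ C ∧ ∀ (u : {y : M // y ≠ x} → ℝ), ContMDiff (𝓡 (m + 1)) 𝓘(ℝ, ℝ) ∞ u →
      HasCompactSupport u → ∀ i : ℕ,
      ∫⁻ y, weightedEnergy (m := m) χ u p k i y ∂(riemannianVolume (m + 1) {y : M // y ≠ x})
        ≤ ENNReal.ofReal C * ∑ j ∈ Finset.range (k + 1),
          ∫⁻ y, weightedEnergy (m := m) χ u p 0 (i + j) y
            ∂(riemannianVolume (m + 1) {y : M // y ≠ x}) := by
  induction k with
  | zero => exact ⟨1, zero_le_one, fun u hu huc i => by simp⟩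
  | succ k ih =>
    obtain ⟨C₁, hC₁, h₁⟩ := ih fun i h1 h2 => hpk i h1 (h2.trans k.le_succ)
    obtain ⟨C₂, hC₂, h₂⟩ := exists_hardy hχ hp (s := ((k + 1 : ℕ) : ℝ)) (by positivity)
      (hpk (k + 1) (by omega) le_rfl)
    refine ⟨C₂ * (C₁ + 1), by positivity, fun u hu huc i => (h₂ u hu huc i).trans ?_⟩
    -- The Hardy step has traded weight k + 1 on ∇ⁱu for weight k on ∇ⁱ⁺¹u, which is why the
    -- induction runs over all orders i at once.
    have h3 := h₁ u hu huc (i + 1)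
    have h4 : ((k + 1 : ℕ) : ℝ) - 1 = k := by push_cast; ring
    rw [h4, ENNReal.ofReal_mul hC₂, mul_assoc]
    refine mul_le_mul_right ?_ _
    -- The split-off term j = 0 takes the unweighted integral of the Hardy step; the terms j + 1
    -- match the induction hypothesis at order i + 1.
    rw [Finset.sum_range_succ', ENNReal.ofReal_add hC₁ zero_le_one, ENNReal.ofReal_one, add_mul,
      one_mul]
    refine add_le_add (h3.trans (mul_le_mul_right ?_ _)) (by simp)
    refine le_trans (le_of_eq (Finset.sum_congr rfl fun j _ => ?_)) le_self_add
    rw [show i + 1 + j = i + (j + 1) by ring]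

end ConeHardy

/-! ### The Sobolev norms are seminorms -/

section Norms

set_option maxSynthPendingDepth 3
set_option linter.unusedSectionVars false

/-- Rules out the zero seminorm that `formulaSeminorm` takes as default value, so the completions
are those of the intended norms. -/
lemma formulaSeminorm_apply {V : Type*} [AddCommGroup V] [Module ℝ V] {N : V → ℝ}
    (hadd : ∀ u v, N (u + v) ≤ N u + N v) (hsmul : ∀ (a : ℝ) u, N (a • u) = |a| * N u) (u : V) :
    formulaSeminorm N u = N u := by
  have h : ∃ q : Seminorm ℝ V, ∀ u, q u = N u := ⟨Seminorm.of N hadd hsmul, fun _ => rfl⟩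
  rw [formulaSeminorm, dif_pos h]
  exact h.choose_spec u

/-- Comparable seminorms have isomorphic completions. -/
lemma exists_completion_equiv {V : Type*} [AddCommGroup V] [Module ℝ V] {N₁ N₂ : V → ℝ} {C : ℝ}
    (h₁ : ∀ u, formulaSeminorm N₁ u = N₁ u) (h₂ : ∀ u, formulaSeminorm N₂ u = N₂ u)
    (h12 : ∀ u, N₁ u ≤ N₂ u) (h21 : ∀ u, N₂ u ≤ C * N₁ u) :
    ∃ e : NormCompletion N₂ ≃L[ℝ] NormCompletion N₁,
      ∀ u, e (toCompletion N₂ u) = toCompletion N₁ u := by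
  have n₁ : ∀ u : Normed N₁, ‖u‖ = N₁ u := h₁
  have n₂ : ∀ u : Normed N₂, ‖u‖ = N₂ u := h₂
  let l₁ : Normed N₂ →ₗ[ℝ] Normed N₁ := (LinearMap.id : V →ₗ[ℝ] V)
  let l₂ : Normed N₁ →ₗ[ℝ] Normed N₂ := (LinearMap.id : V →ₗ[ℝ] V)
  let f₁ : Normed N₂ →L[ℝ] Normed N₁ := l₁.mkContinuous 1 fun u => by
    rw [n₁, n₂, one_mul]; exact h12 u
  let f₂ : Normed N₁ →L[ℝ] Normed N₂ := l₂.mkContinuous C fun u => by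
    rw [n₁, n₂]; exact h21 u
  refine ⟨ContinuousLinearEquiv.equivOfInverse f₁.completion f₂.completion (fun y => ?_)
    (fun y => ?_), fun u => f₁.completion_apply_coe u⟩
  · induction y using UniformSpace.Completion.induction_on with
    | hp => exact isClosed_eq (f₂.completion.continuous.comp f₁.completion.continuous) continuous_id
    | ih u => rw [ContinuousLinearMap.completion_apply_coe,
        ContinuousLinearMap.completion_apply_coe]; rfl
  · induction y using UniformSpace.Completion.induction_on with
    | hp => exact isClosed_eq (f₁.completion.continuous.comp f₂.completion.continuous) continuous_id
    | ih u => rw [ContinuousLinearMap.completion_apply_coe,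
        ContinuousLinearMap.completion_apply_coe]; rfl

variable {n : ℕ} {X : Type*} [TopologicalSpace X] [ChartedSpace (EuclideanSpace ℝ (Fin n)) X]
  [RiemannianBundle (fun y : X => TangentSpace (𝓡 n) y)]

/-- The integrand of a Sobolev norm with the weights `χ ^ e i`. -/
def sobolevDensity (χ : X → ℝ) (e : ℕ → ℝ) (k : ℕ) (p : ℝ) (u : X → ℝ) (y : X) : ℝ :=
  ∑ i ∈ Finset.range (k + 1), χ y ^ e i * covDerivNorm (n := n) u i y ^ p

variable [IsManifold (𝓡 n) ∞ X] [IsContMDiffRiemannianBundle (𝓡 n) ∞ (EuclideanSpace ℝ (Fin n))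
    (fun y : X => TangentSpace (𝓡 n) y)]

lemma sobolevDensity_nonneg {χ : X → ℝ} (hχ : ∀ y, 0 < χ y) (e : ℕ → ℝ) (k : ℕ) (p : ℝ)
    (u : X → ℝ) (y : X) : 0 ≤ sobolevDensity (n := n) χ e k p u y :=
  Finset.sum_nonneg fun _ _ => mul_nonneg (Real.rpow_nonneg (hχ y).le _)
    (Real.rpow_nonneg (covDerivNorm_nonneg _ _ _) _)

lemma continuous_sobolevDensity {χ : X → ℝ} (hχc : Continuous χ) (hχ : ∀ y, 0 < χ y)
    (e : ℕ → ℝ) (k : ℕ) {p : ℝ} (hp : 0 ≤ p) {u : X → ℝ} (hu : ContMDiff (𝓡 n) 𝓘(ℝ, ℝ) ∞ u) :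
    Continuous (sobolevDensity (n := n) χ e k p u) :=
  continuous_finsetSum _ fun i _ =>
    (hχc.rpow_const fun y => Or.inl (hχ y).ne').mul
      ((continuous_covDerivNorm hu i).rpow_const fun _ => Or.inr hp)

lemma sobolevDensity_eq_zero (χ : X → ℝ) (e : ℕ → ℝ) (k : ℕ) {p : ℝ} (hp : 0 < p) {u : X → ℝ}
    (hu : ContMDiff (𝓡 n) 𝓘(ℝ, ℝ) ∞ u) {y : X} (hy : y ∉ tsupport u) :
    sobolevDensity (n := n) χ e k p u y = 0 :=
  Finset.sum_eq_zero fun i _ => by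
    rw [covDerivNorm_eq_zero hu i hy, Real.zero_rpow hp.ne', mul_zero]

/-- Absorbing the weight as χ^{e i / p} into the i-th norm makes the density the p-th power of an
ℓ^p norm over i; then the finite Minkowski inequality applies. -/
lemma sobolevDensity_add_le {χ : X → ℝ} (hχ : ∀ y, 0 < χ y) (e : ℕ → ℝ) (k : ℕ) {p : ℝ}
    (hp : 1 < p) {u v : X → ℝ} (hu : ContMDiff (𝓡 n) 𝓘(ℝ, ℝ) ∞ u)
    (hv : ContMDiff (𝓡 n) 𝓘(ℝ, ℝ) ∞ v) (y : X) :
    sobolevDensity (n := n) χ e k p (u + v) y ^ (1 / p)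
      ≤ sobolevDensity (n := n) χ e k p u y ^ (1 / p)
        + sobolevDensity (n := n) χ e k p v y ^ (1 / p) := by
  have hp0 : 0 < p := by linarith
  have h0 : ∀ i, 0 ≤ χ y ^ (e i / p) := fun i => Real.rpow_nonneg (hχ y).le _
  have key : ∀ w : X → ℝ, sobolevDensity (n := n) χ e k p w y
      = ∑ i ∈ Finset.range (k + 1), (χ y ^ (e i / p) * covDerivNorm (n := n) w i y) ^ p :=
    fun w => Finset.sum_congr rfl fun i _ => by
      rw [Real.mul_rpow (h0 i) (covDerivNorm_nonneg _ _ _), ← Real.rpow_mul (hχ y).le,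
        div_mul_cancel₀ _ hp0.ne']
  rw [key, key, key]
  refine le_trans ?_ (Real.Lp_add_le_of_nonneg (Finset.range (k + 1)) hp.le
    (fun i _ => mul_nonneg (h0 i) (covDerivNorm_nonneg _ _ _))
    (fun i _ => mul_nonneg (h0 i) (covDerivNorm_nonneg _ _ _)))
  refine Real.rpow_le_rpow (Finset.sum_nonneg fun i _ => Real.rpow_nonneg
    (mul_nonneg (h0 i) (covDerivNorm_nonneg _ _ _)) _) ?_ (by positivity)
  refine Finset.sum_le_sum fun i _ => Real.rpow_le_rpow
    (mul_nonneg (h0 i) (covDerivNorm_nonneg _ _ _)) ?_ hp0.le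
  rw [← mul_add]
  exact mul_le_mul_of_nonneg_left (covDerivNorm_add_le hu hv i y) (h0 i)

lemma sobolevDensity_smul (χ : X → ℝ) (e : ℕ → ℝ) (k : ℕ) (p : ℝ)
    {u : X → ℝ} (hu : ContMDiff (𝓡 n) 𝓘(ℝ, ℝ) ∞ u) (a : ℝ) (y : X) :
    sobolevDensity (n := n) χ e k p (a • u) y
      = |a| ^ p * sobolevDensity (n := n) χ e k p u y := by
  rw [sobolevDensity, sobolevDensity, Finset.mul_sum]
  refine Finset.sum_congr rfl fun i _ => ?_
  rw [covDerivNorm_smul hu, Real.mul_rpow (abs_nonneg a) (covDerivNorm_nonneg _ _ _)]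
  ring

/-- Minkowski's inequality for functions given by their `p`-th powers. -/
lemma integral_rpow_le_of_rpow_le {X : Type*} [TopologicalSpace X] [MeasurableSpace X]
    [OpensMeasurableSpace X] {μ : Measure X} [IsFiniteMeasureOnCompacts μ] {p : ℝ} (hp : 1 < p) {F G H : X → ℝ}
    (hF : Continuous F) (hG : Continuous G) (hH : Continuous H)
    (sF : HasCompactSupport F) (sG : HasCompactSupport G)
    (sH : HasCompactSupport H) (hF0 : ∀ y, 0 ≤ F y) (hG0 : ∀ y, 0 ≤ G y) (hH0 : ∀ y, 0 ≤ H y)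
    (h : ∀ y, H y ^ (1 / p) ≤ F y ^ (1 / p) + G y ^ (1 / p)) :
    (∫ y, H y ∂μ) ^ (1 / p) ≤ (∫ y, F y ∂μ) ^ (1 / p) + (∫ y, G y ∂μ) ^ (1 / p) := by
  have hp0 : 0 < p := by linarith
  have hpt : (ENNReal.ofReal p).toReal = p := ENNReal.toReal_ofReal hp0.le
  have hp1 : 1 ≤ ENNReal.ofReal p := by simpa using ENNReal.ofReal_le_ofReal hp.le
  -- The p-th root of a continuous nonnegative function of compact support lies in L^p, and its L^p
  -- norm is the p-th root of the integral; this makes the Minkowski inequality of L^p available.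
  have key : ∀ K : X → ℝ, Continuous K → HasCompactSupport K → (∀ y, 0 ≤ K y) →
      MemLp (fun y => K y ^ (1 / p)) (ENNReal.ofReal p) μ ∧
        eLpNorm (fun y => K y ^ (1 / p)) (ENNReal.ofReal p) μ
          = ENNReal.ofReal ((∫ y, K y ∂μ) ^ (1 / p)) := by
    intro K hK sK hK0
    have h1 : MemLp (fun y => K y ^ (1 / p)) (ENNReal.ofReal p) μ :=
      (hK.rpow_const fun _ => Or.inr (by positivity)).memLp_of_hasCompactSupport
        (sK.comp_left (g := fun t : ℝ => t ^ (1 / p)) (Real.zero_rpow (by positivity)))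
    refine ⟨h1, ?_⟩
    rw [h1.eLpNorm_eq_integral_rpow_norm (by simpa using hp0) ENNReal.ofReal_ne_top, hpt, one_div]
    congr 2
    refine integral_congr_ae (Eventually.of_forall fun y => ?_)
    dsimp only
    rw [Real.norm_of_nonneg (Real.rpow_nonneg (hK0 y) _), ← Real.rpow_mul (hK0 y),
      inv_mul_cancel₀ hp0.ne', Real.rpow_one]
  obtain ⟨mF, eF⟩ := key F hF sF hF0
  obtain ⟨mG, eG⟩ := key G hG sG hG0
  obtain ⟨mH, eH⟩ := key H hH sH hH0
  have nF : 0 ≤ (∫ y, F y ∂μ) ^ (1 / p) := Real.rpow_nonneg (integral_nonneg hF0) _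
  have nG : 0 ≤ (∫ y, G y ∂μ) ^ (1 / p) := Real.rpow_nonneg (integral_nonneg hG0) _
  rw [← ENNReal.ofReal_le_ofReal_iff (add_nonneg nF nG), ENNReal.ofReal_add nF nG, ← eF, ← eG,
    ← eH]
  refine le_trans (eLpNorm_mono_real fun y => ?_) (eLpNorm_add_le mF.1 mG.1 hp1)
  rw [Real.norm_of_nonneg (Real.rpow_nonneg (hH0 y) _)]
  exact h y

variable [MeasurableSpace X] [BorelSpace X] [SecondCountableTopology X] [R1Space X]

/-- A Sobolev norm with the weights `χ ^ e i`. -/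
def powerSobolevNorm (χ : X → ℝ) (e : ℕ → ℝ) (k : ℕ) (p : ℝ) (u : TestFunctions n X) : ℝ :=
  (∫ y, sobolevDensity (n := n) χ e k p u y ∂(riemannianVolume n X)) ^ (1 / p)

lemma hasCompactSupport_sobolevDensity (χ : X → ℝ) (e : ℕ → ℝ) (k : ℕ) {p : ℝ} (hp : 0 < p)
    (u : TestFunctions n X) : HasCompactSupport (sobolevDensity (n := n) χ e k p u) :=
  HasCompactSupport.intro u.2.2.isCompact fun _ hy => sobolevDensity_eq_zero χ e k hp u.2.1 hy

lemma integrable_sobolevDensity {χ : X → ℝ} (hχc : Continuous χ) (hχ : ∀ y, 0 < χ y)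
    (e : ℕ → ℝ) (k : ℕ) {p : ℝ} (hp : 0 < p) (u : TestFunctions n X) :
    Integrable (sobolevDensity (n := n) χ e k p u) (riemannianVolume n X) :=
  (continuous_sobolevDensity hχc hχ e k hp.le u.2.1).integrable_of_hasCompactSupport
    (hasCompactSupport_sobolevDensity χ e k hp u)

/-- Subadditivity is Minkowski twice: in ℓ^p over the order of derivative at each point, then in L^p
over the manifold. The weights are kept general so that both Sobolev norms are covered. -/
lemma formulaSeminorm_powerSobolevNorm {χ : X → ℝ} (hχc : Continuous χ) (hχ : ∀ y, 0 < χ y)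
    (e : ℕ → ℝ) (k : ℕ) {p : ℝ} (hp : 1 < p) (u : TestFunctions n X) :
    formulaSeminorm (powerSobolevNorm (n := n) χ e k p) u = powerSobolevNorm χ e k p u := by
  have hp0 : 0 < p := by linarith
  refine formulaSeminorm_apply (fun u v => ?_) (fun a u => ?_) u
  · exact integral_rpow_le_of_rpow_le hp
      (continuous_sobolevDensity hχc hχ e k hp0.le u.2.1)
      (continuous_sobolevDensity hχc hχ e k hp0.le v.2.1)
      (continuous_sobolevDensity hχc hχ e k hp0.le (u + v).2.1)
      (hasCompactSupport_sobolevDensity χ e k hp0 u)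
      (hasCompactSupport_sobolevDensity χ e k hp0 v)
      (hasCompactSupport_sobolevDensity χ e k hp0 (u + v))
      (sobolevDensity_nonneg hχ e k p _) (sobolevDensity_nonneg hχ e k p _)
      (sobolevDensity_nonneg hχ e k p _)
      (sobolevDensity_add_le hχ e k hp u.2.1 v.2.1)
  · have h1 : ∀ y, sobolevDensity (n := n) χ e k p ((a • u : TestFunctions n X) : X → ℝ) y
        = |a| ^ p * sobolevDensity (n := n) χ e k p u y := sobolevDensity_smul χ e k p u.2.1 a
    rw [powerSobolevNorm, powerSobolevNorm]
    simp only [h1]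
    rw [integral_const_mul, Real.mul_rpow (Real.rpow_nonneg (abs_nonneg a) _)
      (integral_nonneg (sobolevDensity_nonneg hχ e k p _)), ← Real.rpow_mul (abs_nonneg a),
      mul_one_div_cancel hp0.ne', Real.rpow_one]

end Norms

/-! ### Comparison of the norms on a manifold with a conical singularity -/

section Comparison

set_option maxSynthPendingDepth 3
set_option linter.unusedSectionVars false

variable {m : ℕ} {M : Type*} [MetricSpace M] {x : M}
  [ChartedSpace (EuclideanSpace ℝ (Fin (m + 1))) {y : M // y ≠ x}]
  [RiemannianBundle (fun y : {y : M // y ≠ x} => TangentSpace (𝓡 (m + 1)) y)]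
  {N : Type*} [TopologicalSpace N] [ChartedSpace (EuclideanSpace ℝ (Fin m)) N]
  [IsManifold (𝓡 m) ∞ N]
  [MeasurableSpace M] [BorelSpace M]

lemma sobolevNorm_eq (χ : {y : M // y ≠ x} → ℝ) (k : ℕ) (p : ℝ) :
    sobolevNorm (n := m + 1) (X := {y : M // y ≠ x}) k p
      = powerSobolevNorm (n := m + 1) χ (fun _ => 0) k p := by
  funext u
  simp [sobolevNorm, powerSobolevNorm, sobolevDensity]

/-- For δ = k - n/p the n in the exponent cancels, leaving p(k - i), which is zero at top order i =
k. -/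
lemma weightedSobolevNorm_eq (χ : {y : M // y ≠ x} → ℝ) (k : ℕ) {p : ℝ} (hp : p ≠ 0) :
    weightedSobolevNorm (n := m + 1) (X := {y : M // y ≠ x}) χ k p (k - ((m + 1 : ℕ) : ℝ) / p)
      = powerSobolevNorm (n := m + 1) χ (fun i => p * (k - i)) k p := by
  funext u
  have h1 : ∀ i : ℕ, p * ((k : ℝ) - ((m + 1 : ℕ) : ℝ) / p - i) + ((m + 1 : ℕ) : ℝ)
      = p * (k - i) := fun i => by
    field_simp
    ring
  simp only [weightedSobolevNorm, powerSobolevNorm, sobolevDensity, h1]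

variable [IsManifold (𝓡 (m + 1)) ∞ {y : M // y ≠ x}]
    [IsContMDiffRiemannianBundle (𝓡 (m + 1)) ∞ (EuclideanSpace ℝ (Fin (m + 1)))
      (fun y : {y : M // y ≠ x} => TangentSpace (𝓡 (m + 1)) y)] [SecondCountableTopology M]

/-- The norms are Bochner integrals, the Hardy estimates are integrals in [0, ∞]. Integrability of
the density makes the passage exact and splits it by order of derivative. -/
lemma ofReal_integral_sobolevDensity {U : ConicalNeighborhood (m := m) x N}
    {χ : {y : M // y ≠ x} → ℝ} (hχ : U.IsWeight χ) (s : ℕ → ℝ) (k : ℕ) {p : ℝ} (hp : 0 < p)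
    (u : TestFunctions (m + 1) {y : M // y ≠ x}) :
    ENNReal.ofReal (∫ y, sobolevDensity (n := m + 1) χ (fun i => p * s i) k p u y
        ∂(riemannianVolume (m + 1) {y : M // y ≠ x}))
      = ∑ i ∈ Finset.range (k + 1), ∫⁻ y, weightedEnergy (m := m) χ u p (s i) i y
        ∂(riemannianVolume (m + 1) {y : M // y ≠ x}) := by
  rw [ofReal_integral_eq_lintegral_ofReal
    (integrable_sobolevDensity hχ.smooth.continuous hχ.pos _ k hp u)
    (Eventually.of_forall (sobolevDensity_nonneg hχ.pos _ k p _)),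
    ← lintegral_finsetSum _ fun i _ =>
      (continuous_weightedEnergy hχ u.2.1 hp.le (s i) i).measurable]
  refine lintegral_congr fun y => ?_
  rw [sobolevDensity, ENNReal.ofReal_sum_of_nonneg]
  · rfl
  · exact fun i _ => mul_nonneg (Real.rpow_nonneg (hχ.pos y).le _)
      (Real.rpow_nonneg (covDerivNorm_nonneg _ _ _) _)

/-- Pointwise: χ ≥ 1, and its exponents p(k - i) are nonnegative for i ≤ k. -/
lemma sobolevNorm_le_weightedSobolevNorm {U : ConicalNeighborhood (m := m) x N}
    {χ : {y : M // y ≠ x} → ℝ} (hχ : U.IsWeight χ) (k : ℕ) {p : ℝ} (hp : 0 < p)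
    (u : TestFunctions (m + 1) {y : M // y ≠ x}) :
    powerSobolevNorm (n := m + 1) χ (fun _ => 0) k p u
      ≤ powerSobolevNorm (n := m + 1) χ (fun i => p * (k - i)) k p u := by
  refine Real.rpow_le_rpow (integral_nonneg (sobolevDensity_nonneg hχ.pos _ k p _)) ?_
    (by positivity)
  refine integral_mono (integrable_sobolevDensity hχ.smooth.continuous hχ.pos _ k hp u)
    (integrable_sobolevDensity hχ.smooth.continuous hχ.pos _ k hp u) fun y => ?_
  refine Finset.sum_le_sum fun i hi => mul_le_mul_of_nonneg_right ?_
    (Real.rpow_nonneg (covDerivNorm_nonneg _ _ _) _)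
  have hik : (i : ℝ) ≤ k := by
    exact_mod_cast Nat.lt_succ_iff.1 (Finset.mem_range.1 hi)
  exact Real.rpow_le_rpow_of_exponent_le (hχ.one_le y)
    (mul_nonneg hp.le (sub_nonneg.2 hik))

lemma exists_weightedSobolevNorm_le [CompactSpace M] [CompactSpace N]
    {U : ConicalNeighborhood (m := m) x N}
    {χ : {y : M // y ≠ x} → ℝ} (hχ : U.IsWeight χ) (k : ℕ) {p : ℝ} (hp : 1 < p)
    (hpk : ∀ i : ℕ, 1 ≤ i → i ≤ k → p * (i : ℝ) ≠ ((m + 1 : ℕ) : ℝ)) :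
    ∃ C : ℝ, ∀ u : TestFunctions (m + 1) {y : M // y ≠ x},
      powerSobolevNorm (n := m + 1) χ (fun i => p * (k - i)) k p u
        ≤ C * powerSobolevNorm (n := m + 1) χ (fun _ => 0) k p u := by
  have hp0 : 0 < p := by linarith
  have h1 : ∀ i : ℕ, ∃ C : ℝ, 0 ≤ C ∧ (i ≤ k → ∀ u : TestFunctions (m + 1) {y : M // y ≠ x},
      ∫⁻ y, weightedEnergy (m := m) χ u p (k - i) i y ∂(riemannianVolume (m + 1) {y : M // y ≠ x})
        ≤ ENNReal.ofReal C * ∑ j ∈ Finset.range (k + 1),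
          ∫⁻ y, weightedEnergy (m := m) χ u p 0 j y
            ∂(riemannianVolume (m + 1) {y : M // y ≠ x})) := by
    intro i
    by_cases hi : i ≤ k
    · obtain ⟨C, hC0, hC⟩ := exists_weightedEnergy_le hχ hp (k - i)
        fun j hj1 hj2 => hpk j hj1 (hj2.trans (Nat.sub_le _ _))
      refine ⟨C, hC0, fun _ u => ?_⟩
      have h2 := hC u u.2.1 u.2.2 i
      rw [Nat.cast_sub hi] at h2
      refine h2.trans (mul_le_mul_right ?_ _)
      have h3 := Finset.sum_image (s := Finset.range (k - i + 1)) (g := fun j => i + j)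
        (f := fun j => ∫⁻ y, weightedEnergy (m := m) χ u p 0 j y
            ∂(riemannianVolume (m + 1) {y : M // y ≠ x}))
        (fun a _ b _ h => Nat.add_left_cancel h)
      rw [← h3]
      refine Finset.sum_le_sum_of_subset fun j hj => ?_
      obtain ⟨l, hl, rfl⟩ := Finset.mem_image.1 hj
      rw [Finset.mem_range] at hl ⊢
      omega
    -- Orders above k do not occur; any constant serves, so that `choose` yields a function on all
    -- of ℕ.
    · exact ⟨0, le_rfl, fun h => absurd h hi⟩
  choose C hC0 hC using h1
  set D := ∑ i ∈ Finset.range (k + 1), C i with hD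
  have hD0 : 0 ≤ D := Finset.sum_nonneg fun i _ => hC0 i
  -- Each weighted term is bounded by C i times the full unweighted energy, so the energies compare
  -- with D = ∑ C i and the norms with its p-th root.
  refine ⟨D ^ (1 / p), fun u => ?_⟩
  have h0 : 0 ≤ ∫ y, sobolevDensity (n := m + 1) χ (fun _ => 0) k p u y
      ∂(riemannianVolume (m + 1) {y : M // y ≠ x}) :=
    integral_nonneg (sobolevDensity_nonneg hχ.pos (fun _ => 0) k p u)
  rw [powerSobolevNorm, powerSobolevNorm, ← Real.mul_rpow hD0 h0]
  refine Real.rpow_le_rpow (integral_nonneg (sobolevDensity_nonneg hχ.pos _ k p _)) ?_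
    (by positivity)
  rw [← ENNReal.ofReal_le_ofReal_iff (mul_nonneg hD0 h0), ENNReal.ofReal_mul hD0,
    ofReal_integral_sobolevDensity hχ (fun i => (k : ℝ) - i) k hp0 u]
  have h3 := ofReal_integral_sobolevDensity hχ (fun _ => 0) k hp0 u
  simp only [mul_zero] at h3
  rw [h3, hD, ENNReal.ofReal_sum_of_nonneg fun i _ => hC0 i, Finset.sum_mul]
  exact Finset.sum_le_sum fun i hi => hC i (Nat.lt_succ_iff.1 (Finset.mem_range.1 hi)) u

end Comparison

end ConicalSobolev

end

/-! ### The theorem: seminorm property, equivalence of the norms, isomorphism of the completions. -/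

theorem mainTheorem4 {m : ℕ}
    {M : Type*} [MetricSpace M] [CompactSpace M] [MeasurableSpace M] [BorelSpace M] (x : M)
    [ChartedSpace (EuclideanSpace ℝ (Fin (m + 1))) {y : M // y ≠ x}]
    [IsManifold (𝓡 (m + 1)) ∞ {y : M // y ≠ x}]
    [RiemannianBundle (fun y : {y : M // y ≠ x} => TangentSpace (𝓡 (m + 1)) y)]
    [IsContMDiffRiemannianBundle (𝓡 (m + 1)) ∞ (EuclideanSpace ℝ (Fin (m + 1)))
      (fun y : {y : M // y ≠ x} => TangentSpace (𝓡 (m + 1)) y)]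
    [IsRiemannianManifold (𝓡 (m + 1)) {y : M // y ≠ x}]
    {N : Type*} [TopologicalSpace N] [T2Space N] [CompactSpace N]
    [ChartedSpace (EuclideanSpace ℝ (Fin m)) N] [IsManifold (𝓡 m) ∞ N]
    (U : ConicalSobolev.ConicalNeighborhood (m := m) x N)
    (χ : {y : M // y ≠ x} → ℝ) (hχ : U.IsWeight χ)
    (p : ℝ) (hp : 1 < p) (k : ℕ)
    (hpk : ∀ i : ℕ, 1 ≤ i → i ≤ k → p * (i : ℝ) ≠ ((m + 1 : ℕ) : ℝ)) :
    -- the two expressions are norms: they are the norms of which the completions are taken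
    (∀ u : ConicalSobolev.TestFunctions (m + 1) {y : M // y ≠ x},
      ConicalSobolev.formulaSeminorm (ConicalSobolev.sobolevNorm k p) u
          = ConicalSobolev.sobolevNorm k p u ∧
        ConicalSobolev.formulaSeminorm
            (ConicalSobolev.weightedSobolevNorm χ k p (k - ((m + 1 : ℕ) : ℝ) / p)) u
          = ConicalSobolev.weightedSobolevNorm χ k p (k - ((m + 1 : ℕ) : ℝ) / p) u) ∧
    -- equivalence of the two norms
    (∃ C : ℝ, ∀ u : ConicalSobolev.TestFunctions (m + 1) {y : M // y ≠ x},
      ConicalSobolev.sobolevNorm k p u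
          ≤ ConicalSobolev.weightedSobolevNorm χ k p (k - ((m + 1 : ℕ) : ℝ) / p) u ∧
        ConicalSobolev.weightedSobolevNorm χ k p (k - ((m + 1 : ℕ) : ℝ) / p) u
          ≤ C * ConicalSobolev.sobolevNorm k p u) ∧
    -- equality of the two completions: the identity on test functions extends to an isomorphism
    (∃ e : ConicalSobolev.WeightedSobolevSpace (m + 1) {y : M // y ≠ x} χ k p
          (k - ((m + 1 : ℕ) : ℝ) / p) ≃L[ℝ]
        ConicalSobolev.SobolevSpace (m + 1) {y : M // y ≠ x} k p,
      ∀ u : ConicalSobolev.TestFunctions (m + 1) {y : M // y ≠ x},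
        e (ConicalSobolev.toCompletion
            (ConicalSobolev.weightedSobolevNorm χ k p (k - ((m + 1 : ℕ) : ℝ) / p)) u)
          = ConicalSobolev.toCompletion (ConicalSobolev.sobolevNorm k p) u) := by
  have hp0 : 0 < p := by linarith
  have e1 := ConicalSobolev.sobolevNorm_eq (m := m) (x := x) χ k p
  have e2 := ConicalSobolev.weightedSobolevNorm_eq (m := m) (x := x) χ k hp0.ne'
  have hs := ConicalSobolev.formulaSeminorm_powerSobolevNorm (n := m + 1) hχ.smooth.continuous hχ.pos
    (fun _ => 0) k hp
  have hw := ConicalSobolev.formulaSeminorm_powerSobolevNorm (n := m + 1) hχ.smooth.continuous hχ.pos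
    (fun i => p * (k - i)) k hp
  have hle := ConicalSobolev.sobolevNorm_le_weightedSobolevNorm hχ k hp0
  obtain ⟨C, hC⟩ := ConicalSobolev.exists_weightedSobolevNorm_le hχ k hp hpk
  rw [← e1] at hs hle hC
  rw [← e2] at hw hle hC
  exact ⟨fun u => ⟨hs u, hw u⟩, ⟨C, fun u => ⟨hle u, hC u⟩⟩,
    ConicalSobolev.exists_completion_equiv hs hw hle hC⟩
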